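/- **Theorem 5 (Sublinear convergence).** Let $A\in\mathbb R^{n\times n}$, $B\in\mathbb R^{n\times m_1}$, $C\in\mathbb R^{m_2\times n}$ and let $Q,R,\mathcal W,\mathcal V$ be symmetric positive definite real matrices of sizes $n,m_1,n,m_2$. A controller $\mathcal K=(A_{\mathcal K},B_{\mathcal K},C_{\mathcal K})$ of order $p$ is $\dot{\hat x}=A_{\mathcal K}\hat x+B_{\mathcal K}y$, $u=C_{\mathcal K}\hat x$ with $\hat x\in\mathbb R^p$; $\mathbb K_p$ is the set of those for which $\mathcal A_{\mathcal K}=\begin{bmatrix}A&BC_{\mathcal K}\\B_{\mathcal K}C&A_{\mathcal K}\end{bmatrix}$ has all its eigenvalues in the open left half-plane. For $\mathcal K\in\mathbb K_p$ the LQG cost is $J(\mathcal K)=\lim_{T\to\infty}\frac1T\mathbb E\int_0^T(x_t^\top Qx_t+u_t^\top Ru_t)\,dt$ along $\dot x=Ax+Bu+\omega$, $y=Cx+v$, where $\omega,v$ are independent Gaussian white noises with intensities $\mathcal W,\mathcal V$ and the initial values $x_0,\hat x_0$ are square integrable. Fix $q$ and $\mathcal K_0\in\mathbb K_q$, write $\mathcal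 A=\mathcal A_{\mathcal K_0}$, $B_0=B_{\mathcal K_0}$, $C_0=C_{\mathcal K_0}$, $\bar B=\begin{bmatrix}B&0\\0&I_q\end{bmatrix}$, $\bar C=\begin{bmatrix}C&0\\0&I_q\end{bmatrix}$, $\mathcal B=\begin{bmatrix}\mathcal W^{1/2}&0\\0&B_0\mathcal V^{1/2}\end{bmatrix}$, $\mathcal C=\begin{bmatrix}Q^{1/2}&0\\0&R^{1/2}C_0\end{bmatrix}$, and $$\mathbf M_{11}=\mathcal C(sI-\mathcal A)^{-1}\mathcal B,\quad \mathbf M_{12}=\mathcal C(sI-\mathcal A)^{-1}\bar B+\begin{bmatrix}0&0\\R^{1/2}&0\end{bmatrix},\quad \mathbf M_{21}=\bar C(sI-\mathcal A)^{-1}\mathcal B+\begin{bmatrix}0&\mathcal V^{1/2}\\0&0\end{bmatrix}.$$ Let $\mathbb U$ be the space of pairs $(\mathbf Q,Q)$, where $\mathbf Q$ is an $(m_1+q)\times(m_2+q)$ strictly proper, stable, real rational transfer matrix and $Q$ is a real $(m_1+q)\times(m_2+q)$ matrix whose top left $m_1\times m_2$ block is zero, with the inner product $\langle\mathbf Q,\mathbf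 Q'\rangle_{\mathcal H_2}+\langle Q,Q'\rangle_F$, where $\langle G,H\rangle_{\mathcal H_2}=\int_{-\infty}^\infty\operatorname{tr}(G(j\omega)^*H(j\omega))\frac{d\omega}{2\pi}$. Put $J_{\mathcal K_0}(\mathbf Q,Q)=\|\mathbf M_{11}+\mathbf M_{12}(\mathbf Q+Q)\mathbf M_{21}\|_{\mathcal H_2}^2$, with $\|G\|_{\mathcal H_2}^2=\langle G,G\rangle_{\mathcal H_2}$. Let $\mathcal P,\Sigma$ solve $\mathcal A^\top\mathcal P+\mathcal P\mathcal A=-\begin{bmatrix}Q&0\\0&C_0^\top RC_0\end{bmatrix}$ and $\mathcal A\Sigma+\Sigma\mathcal A^\top=-\begin{bmatrix}\mathcal W&0\\0&B_0\mathcal VB_0^\top\end{bmatrix}$. The algorithm with step size $\eta>0$ starts at $(\mathbf Q_0,Q_0)=(0,0)$ and iterates $\mathbf Q_{k+1}=\mathbf Q_k-\eta\,\mathbf S_k$, $Q_{k+1}=Q_k-\eta\,\mathbf e(\operatorname{Res}_{\Re s\le0}\mathbf S_k)$, where $\operatorname{Res}_{\Re s\le 0}$ is the sum of the residues at the poles in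 $\Re s\le0$, $\mathbf e$ sets the top left $m_1\times m_2$ block to zero, and $\mathbf S_k$ is the stable (strictly proper) part of $$\Bigl(\begin{bmatrix}0&RC_0\\0&0\end{bmatrix}+\bar B^\top\mathcal P\Bigr)(sI-\mathcal A)^{-1}\Bigl(\begin{bmatrix}0&0\\B_0\mathcal V&0\end{bmatrix}+\Sigma\bar C^\top\Bigr)+\mathbf M_{12}(-s)^\top\mathbf M_{12}(s)(\mathbf Q_k(s)+Q_k)\mathbf M_{21}(s)\mathbf M_{21}(-s)^\top .$$ Then $J_{\mathcal K_0}$ is $L$-smooth on $\mathbb U$ for some $L>0$, i.e. it has a Fréchet gradient in $\mathbb U$ at every point of $\mathbb U$ and $J_{\mathcal K_0}(X)\le J_{\mathcal K_0}(Y)+\langle\nabla J_{\mathcal K_0}(Y),X-Y\rangle_{\mathbb U}+\frac L2\|X-Y\|_{\mathbb U}^2$ for all $X,Y\in\mathbb U$. Moreover $J$ attains a minimum $J^\star$ over all stabilizing controllers of all finite orders (the optimal LQG value), $J^\star$ is also the minimum of $J$ over $\mathbb K_q$ if $q\ge n$, and for every such $L=L_{\mathcal K_0}$ and every step size $0<\eta<2/L_{\mathcal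 K_0}$ the iterates stay in $\mathbb U$, satisfy $J_{\mathcal K_0}(\mathbf Q_k,Q_k)\ge J^\star$ and $J_{\mathcal K_0}(\mathbf Q_k,Q_k)\to J^\star$, and there is a constant $c$ with $$J_{\mathcal K_0}(\mathbf Q_k,Q_k)-J^\star\le\frac ck\qquad\text{for all }k\ge1 .$$ -/

import Mathlib

open Matrix MeasureTheory ProbabilityTheory Filter Topology
open scoped NNReal MatrixOrder

noncomputable section

namespace LQG

/-! ### Rational transfer functions with real coefficients -/

/-- `f ↦ f(-s)`. -/
def negVar : RatFunc ℝ →+* RatFunc ℝ :=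
  RatFunc.mapRingHom (Polynomial.algEquivAevalNegX (R := ℝ))
    (nonZeroDivisors_le_comap_nonZeroDivisors_of_injective _
      (Polynomial.algEquivAevalNegX (R := ℝ)).injective)

/-- A real rational function regarded as a complex one. -/
def toComplex : RatFunc ℝ →+* RatFunc ℂ :=
  RatFunc.mapRingHom (Polynomial.mapRingHom (algebraMap ℝ ℂ))
    (nonZeroDivisors_le_comap_nonZeroDivisors_of_injective _
      (Polynomial.map_injective _ (algebraMap ℝ ℂ).injective))

/-- All poles lie in the open left half-plane. -/
def IsStable (f : RatFunc ℝ) : Prop :=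
  ∀ z : ℂ, Polynomial.aeval z f.denom = 0 → z.re < 0

/-- All poles lie in the open right half-plane. -/
def IsAntistable (f : RatFunc ℝ) : Prop :=
  ∀ z : ℂ, Polynomial.aeval z f.denom = 0 → 0 < z.re

/-- `f(s) → 0` as `s → ∞`. -/
def IsStrictlyProper (f : RatFunc ℝ) : Prop :=
  f.num.degree < f.denom.degree

/-- The residue at `z`: the coefficient of `(s - z)⁻¹` in the Laurent expansion of `f` at `z`. -/
def residue (z : ℂ) (f : RatFunc ℂ) : ℂ :=
  (algebraMap (Polynomial ℂ) (LaurentSeries ℂ) (RatFunc.laurent z f).num /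
    algebraMap (Polynomial ℂ) (LaurentSeries ℂ) (RatFunc.laurent z f).denom).coeff (-1)

open Classical in
/-- The sum of the residues of `f` at its poles in `Re s ≤ 0`. Since `f` has real coefficients,
this sum is a real number; it is recorded as such. -/
def residueSum (f : RatFunc ℝ) : ℝ :=
  (∑ z ∈ (toComplex f).denom.roots.toFinset with z.re ≤ 0, residue z (toComplex f)).re

section Transfer

variable {ι κ σ : Type*}

/-- A real matrix as a constant transfer matrix. -/
def const (D : Matrix ι κ ℝ) : Matrix ι κ (RatFunc ℝ) := D.map RatFunc.C

/-- The resolvent `(sI - F)⁻¹`. -/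
def resolvent [Fintype σ] [DecidableEq σ] (F : Matrix σ σ ℝ) : Matrix σ σ (RatFunc ℝ) :=
  ((RatFunc.X : RatFunc ℝ) • (1 : Matrix σ σ (RatFunc ℝ)) - const F)⁻¹

/-- The transfer matrix `H (sI - F)⁻¹ G + D`. -/
def transfer [Fintype σ] [DecidableEq σ] (F : Matrix σ σ ℝ) (G : Matrix σ κ ℝ) (H : Matrix ι σ ℝ) (D : Matrix ι κ ℝ) :
    Matrix ι κ (RatFunc ℝ) :=
  const H * resolvent F * const G + const D

/-- `M(-s)ᵀ`. -/
def paraConj (M : Matrix ι κ (RatFunc ℝ)) : Matrix κ ι (RatFunc ℝ) := (M.map negVar)ᵀ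

/-- The value of a transfer matrix at a complex number. -/
def evalAt (M : Matrix ι κ (RatFunc ℝ)) (s : ℂ) : Matrix ι κ ℂ :=
  M.map (RatFunc.eval (algebraMap ℝ ℂ) s)

/-- The set `RH_{∞,0}` of strictly proper, stable, real rational transfer matrices
(it contains `0`). -/
def RHinf0 (ι κ : Type*) : Set (Matrix ι κ (RatFunc ℝ)) :=
  {M | ∀ i j, IsStable (M i j) ∧ IsStrictlyProper (M i j)}

/-- The inner product `⟨G, H⟩ = (2π)⁻¹ ∫ tr (G(jω)* H(jω)) dω` (a real number for real rational
`G` and `H`, whence the real part). -/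
def h2Inner [Fintype ι] [Fintype κ] (G H : Matrix ι κ (RatFunc ℝ)) : ℝ :=
  (2 * Real.pi)⁻¹ *
    ∫ w : ℝ, (((evalAt G (w * Complex.I))ᴴ * evalAt H (w * Complex.I)).trace).re

/-- The squared `H₂` norm. -/
def h2NormSq [Fintype ι] [Fintype κ] (G : Matrix ι κ (RatFunc ℝ)) : ℝ := h2Inner G G

/-- `S` is the stable part of `N`: `N = S + (N - S)` with `S` stable and strictly proper and
`N - S` antistable. -/
def IsStablePart (N S : Matrix ι κ (RatFunc ℝ)) : Prop :=
  S ∈ RHinf0 ι κ ∧ ∀ i j, IsAntistable ((N - S) i j)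

/-- The operator extracting the stable part. -/
def stablePart (N : Matrix ι κ (RatFunc ℝ)) : Matrix ι κ (RatFunc ℝ) :=
  Classical.epsilon (IsStablePart N)

end Transfer

/-! ### Linear systems and controllers -/

/-- The data of an LQG problem: system matrices `A, B, C`, weights `Q, R` and noise intensities
`W, V`. -/
structure Plant (n m₁ m₂ : ℕ) where
  A : Matrix (Fin n) (Fin n) ℝ
  B : Matrix (Fin n) (Fin m₁) ℝ
  C : Matrix (Fin m₂) (Fin n) ℝ
  Q : Matrix (Fin n) (Fin n) ℝ
  R : Matrix (Fin m₁) (Fin m₁) ℝ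
  W : Matrix (Fin n) (Fin n) ℝ
  V : Matrix (Fin m₂) (Fin m₂) ℝ

/-- A dynamic output-feedback controller `x̂' = A x̂ + B y`, `u = C x̂` of order `q`. -/
structure Controller (q m₁ m₂ : ℕ) where
  A : Matrix (Fin q) (Fin q) ℝ
  B : Matrix (Fin q) (Fin m₂) ℝ
  C : Matrix (Fin m₁) (Fin q) ℝ

variable {n m₁ m₂ q : ℕ}

/-- The closed-loop state matrix. -/
def clA (S : Plant n m₁ m₂) (K : Controller q m₁ m₂) :
    Matrix (Fin n ⊕ Fin q) (Fin n ⊕ Fin q) ℝ :=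
  fromBlocks S.A (S.B * K.C) (K.B * S.C) K.A

/-- All eigenvalues of the closed-loop state matrix have negative real parts. -/
def Stabilizes (S : Plant n m₁ m₂) (K : Controller q m₁ m₂) : Prop :=
  ∀ z ∈ spectrum ℂ ((clA S K).map (algebraMap ℝ ℂ)), z.re < 0

/-! ### The LQG cost -/

section Stochastic

variable {Ω : Type*} [MeasurableSpace Ω]

/-- A `d`-dimensional Wiener process with intensity `Γ` (whose formal derivative is Gaussian white
noise with intensity `Γ`). -/
structure IsWiener {d : ℕ} (P : Measure Ω) (Γ : Matrix (Fin d) (Fin d) ℝ)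
    (w : ℝ≥0 → Ω → Fin d → ℝ) : Prop where
  zero : ∀ᵐ ω ∂P, w 0 ω = 0
  law : ∀ s t : ℝ≥0, s ≤ t → HasLaw (fun ω => WithLp.toLp 2 (w t ω - w s ω))
    (multivariateGaussian 0 (((t : ℝ) - (s : ℝ)) • Γ)) P
  indep : HasIndepIncrements w P
  cont : ∀ᵐ ω ∂P, Continuous fun t => w t ω

/-- `w` and `v` are independent Wiener processes with intensities `W` and `V`. -/
structure IsNoise (S : Plant n m₁ m₂) (P : Measure Ω)
    (w : ℝ≥0 → Ω → Fin n → ℝ) (v : ℝ≥0 → Ω → Fin m₂ → ℝ) : Prop where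
  wiener_w : IsWiener P S.W w
  wiener_v : IsWiener P S.V v
  indep : IndepFun (fun ω t => w t ω) (fun ω t => v t ω) P

/-- `(x, z)` is a trajectory, with square-integrable initial values, of the closed-loop system
`dx = (A x + B C_K z) dt + dw`, `dz = A_K z dt + B_K dy` with observation `dy = C x dt + dv`. -/
structure IsTrajectory (S : Plant n m₁ m₂) (K : Controller q m₁ m₂) (P : Measure Ω)
    (w : ℝ≥0 → Ω → Fin n → ℝ) (v : ℝ≥0 → Ω → Fin m₂ → ℝ)
    (x : ℝ → Ω → Fin n → ℝ) (z : ℝ → Ω → Fin q → ℝ) : Prop where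
  init_x : MemLp (x 0) 2 P
  init_z : MemLp (z 0) 2 P
  cont_x : ∀ᵐ ω ∂P, ContinuousOn (fun t => x t ω) (Set.Ici 0)
  cont_z : ∀ᵐ ω ∂P, ContinuousOn (fun t => z t ω) (Set.Ici 0)
  eq_x : ∀ᵐ ω ∂P, ∀ t : ℝ≥0,
    x t ω = x 0 ω + (∫ s in (0 : ℝ)..t, (S.A *ᵥ x s ω + S.B *ᵥ (K.C *ᵥ z s ω))) + w t ω
  eq_z : ∀ᵐ ω ∂P, ∀ t : ℝ≥0,
    z t ω = z 0 ω + (∫ s in (0 : ℝ)..t, K.A *ᵥ z s ω) +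
      K.B *ᵥ ((∫ s in (0 : ℝ)..t, S.C *ᵥ x s ω) + v t ω)

/-- The cost `∫₀ᵀ (xᵀ Q x + uᵀ R u) dt` accumulated along a path, where `u = C_K z`. -/
def pathCost (S : Plant n m₁ m₂) (K : Controller q m₁ m₂)
    (x : ℝ → Ω → Fin n → ℝ) (z : ℝ → Ω → Fin q → ℝ) (T : ℝ) (ω : Ω) : ℝ :=
  ∫ t in (0 : ℝ)..T,
    (x t ω ⬝ᵥ (S.Q *ᵥ x t ω) + (K.C *ᵥ z t ω) ⬝ᵥ (S.R *ᵥ (K.C *ᵥ z t ω)))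

/-- `J(K) = c`: the closed-loop system has trajectories, and along each of them the expected cost
per unit of time over `[0, T]` is finite and tends to `c` as `T → ∞`. -/
def HasCost (S : Plant n m₁ m₂) (P : Measure Ω)
    (w : ℝ≥0 → Ω → Fin n → ℝ) (v : ℝ≥0 → Ω → Fin m₂ → ℝ)
    (K : Controller q m₁ m₂) (c : ℝ) : Prop :=
  (∃ x z, IsTrajectory S K P w v x z) ∧
  ∀ x z, IsTrajectory S K P w v x z →
    (∀ T : ℝ, 0 < T → Integrable (pathCost S K x z T) P) ∧
    Tendsto (fun T : ℝ => (1 / T) * ∫ ω, pathCost S K x z T ω ∂P) atTop (𝓝 c)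

/-- `c` is the minimum of `J` over the stabilizing controllers of order `q`. -/
def IsOptimalOfOrder (S : Plant n m₁ m₂) (P : Measure Ω)
    (w : ℝ≥0 → Ω → Fin n → ℝ) (v : ℝ≥0 → Ω → Fin m₂ → ℝ) (q : ℕ) (c : ℝ) : Prop :=
  (∃ K : Controller q m₁ m₂, Stabilizes S K ∧ HasCost S P w v K c) ∧
  ∀ K : Controller q m₁ m₂, Stabilizes S K → ∃ c', HasCost S P w v K c' ∧ c ≤ c'

/-- `c` is the minimum of `J` over the stabilizing controllers of arbitrary finite order. -/
def IsOptimalValue (S : Plant n m₁ m₂) (P : Measure Ω)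
    (w : ℝ≥0 → Ω → Fin n → ℝ) (v : ℝ≥0 → Ω → Fin m₂ → ℝ) (c : ℝ) : Prop :=
  (∃ p, ∃ K : Controller p m₁ m₂, Stabilizes S K ∧ HasCost S P w v K c) ∧
  ∀ p, ∀ K : Controller p m₁ m₂, Stabilizes S K → ∃ c', HasCost S P w v K c' ∧ c ≤ c'

end Stochastic

/-! ### The lifted problem -/

/-- `ℬ = diag (W^{1/2}, B_K V^{1/2})`. -/
def clB (S : Plant n m₁ m₂) (K : Controller q m₁ m₂) :
    Matrix (Fin n ⊕ Fin q) (Fin n ⊕ Fin m₂) ℝ :=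
  fromBlocks (CFC.sqrt S.W) 0 0 (K.B * CFC.sqrt S.V)

/-- `𝒞 = diag (Q^{1/2}, R^{1/2} C_K)`. -/
def clC (S : Plant n m₁ m₂) (K : Controller q m₁ m₂) :
    Matrix (Fin n ⊕ Fin m₁) (Fin n ⊕ Fin q) ℝ :=
  fromBlocks (CFC.sqrt S.Q) 0 0 (CFC.sqrt S.R * K.C)

/-- `diag (B, I)`. -/
def extB (S : Plant n m₁ m₂) (q : ℕ) : Matrix (Fin n ⊕ Fin q) (Fin m₁ ⊕ Fin q) ℝ :=
  fromBlocks S.B 0 0 1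

/-- `diag (C, I)`. -/
def extC (S : Plant n m₁ m₂) (q : ℕ) : Matrix (Fin m₂ ⊕ Fin q) (Fin n ⊕ Fin q) ℝ :=
  fromBlocks S.C 0 0 1

/-- `M₁₁ = 𝒞 (sI - 𝒜)⁻¹ ℬ`. -/
def M11 (S : Plant n m₁ m₂) (K : Controller q m₁ m₂) :
    Matrix (Fin n ⊕ Fin m₁) (Fin n ⊕ Fin m₂) (RatFunc ℝ) :=
  transfer (clA S K) (clB S K) (clC S K) 0

/-- `M₁₂ = 𝒞 (sI - 𝒜)⁻¹ diag (B, I) + [0 0; R^{1/2} 0]`. -/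
def M12 (S : Plant n m₁ m₂) (K : Controller q m₁ m₂) :
    Matrix (Fin n ⊕ Fin m₁) (Fin m₁ ⊕ Fin q) (RatFunc ℝ) :=
  transfer (clA S K) (extB S q) (clC S K) (fromBlocks 0 0 (CFC.sqrt S.R) 0)

/-- `M₂₁ = diag (C, I) (sI - 𝒜)⁻¹ ℬ + [0 V^{1/2}; 0 0]`. -/
def M21 (S : Plant n m₁ m₂) (K : Controller q m₁ m₂) :
    Matrix (Fin m₂ ⊕ Fin q) (Fin n ⊕ Fin m₂) (RatFunc ℝ) :=
  transfer (clA S K) (clB S K) (extC S q) (fromBlocks 0 (CFC.sqrt S.V) 0 0)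

/-- Pairs `(𝐐, Q)` of a transfer matrix and a real matrix of the same size. -/
abbrev Param (q m₁ m₂ : ℕ) : Type :=
  Matrix (Fin m₁ ⊕ Fin q) (Fin m₂ ⊕ Fin q) (RatFunc ℝ) ×
    Matrix (Fin m₁ ⊕ Fin q) (Fin m₂ ⊕ Fin q) ℝ

/-- The parameter space `𝕌`: `𝐐 ∈ RH_{∞,0}`, and the top left `m₁ × m₂` block of `Q` is zero. -/
def paramSpace (q m₁ m₂ : ℕ) : Set (Param q m₁ m₂) :=
  {X | X.1 ∈ RHinf0 (Fin m₁ ⊕ Fin q) (Fin m₂ ⊕ Fin q) ∧ X.2.toBlocks₁₁ = 0}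

/-- `⟨(𝐐, Q), (𝐐', Q')⟩ = ⟨𝐐, 𝐐'⟩_{H₂} + ⟨Q, Q'⟩_F`. -/
def paramInner (X Y : Param q m₁ m₂) : ℝ := h2Inner X.1 Y.1 + (X.2ᵀ * Y.2).trace

/-- The norm of `𝕌`. -/
def paramNorm (X : Param q m₁ m₂) : ℝ := Real.sqrt (paramInner X X)

/-- The transfer matrix `𝐐 + Q`. -/
def Param.toTransfer (X : Param q m₁ m₂) :
    Matrix (Fin m₁ ⊕ Fin q) (Fin m₂ ⊕ Fin q) (RatFunc ℝ) := X.1 + const X.2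

/-- The lifted cost `J_K(𝐐, Q) = ‖M₁₁ + M₁₂ (𝐐 + Q) M₂₁‖²_{H₂}`. -/
def liftedCost (S : Plant n m₁ m₂) (K : Controller q m₁ m₂) (X : Param q m₁ m₂) : ℝ :=
  h2NormSq (M11 S K + M12 S K * Param.toTransfer X * M21 S K)

/-- `g ∈ 𝕌` is the Fréchet gradient of `J_K : 𝕌 → ℝ` at `X`. -/
def IsGradient (S : Plant n m₁ m₂) (K : Controller q m₁ m₂) (X g : Param q m₁ m₂) : Prop :=
  g ∈ paramSpace q m₁ m₂ ∧
  ∀ ε : ℝ, 0 < ε → ∃ δ : ℝ, 0 < δ ∧ ∀ H ∈ paramSpace q m₁ m₂, paramNorm H ≤ δ →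
    |liftedCost S K (X + H) - liftedCost S K X - paramInner g H| ≤ ε * paramNorm H

/-- `J_K` is `L`-smooth on `𝕌`. -/
def IsSmoothnessConstant (S : Plant n m₁ m₂) (K : Controller q m₁ m₂) (L : ℝ) : Prop :=
  0 < L ∧ ∀ X ∈ paramSpace q m₁ m₂, ∀ Y ∈ paramSpace q m₁ m₂, ∃ g, IsGradient S K Y g ∧
    liftedCost S K X ≤
      liftedCost S K Y + paramInner g (X - Y) + L / 2 * paramNorm (X - Y) ^ 2

/-! ### The algorithm -/

/-- The solution `X` of the Lyapunov equation `F X + X Fᵀ = -M`. -/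
def lyapunov {σ : Type*} [Fintype σ] (F M : Matrix σ σ ℝ) : Matrix σ σ ℝ :=
  Classical.epsilon fun X => F * X + X * Fᵀ = -M

/-- `𝒫`, with `𝒜ᵀ 𝒫 + 𝒫 𝒜 = -diag (Q, C_Kᵀ R C_K)`. -/
def gramP (S : Plant n m₁ m₂) (K : Controller q m₁ m₂) :
    Matrix (Fin n ⊕ Fin q) (Fin n ⊕ Fin q) ℝ :=
  lyapunov (clA S K)ᵀ (fromBlocks S.Q 0 0 (K.Cᵀ * S.R * K.C))

/-- `Σ`, with `𝒜 Σ + Σ 𝒜ᵀ = -diag (W, B_K V B_Kᵀ)`. -/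
def gramSigma (S : Plant n m₁ m₂) (K : Controller q m₁ m₂) :
    Matrix (Fin n ⊕ Fin q) (Fin n ⊕ Fin q) ℝ :=
  lyapunov (clA S K) (fromBlocks S.W 0 0 (K.B * S.V * K.Bᵀ))

def algB0 (S : Plant n m₁ m₂) (K : Controller q m₁ m₂) :
    Matrix (Fin n ⊕ Fin q) (Fin m₂ ⊕ Fin q) ℝ :=
  fromBlocks 0 0 (K.B * S.V) 0

def algC0 (S : Plant n m₁ m₂) (q : ℕ) : Matrix (Fin n ⊕ Fin q) (Fin m₂ ⊕ Fin q) ℝ :=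
  -fromBlocks S.Cᵀ 0 0 1

def algB1 (S : Plant n m₁ m₂) (q : ℕ) : Matrix (Fin m₁ ⊕ Fin q) (Fin n ⊕ Fin q) ℝ :=
  -fromBlocks S.Bᵀ 0 0 1

def algC1 (S : Plant n m₁ m₂) (K : Controller q m₁ m₂) :
    Matrix (Fin m₁ ⊕ Fin q) (Fin n ⊕ Fin q) ℝ :=
  fromBlocks 0 (S.R * K.C) 0 0

/-- The search direction `𝐒(s)` at the pair `X = (𝐐, Q)`. -/
def searchDir (S : Plant n m₁ m₂) (K : Controller q m₁ m₂) (X : Param q m₁ m₂) :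
    Matrix (Fin m₁ ⊕ Fin q) (Fin m₂ ⊕ Fin q) (RatFunc ℝ) :=
  stablePart
    (transfer (clA S K) (algB0 S K - gramSigma S K * algC0 S q)
        (algC1 S K - algB1 S q * gramP S K) 0 +
      paraConj (M12 S K) * M12 S K * Param.toTransfer X * M21 S K * paraConj (M21 S K))

/-- The operator that sets the top left `m₁ × m₂` block to zero. -/
def zeroBlock (D : Matrix (Fin m₁ ⊕ Fin q) (Fin m₂ ⊕ Fin q) ℝ) :
    Matrix (Fin m₁ ⊕ Fin q) (Fin m₂ ⊕ Fin q) ℝ :=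
  fromBlocks 0 D.toBlocks₁₂ D.toBlocks₂₁ D.toBlocks₂₂

/-- The iterates `(𝐐_k, Q_k)` of the algorithm with initial controller `K` and step size `η`. -/
def iterates (S : Plant n m₁ m₂) (K : Controller q m₁ m₂) (η : ℝ) : ℕ → Param q m₁ m₂
  | 0 => 0
  | k + 1 =>
    let X := iterates S K η k
    (X.1 - η • searchDir S K X, X.2 - η • zeroBlock ((searchDir S K X).map residueSum))

end LQG

end

set_option linter.unusedSectionVars false
set_option linter.unusedSimpArgs false

noncomputable section

namespace LQG

open WithZero

/-! ### The valuation at infinity -/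

section Infinity

variable {K : Type*} [Field K]

/-! The lifted cost is a convex quadratic function on the parameter space. The closed-loop map
`closedMap` is affine in the parameter, so `liftedCost_add_eq` is an exact expansion: J(X + H) =
J(X) + 2⟨`halfGrad` X, H⟩ + ‖M₁₂ H M₂₁‖². The gradient is therefore twice `halfGrad`, and the
algorithm is gradient descent with effective step η/2 < 1/L. Any smoothness constant L bounds the
quadratic term by (L/2)‖H‖² (`IsSmoothnessConstant.deltaMap_le`). Hence each step lowers the cost by
at least η‖`halfGrad`‖² (`descent`). Convexity then shows that the squared distance to any parameter
Y drops by η(J(X⁺) - J(Y)) (`distance_decrease`), and telescoping against a minimizer Y gives the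
rate c/k. Three facts support this argument.

First, the search direction represents the derivative (`h2Inner_deltaMap`). With N = M₁₂(-s)ᵀ T
M₂₁(-s)ᵀ, where T is the closed-loop map, the derivative in direction H is a pairing of N with H.
Against the strictly proper part of H, the antistable part of N integrates to zero by Cauchy's
theorem, which leaves the stable part. Against the constant part of H, the s⁻¹ coefficient of N is
invisible, because it sits in the block where H vanishes. So the stable and antistable parts of N
have opposite leading coefficients after pairing. Each contributes π times the residue sum of the
stable part (`integral_re_ev_axis`, `sum_residue_eq_lead`), and the factor 1/(2π) normalizes the
total.

Second, the minimum of the lifted problem is the LQG optimum. Controllers and parameters both give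
an `IsLoop`: a linear system containing the plant, driven beyond it by the observation only. If P
and Y solve the control and filter Riccati equations, completing the square and subtracting the
unavoidable error covariance gives cost = `lqgValue` + tr(R (U - FE)(X - NYNᵀ)(U - FE)ᵀ) with a
nonnegative last term (`IsLoop.loopCost_eq`). This term vanishes for the Kalman controller
(`controllerCost_kalman`) and for an explicit parameter (`liftedCost_optParam`). The Riccati
solutions come from policy iteration (`exists_riccati`). Every parameter has a state space
realization (`isRealizable_of_mem`), so the bound applies to all of them.

Third, the stochastic cost is the stationary one (`hasCost_controllerCost`). Square-integrable
processes are treated as paths in the Hilbert space L²(Ω), and the noise enters only through its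
covariances. The balance of expected energy (`IsWhite.energy`) follows from ordinary calculus and
the orthogonality of increments, without Itô integration. Stability bounds the energy, and dividing
by T gives the limit. -/

open Classical in
/-- The valuation at infinity of the field of rational functions. -/
def infVal (K : Type*) [Field K] : Valuation (RatFunc K) (WithZero (Multiplicative ℤ)) :=
  RatFunc.inftyValuation K

lemma infVal_X : infVal K RatFunc.X = exp 1 := by
  classical exact RatFunc.inftyValuation.X K

lemma infVal_C_le (a : K) : infVal K (RatFunc.C a) ≤ 1 := by
  classical
  by_cases ha : a = 0
  · simp [ha]
  · exact (RatFunc.inftyValuation.C K ha).le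

lemma infVal_C {a : K} (ha : a ≠ 0) : infVal K (RatFunc.C a) = 1 := by
  classical exact RatFunc.inftyValuation.C K ha

lemma infVal_polynomial {p : Polynomial K} (hp : p ≠ 0) :
    infVal K (algebraMap (Polynomial K) (RatFunc K) p) = exp (p.natDegree : ℤ) := by
  classical exact RatFunc.inftyValuation.polynomial K hp

lemma infVal_div_lt_one_iff {p d : Polynomial K} (hd : d ≠ 0) :
    infVal K (algebraMap _ _ p / algebraMap _ _ d) < 1 ↔ p.degree < d.degree := by
  by_cases hp : p = 0
  · simp [hp, Polynomial.degree_eq_natDegree hd]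
  · rw [map_div₀, infVal_polynomial hp, infVal_polynomial hd, ← exp_sub, ← exp_zero, exp_lt_exp,
      Polynomial.degree_eq_natDegree hd, Polynomial.degree_eq_natDegree hp, Nat.cast_lt]
    omega

lemma infVal_div_le_one_iff {p d : Polynomial K} (hd : d ≠ 0) :
    infVal K (algebraMap _ _ p / algebraMap _ _ d) ≤ 1 ↔ p.degree ≤ d.degree := by
  by_cases hp : p = 0
  · simp [hp]
  · rw [map_div₀, infVal_polynomial hp, infVal_polynomial hd, ← exp_sub, ← exp_zero, exp_le_exp,
      Polynomial.degree_eq_natDegree hd, Polynomial.degree_eq_natDegree hp, Nat.cast_le]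
    omega

lemma infVal_lt_one_iff {f : RatFunc K} : infVal K f < 1 ↔ f.num.degree < f.denom.degree := by
  conv_lhs => rw [← RatFunc.num_div_denom f]
  exact infVal_div_lt_one_iff f.denom_ne_zero

lemma lt_exp_iff_le_exp_sub_one {x : WithZero (Multiplicative ℤ)} {n : ℤ} :
    x < exp n ↔ x ≤ exp (n - 1) := by
  rcases eq_or_ne x 0 with rfl | hx
  · simp
  · rw [← exp_log hx, exp_lt_exp, exp_le_exp]; omega

lemma infVal_lt_one_iff_le {f : RatFunc K} : infVal K f < 1 ↔ infVal K f ≤ exp (-1) := by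
  rw [← exp_zero, lt_exp_iff_le_exp_sub_one]; simp

lemma infVal_X_mul_le_one_iff {f : RatFunc K} : infVal K (RatFunc.X * f) ≤ 1 ↔ infVal K f < 1 := by
  rw [infVal_lt_one_iff_le, map_mul, infVal_X]
  rcases eq_or_ne (infVal K f) 0 with h | h
  · simp [h]
  · rw [← exp_log h, ← exp_add, ← exp_zero, exp_le_exp, exp_le_exp]; omega

/-- The constant is the value at infinity. The denominator is monic, so this is the coefficient of
the numerator at the degree of the denominator, and subtracting that multiple of the denominator
cancels the top term. -/
lemma exists_C_approx {f : RatFunc K} (hf : infVal K f ≤ 1) :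
    ∃ c : K, infVal K (f - RatFunc.C c) < 1 := by
  have hd := f.denom_ne_zero
  have hm := f.monic_denom
  rw [← RatFunc.num_div_denom f, infVal_div_le_one_iff hd] at hf
  refine ⟨f.num.coeff f.denom.natDegree, ?_⟩
  set c := f.num.coeff f.denom.natDegree
  have hd' : algebraMap (Polynomial K) (RatFunc K) f.denom ≠ 0 := RatFunc.algebraMap_ne_zero hd
  have : f - RatFunc.C c = algebraMap _ _ (f.num - Polynomial.C c * f.denom) /
      algebraMap _ _ f.denom := by
    rw [map_sub, sub_div, RatFunc.num_div_denom, map_mul, mul_div_assoc, div_self hd', mul_one,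
      RatFunc.algebraMap_C]
  rw [this, infVal_div_lt_one_iff hd, Polynomial.degree_eq_natDegree hd]
  refine (Polynomial.degree_lt_iff_coeff_zero _ _).2 fun m hm' => ?_
  rcases hm'.eq_or_lt with h | h
  · rw [← h, Polynomial.coeff_sub, Polynomial.coeff_C_mul, hm.coeff_natDegree, mul_one, sub_self]
  · rw [Polynomial.coeff_sub, Polynomial.coeff_C_mul, Polynomial.coeff_eq_zero_of_natDegree_lt h,
      Polynomial.coeff_eq_zero_of_degree_lt, mul_zero, sub_zero]
    exact hf.trans_lt (by rw [Polynomial.degree_eq_natDegree hd]; exact_mod_cast h)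

/-- `s f(s) → c` as `s → ∞`. -/
def HasLead (f : RatFunc K) (c : K) : Prop := infVal K (RatFunc.X * f - RatFunc.C c) < 1

lemma HasLead.infVal_lt {f : RatFunc K} {c : K} (h : HasLead f c) : infVal K f < 1 := by
  rw [← infVal_X_mul_le_one_iff, ← sub_add_cancel (RatFunc.X * f) (RatFunc.C c)]
  exact (infVal K).map_add_le h.le (infVal_C_le c)

lemma exists_hasLead {f : RatFunc K} (h : infVal K f < 1) : ∃ c, HasLead f c :=
  exists_C_approx (infVal_X_mul_le_one_iff.2 h)

lemma HasLead.add {f g : RatFunc K} {a b : K} (hf : HasLead f a) (hg : HasLead g b) :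
    HasLead (f + g) (a + b) := by
  unfold HasLead at *
  rw [map_add, mul_add, add_sub_add_comm]
  exact (infVal K).map_add_lt hf hg

lemma HasLead.neg {f : RatFunc K} {a : K} (hf : HasLead f a) : HasLead (-f) (-a) := by
  unfold HasLead at *
  rw [map_neg, mul_neg, neg_sub_neg, ← Valuation.map_neg, neg_sub]
  exact hf

lemma HasLead.sub {f g : RatFunc K} {a b : K} (hf : HasLead f a) (hg : HasLead g b) :
    HasLead (f - g) (a - b) := by
  rw [sub_eq_add_neg, sub_eq_add_neg]; exact hf.add hg.neg

lemma HasLead.C_mul {f : RatFunc K} {a : K} (c : K) (hf : HasLead f a) :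
    HasLead (RatFunc.C c * f) (c * a) := by
  unfold HasLead at *
  rw [map_mul, mul_left_comm, ← mul_sub, map_mul]
  exact (mul_le_of_le_one_left' (infVal_C_le c)).trans_lt hf

lemma hasLead_zero : HasLead (0 : RatFunc K) 0 := by simp [HasLead]

lemma hasLead_sum {ι : Type*} (s : Finset ι) {f : ι → RatFunc K} {a : ι → K}
    (h : ∀ i ∈ s, HasLead (f i) (a i)) : HasLead (∑ i ∈ s, f i) (∑ i ∈ s, a i) := by
  classical
  induction s using Finset.induction_on with
  | empty => simpa using hasLead_zero
  | insert i s hi ih =>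
    rw [Finset.sum_insert hi, Finset.sum_insert hi]
    exact (h _ (by simp)).add (ih fun j hj => h _ (by simp [hj]))

lemma HasLead.unique {f : RatFunc K} {a b : K} (ha : HasLead f a) (hb : HasLead f b) : a = b := by
  by_contra hab
  have h := ha.sub hb
  rw [sub_self, HasLead, mul_zero, zero_sub, Valuation.map_neg, infVal_C (sub_ne_zero.2 hab)] at h
  exact lt_irrefl _ h

lemma hasLead_zero_iff {f : RatFunc K} : HasLead f 0 ↔ infVal K f ≤ exp (-2) := by
  rw [HasLead, map_zero, sub_zero, infVal_lt_one_iff_le, map_mul, infVal_X]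
  rcases eq_or_ne (infVal K f) 0 with h | h
  · simp [h]
  · rw [← exp_log h, ← exp_add, exp_le_exp, exp_le_exp]; omega

/-- Each factor is O(1/s), so the product is O(s⁻²). -/
lemma hasLead_mul {f g : RatFunc K} (hf : infVal K f < 1) (hg : infVal K g < 1) :
    HasLead (f * g) 0 := by
  rw [hasLead_zero_iff, map_mul, show (-2 : ℤ) = -1 + -1 by norm_num, exp_add]
  exact mul_le_mul' (infVal_lt_one_iff_le.1 hf) (infVal_lt_one_iff_le.1 hg)

end Infinity

lemma isStrictlyProper_iff {f : RatFunc ℝ} : IsStrictlyProper f ↔ infVal ℝ f < 1 :=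
  infVal_lt_one_iff.symm

/-! ### Rational functions without poles in a set -/

/-- The algebra of real rational functions without poles in `s ⊆ ℂ`. -/
def regularOn (s : Set ℂ) : Subalgebra ℝ (RatFunc ℝ) where
  carrier := {f | ∀ z ∈ s, Polynomial.aeval z f.denom ≠ 0}
  mul_mem' {f g} hf hg z hz h := by
    obtain ⟨r, hr⟩ := RatFunc.denom_mul_dvd f g
    have h' : Polynomial.aeval z (f.denom * g.denom) = 0 := by rw [hr, map_mul, h, zero_mul]
    rw [map_mul] at h'
    exact mul_ne_zero (hf z hz) (hg z hz) h'
  add_mem' {f g} hf hg z hz h := by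
    obtain ⟨r, hr⟩ := RatFunc.denom_add_dvd f g
    have h' : Polynomial.aeval z (f.denom * g.denom) = 0 := by rw [hr, map_mul, h, zero_mul]
    rw [map_mul] at h'
    exact mul_ne_zero (hf z hz) (hg z hz) h'
  algebraMap_mem' r z hz := by
    simp [RatFunc.algebraMap_eq_C]

lemma mem_regularOn {s : Set ℂ} {f : RatFunc ℝ} :
    f ∈ regularOn s ↔ ∀ z ∈ s, Polynomial.aeval z f.denom ≠ 0 := Iff.rfl

lemma div_mem_regularOn {s : Set ℂ} (p : Polynomial ℝ) {d : Polynomial ℝ}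
    (h : ∀ z ∈ s, Polynomial.aeval z d ≠ 0) :
    algebraMap _ (RatFunc ℝ) p / algebraMap _ (RatFunc ℝ) d ∈ regularOn s := by
  intro z hz h0
  obtain ⟨r, hr⟩ := RatFunc.denom_div_dvd p d
  exact h z hz (by rw [hr, map_mul, h0, zero_mul])

lemma polynomial_mem_regularOn (s : Set ℂ) (p : Polynomial ℝ) :
    algebraMap _ (RatFunc ℝ) p ∈ regularOn s := by
  simpa using div_mem_regularOn (s := s) p (d := 1) (by simp)

lemma X_mem_regularOn (s : Set ℂ) : (RatFunc.X : RatFunc ℝ) ∈ regularOn s := by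
  simpa using polynomial_mem_regularOn s Polynomial.X

lemma C_mem_regularOn (s : Set ℂ) (c : ℝ) : RatFunc.C c ∈ regularOn s := by
  simpa using polynomial_mem_regularOn s (Polynomial.C c)

lemma regularOn_mono {s t : Set ℂ} (h : s ⊆ t) : regularOn t ≤ regularOn s :=
  fun _ hf z hz => hf z (h hz)

/-- The closed right half-plane. -/
abbrev rhp : Set ℂ := {z | 0 ≤ z.re}

/-- The closed left half-plane. -/
abbrev lhp : Set ℂ := {z | z.re ≤ 0}

/-- The imaginary axis. -/
abbrev imAxis : Set ℂ := {z | z.re = 0}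

lemma imAxis_subset_rhp : imAxis ⊆ rhp := fun _ hz => (Eq.ge hz :)
lemma imAxis_subset_lhp : imAxis ⊆ lhp := fun _ hz => (Eq.le hz :)

lemma isStable_iff {f : RatFunc ℝ} : IsStable f ↔ f ∈ regularOn rhp := by
  simp only [IsStable, mem_regularOn, Set.mem_ofPred_eq]
  exact forall_congr' fun z => by rw [← not_imp_not, not_lt]

lemma isAntistable_iff {f : RatFunc ℝ} : IsAntistable f ↔ f ∈ regularOn lhp := by
  simp only [IsAntistable, mem_regularOn, Set.mem_ofPred_eq]
  exact forall_congr' fun z => by rw [← not_imp_not, not_lt]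

/-- Evaluation at a complex number. -/
abbrev ev (z : ℂ) (f : RatFunc ℝ) : ℂ := RatFunc.eval (algebraMap ℝ ℂ) z f

lemma ev_add {s : Set ℂ} {z : ℂ} (hz : z ∈ s) {f g : RatFunc ℝ} (hf : f ∈ regularOn s)
    (hg : g ∈ regularOn s) : ev z (f + g) = ev z f + ev z g :=
  RatFunc.eval_add _ _ (hf z hz) (hg z hz)

lemma ev_mul {s : Set ℂ} {z : ℂ} (hz : z ∈ s) {f g : RatFunc ℝ} (hf : f ∈ regularOn s)
    (hg : g ∈ regularOn s) : ev z (f * g) = ev z f * ev z g :=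
  RatFunc.eval_mul _ _ (hf z hz) (hg z hz)

lemma ev_C (z : ℂ) (c : ℝ) : ev z (RatFunc.C c) = c := RatFunc.eval_C _ _

lemma ev_neg {s : Set ℂ} {z : ℂ} (hz : z ∈ s) {f : RatFunc ℝ} (hf : f ∈ regularOn s) :
    ev z (-f) = - ev z f := by
  have := ev_mul hz (C_mem_regularOn s (-1)) hf
  rw [ev_C] at this
  simpa using this

lemma ev_sub {s : Set ℂ} {z : ℂ} (hz : z ∈ s) {f g : RatFunc ℝ} (hf : f ∈ regularOn s)
    (hg : g ∈ regularOn s) : ev z (f - g) = ev z f - ev z g := by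
  rw [sub_eq_add_neg, ev_add hz hf (neg_mem hg), ev_neg hz hg, sub_eq_add_neg]

lemma ev_sum {s : Set ℂ} {z : ℂ} (hz : z ∈ s) {ι : Type*} (t : Finset ι) {f : ι → RatFunc ℝ}
    (hf : ∀ i ∈ t, f i ∈ regularOn s) : ev z (∑ i ∈ t, f i) = ∑ i ∈ t, ev z (f i) := by
  classical
  induction t using Finset.induction_on with
  | empty => simp [ev]
  | insert i t hi ih =>
    rw [Finset.sum_insert hi, Finset.sum_insert hi, ev_add hz (hf _ (by simp))
      (sum_mem fun j hj => hf j (by simp [hj])), ih fun j hj => hf j (by simp [hj])]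

/-- `RatFunc.eval` uses the reduced fraction, whereas `p` and `d` may share factors. Multiplying by
`d` reduces the claim to multiplicativity of evaluation away from poles. -/
lemma ev_div {z : ℂ} {p d : Polynomial ℝ} (hd : Polynomial.aeval z d ≠ 0) :
    ev z (algebraMap _ _ p / algebraMap _ _ d) = Polynomial.aeval z p / Polynomial.aeval z d := by
  have hd0 : algebraMap (Polynomial ℝ) (RatFunc ℝ) d ≠ 0 :=
    RatFunc.algebraMap_ne_zero (by rintro rfl; simp at hd)
  have h1 : algebraMap (Polynomial ℝ) (RatFunc ℝ) p / algebraMap _ _ d ∈ regularOn {z} :=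
    div_mem_regularOn _ (by simpa using hd)
  have h2 := ev_mul (Set.mem_singleton z) h1 (polynomial_mem_regularOn {z} d)
  rw [div_mul_cancel₀ _ hd0] at h2
  simp only [ev, RatFunc.eval_algebraMap, Algebra.algebraMap_self, RingHom.id_apply] at h2
  rw [eq_div_iff hd]
  exact h2.symm

/-! ### The reflection `f ↦ f(-s)` -/

lemma negVar_algebraMap (p : Polynomial ℝ) :
    negVar (algebraMap _ _ p) = algebraMap _ (RatFunc ℝ) (p.comp (-Polynomial.X)) := by
  simp only [negVar, RatFunc.coe_mapRingHom_eq_coe_map]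
  have := RatFunc.map_apply_div (Polynomial.algEquivAevalNegX (R := ℝ))
    (nonZeroDivisors_le_comap_nonZeroDivisors_of_injective _
      (Polynomial.algEquivAevalNegX (R := ℝ)).injective) p 1
  simp only [map_one, div_one] at this
  rw [this]
  simp [Polynomial.algEquivAevalNegX, Polynomial.aeval_def, Polynomial.comp]

lemma negVar_C (c : ℝ) : negVar (RatFunc.C c) = RatFunc.C c := by
  rw [← RatFunc.algebraMap_C, negVar_algebraMap]; simp

lemma negVar_X : negVar (RatFunc.X) = -RatFunc.X := by
  rw [← RatFunc.algebraMap_X, negVar_algebraMap]; simp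

lemma negVar_negVar (f : RatFunc ℝ) : negVar (negVar f) = f := by
  rw [← RatFunc.num_div_denom f]
  simp only [map_div₀, negVar_algebraMap, Polynomial.comp_assoc]
  simp

lemma negVar_eq_div (f : RatFunc ℝ) : negVar f =
    algebraMap _ _ (f.num.comp (-Polynomial.X)) / algebraMap _ _ (f.denom.comp (-Polynomial.X)) := by
  conv_lhs => rw [← RatFunc.num_div_denom f]
  simp only [map_div₀, negVar_algebraMap]

lemma negVar_mem_regularOn {s : Set ℂ} {f : RatFunc ℝ} (hf : f ∈ regularOn s) :
    negVar f ∈ regularOn {z | -z ∈ s} := by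
  rw [negVar_eq_div]
  refine div_mem_regularOn _ fun z hz => ?_
  rw [Polynomial.aeval_comp]
  simpa using hf _ hz

lemma negVar_stable {f : RatFunc ℝ} (hf : f ∈ regularOn rhp) : negVar f ∈ regularOn lhp :=
  regularOn_mono (fun z hz => by simpa using hz) (negVar_mem_regularOn hf)

lemma negVar_antistable {f : RatFunc ℝ} (hf : f ∈ regularOn lhp) : negVar f ∈ regularOn rhp :=
  regularOn_mono (fun z hz => by simpa using hz) (negVar_mem_regularOn hf)

lemma negVar_imAxis {f : RatFunc ℝ} (hf : f ∈ regularOn imAxis) : negVar f ∈ regularOn imAxis :=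
  regularOn_mono (fun z hz => by simpa using hz) (negVar_mem_regularOn hf)

lemma ev_negVar {z : ℂ} {f : RatFunc ℝ} (hf : Polynomial.aeval (-z) f.denom ≠ 0) :
    ev z (negVar f) = ev (-z) f := by
  conv_rhs => rw [← RatFunc.num_div_denom f]
  rw [negVar_eq_div, ev_div, ev_div hf]
  · simp [Polynomial.aeval_comp]
  · simpa [Polynomial.aeval_comp] using hf

lemma ev_conj (z : ℂ) (f : RatFunc ℝ) : ev (star z) f = star (ev z f) := by
  have h (p : Polynomial ℝ) : Polynomial.eval₂ (algebraMap ℝ ℂ) (star z) p =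
      star (Polynomial.eval₂ (algebraMap ℝ ℂ) z p) := by
    simp only [← Polynomial.aeval_def]
    exact (Polynomial.aeval_conj p z)
  simp only [ev, RatFunc.eval, h, star_div₀]

/-- On the imaginary axis `-s` is the conjugate of `s`, and the coefficients are real. This is why
para-conjugation becomes the adjoint there. -/
lemma ev_negVar_axis {f : RatFunc ℝ} (hf : f ∈ regularOn imAxis) (w : ℝ) :
    ev (w * Complex.I) (negVar f) = star (ev (w * Complex.I) f) := by
  rw [ev_negVar (hf _ (by simp)), ← ev_conj]
  simp

lemma infVal_negVar (f : RatFunc ℝ) : infVal ℝ (negVar f) = infVal ℝ f := by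
  rcases eq_or_ne f 0 with rfl | hf
  · simp
  have h (p : Polynomial ℝ) : (p.comp (-Polynomial.X)).natDegree = p.natDegree := by
    rw [Polynomial.natDegree_comp]; simp
  have h0 (p : Polynomial ℝ) (hp : p ≠ 0) : p.comp (-Polynomial.X) ≠ 0 := by
    intro h0
    apply hp
    have := congrArg (fun q => Polynomial.comp q (-Polynomial.X)) h0
    simpa [Polynomial.comp_assoc] using this
  have hn := RatFunc.num_ne_zero hf
  conv_rhs => rw [← RatFunc.num_div_denom f]
  rw [negVar_eq_div, map_div₀, map_div₀, infVal_polynomial (h0 _ hn),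
    infVal_polynomial (h0 _ f.denom_ne_zero), infVal_polynomial hn,
    infVal_polynomial f.denom_ne_zero, h, h]

lemma HasLead.negVar {f : RatFunc ℝ} {c : ℝ} (h : HasLead f c) : HasLead (negVar f) (-c) := by
  unfold HasLead at *
  rw [← infVal_negVar]
  rw [map_sub, map_mul, negVar_negVar, negVar_C, negVar_X, map_neg, ← Valuation.map_neg]
  convert h using 2
  ring

/-! ### Stable parts -/

/-- Without any complex pole the function is a polynomial, and a polynomial that vanishes at
infinity is zero. Uniqueness for Lyapunov equations rests on this. -/
lemma eq_zero_of_stable_of_antistable {f : RatFunc ℝ} (h1 : f ∈ regularOn rhp)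
    (h2 : f ∈ regularOn lhp) (h3 : infVal ℝ f < 1) : f = 0 := by
  have hd : f.denom.degree = 0 := by
    by_contra hd
    obtain ⟨z, hz⟩ := IsAlgClosed.exists_root (f.denom.map (algebraMap ℝ ℂ))
      (by rwa [Polynomial.degree_map])
    rw [Polynomial.IsRoot, Polynomial.eval_map_algebraMap] at hz
    rcases le_total 0 z.re with h | h
    · exact h1 z h hz
    · exact h2 z h hz
  rw [infVal_lt_one_iff, hd, Nat.WithBot.lt_zero_iff, Polynomial.degree_eq_bot] at h3
  exact RatFunc.num_eq_zero_iff.1 h3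

/-- `f` is the sum of a stable, strictly proper function and of an antistable one. -/
def HasStablePart (f : RatFunc ℝ) : Prop :=
  ∃ g, (g ∈ regularOn rhp ∧ infVal ℝ g < 1) ∧ f - g ∈ regularOn lhp

lemma HasStablePart.add {f g : RatFunc ℝ} (hf : HasStablePart f) (hg : HasStablePart g) :
    HasStablePart (f + g) := by
  obtain ⟨a, ⟨h1, h2⟩, h3⟩ := hf
  obtain ⟨b, ⟨k1, k2⟩, k3⟩ := hg
  refine ⟨a + b, ⟨add_mem h1 k1, (infVal ℝ).map_add_lt h2 k2⟩, ?_⟩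
  rw [add_sub_add_comm]
  exact add_mem h3 k3

lemma hasStablePart_sum {ι : Type*} (s : Finset ι) {f : ι → RatFunc ℝ}
    (h : ∀ i ∈ s, HasStablePart (f i)) : HasStablePart (∑ i ∈ s, f i) := by
  classical
  induction s using Finset.induction_on with
  | empty => exact ⟨0, ⟨zero_mem _, by simp⟩, by simp⟩
  | insert i s hi ih =>
    rw [Finset.sum_insert hi]
    exact (h _ (by simp)).add (ih fun j hj => h _ (by simp [hj]))

/-- The two denominators have no common complex root, hence are coprime, and partial fractions
apply. The polynomial quotient goes into the antistable part, which need not be proper. -/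
lemma hasStablePart_mul {f g : RatFunc ℝ} (hf : f ∈ regularOn rhp) (hg : g ∈ regularOn lhp) :
    HasStablePart (f * g) := by
  have hc : IsCoprime f.denom g.denom := by
    refine (Polynomial.isCoprime_iff_aeval_ne_zero_of_isAlgClosed ℝ ℂ _ _).2 fun z => ?_
    rcases le_total 0 z.re with h | h
    · exact Or.inl (hf z h)
    · exact Or.inr (hg z h)
  obtain ⟨q, r₁, r₂, h1, h2, h⟩ := Polynomial.div_eq_quo_add_rem_div_add_rem_div (RatFunc ℝ)
    (f.num * g.num) f.monic_denom g.monic_denom hc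
  refine ⟨algebraMap _ _ r₁ / algebraMap _ _ f.denom,
    ⟨div_mem_regularOn _ hf, (infVal_div_lt_one_iff f.denom_ne_zero).2 h1⟩, ?_⟩
  have : f * g = algebraMap _ (RatFunc ℝ) (f.num * g.num) /
      (algebraMap _ _ f.denom * algebraMap _ _ g.denom) := by
    conv_lhs => rw [← RatFunc.num_div_denom f, ← RatFunc.num_div_denom g]
    rw [map_mul, div_mul_div_comm]
  rw [this]
  change algebraMap _ (RatFunc ℝ) (f.num * g.num) /
      (algebraMap _ _ f.denom * algebraMap _ _ g.denom) = algebraMap _ _ q +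
        algebraMap _ _ r₁ / algebraMap _ _ f.denom + algebraMap _ _ r₂ / algebraMap _ _ g.denom at h
  rw [h, add_right_comm, add_sub_cancel_right]
  exact add_mem (polynomial_mem_regularOn _ _) (div_mem_regularOn _ hg)

end LQG

end

noncomputable section

namespace LQG

open WithZero

/-! ### Integrals of rational functions along the imaginary axis -/

/-- After division by `z ^ N` the monomial of index `i` becomes a multiple of `z⁻¹ ^ (N - i)`, and
only `i = N` survives in the limit. -/
lemma tendsto_aeval_div_pow (p : Polynomial ℝ) {N : ℕ} (h : p.natDegree ≤ N) :
    Tendsto (fun z : ℂ => Polynomial.aeval z p / z ^ N) (Bornology.cobounded ℂ)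
      (𝓝 (p.coeff N : ℂ)) := by
  have h1 : Tendsto (fun z : ℂ => ∑ i ∈ Finset.range (N + 1), (p.coeff i : ℂ) * z⁻¹ ^ (N - i))
      (Bornology.cobounded ℂ) (𝓝 (∑ i ∈ Finset.range (N + 1), (p.coeff i : ℂ) * 0 ^ (N - i))) :=
    tendsto_finsetSum _ fun i _ => (tendsto_inv₀_cobounded.pow _).const_mul _
  have h2 : ∑ i ∈ Finset.range (N + 1), (p.coeff i : ℂ) * 0 ^ (N - i) = p.coeff N := by
    rw [Finset.sum_eq_single N]
    · simp
    · intro i hi hiN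
      have : N - i ≠ 0 := by have := Finset.mem_range.1 hi; omega
      simp [this]
    · simp
  rw [h2] at h1
  refine h1.congr' ?_
  filter_upwards [Metric.cobounded_eq_cocompact (α := ℂ) ▸
    (isCompact_singleton (x := (0 : ℂ))).compl_mem_cocompact] with z hz
  have hz0 : z ≠ 0 := by simpa using hz
  rw [Polynomial.aeval_eq_sum_range' (Nat.lt_succ_of_le h), Finset.sum_div]
  refine Finset.sum_congr rfl fun i hi => ?_
  have hi' : i ≤ N := Nat.lt_succ_iff.1 (Finset.mem_range.1 hi)
  rw [inv_pow, pow_sub₀ _ hz0 hi', Complex.real_smul]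
  field_simp

lemma tendsto_ev_cobounded {f : RatFunc ℝ} (hf : infVal ℝ f ≤ 1) :
    Tendsto (fun z => ev z f) (Bornology.cobounded ℂ)
      (𝓝 (f.num.coeff f.denom.natDegree : ℂ)) := by
  have hd := f.denom_ne_zero
  rw [← RatFunc.num_div_denom f, infVal_div_le_one_iff hd] at hf
  have hdeg : f.num.natDegree ≤ f.denom.natDegree := Polynomial.natDegree_le_natDegree hf
  have h := (tendsto_aeval_div_pow f.num hdeg).div (tendsto_aeval_div_pow f.denom le_rfl)
    (by simp [f.monic_denom.coeff_natDegree])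
  rw [f.monic_denom.coeff_natDegree] at h
  simp only [Complex.ofReal_one, div_one] at h
  refine h.congr' ?_
  filter_upwards [Metric.cobounded_eq_cocompact (α := ℂ) ▸
    (isCompact_singleton (x := (0 : ℂ))).compl_mem_cocompact] with z hz
  have hz0 : z ≠ 0 := by simpa using hz
  simp only [Pi.div_apply]
  rw [div_div_div_cancel_right₀ (pow_ne_zero _ hz0)]
  rfl

lemma exists_bound_ev_of_large {f : RatFunc ℝ} (hf : infVal ℝ f ≤ 1) :
    ∃ C R : ℝ, 0 < R ∧ ∀ z : ℂ, R ≤ ‖z‖ → ‖ev z f‖ ≤ C := by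
  obtain ⟨C, hC⟩ := (tendsto_ev_cobounded hf).norm.isBoundedUnder_le
  rw [eventually_map, ← comap_norm_atTop, eventually_comap] at hC
  obtain ⟨R, hR⟩ := eventually_atTop.1 hC
  exact ⟨C, max R 1, by positivity, fun z hz => hR _ (le_trans (le_max_left _ _) hz) z rfl⟩

lemma exists_sq_bound_ev_of_large {s : Set ℂ} {g : RatFunc ℝ} (hg : g ∈ regularOn s)
    (h2 : infVal ℝ g ≤ exp (-2)) :
    ∃ C R : ℝ, 0 < R ∧ ∀ z ∈ s, R ≤ ‖z‖ → ‖ev z g‖ ≤ C / ‖z‖ ^ 2 := by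
  have h : infVal ℝ (RatFunc.X * RatFunc.X * g) ≤ 1 := by
    rw [map_mul, map_mul, infVal_X, ← exp_add]
    refine (mul_le_mul_right h2 _).trans ?_
    rw [← exp_add]; norm_num
  obtain ⟨C, R, hR, hC⟩ := exists_bound_ev_of_large h
  refine ⟨C, R, hR, fun z hz hRz => ?_⟩
  have := hC z hRz
  have hX := X_mem_regularOn s
  rw [ev_mul hz (mul_mem hX hX) hg, ev_mul hz hX hX, norm_mul, norm_mul] at this
  simp only [ev, RatFunc.eval_X] at this
  rw [le_div_iff₀ (pow_pos (hR.trans_le hRz) 2)]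
  linarith

lemma differentiableAt_ev {f : RatFunc ℝ} {z : ℂ} (hf : Polynomial.aeval z f.denom ≠ 0) :
    DifferentiableAt ℂ (fun z => ev z f) z :=
  (Polynomial.differentiableAt_aeval f.num).div (Polynomial.differentiableAt_aeval f.denom) hf

lemma continuous_ev_axis {f : RatFunc ℝ} (hf : f ∈ regularOn imAxis) :
    Continuous fun w : ℝ => ev (w * Complex.I) f := by
  refine continuous_iff_continuousAt.2 fun w => ?_
  have h := (differentiableAt_ev (hf (w * Complex.I) (by simp))).continuousAt
  exact ContinuousAt.comp (f := fun w : ℝ => (w : ℂ) * Complex.I) h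
    (by fun_prop)

lemma exists_bound_ev_axis {f : RatFunc ℝ} (hf : f ∈ regularOn imAxis) (h : infVal ℝ f ≤ 1) :
    ∃ C : ℝ, 0 ≤ C ∧ ∀ w : ℝ, ‖ev (w * Complex.I) f‖ ≤ C := by
  obtain ⟨C, R, hR, hC⟩ := exists_bound_ev_of_large h
  obtain ⟨D, hD⟩ := (isCompact_Icc (a := -R) (b := R)).exists_bound_of_continuousOn
    (continuous_ev_axis hf).continuousOn
  refine ⟨max (max C D) 0, le_max_right _ _, fun w => ?_⟩
  refine le_trans ?_ (le_max_left _ _)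
  by_cases hw : |w| ≤ R
  · exact (hD w (abs_le.1 hw)).trans (le_max_right _ _)
  · refine (hC _ ?_).trans (le_max_left _ _)
    simpa using (not_le.1 hw).le

/-- On the axis `1 - s²` equals `1 + ω²`. Multiplication by it turns a function of order s⁻² into a
proper one, which is bounded. -/
lemma exists_bound_ev_axis_sq {g : RatFunc ℝ} (hg : g ∈ regularOn imAxis)
    (h2 : infVal ℝ g ≤ exp (-2)) :
    ∃ C : ℝ, ∀ w : ℝ, ‖ev (w * Complex.I) g‖ ≤ C * (1 + w ^ 2)⁻¹ := by
  have hX := X_mem_regularOn imAxis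
  have h1 : (1 - RatFunc.X * RatFunc.X : RatFunc ℝ) ∈ regularOn imAxis :=
    sub_mem (one_mem _) (mul_mem hX hX)
  have hv : infVal ℝ ((1 - RatFunc.X * RatFunc.X) * g) ≤ 1 := by
    rw [map_mul]
    have : infVal ℝ (1 - RatFunc.X * RatFunc.X : RatFunc ℝ) ≤ exp 2 := by
      refine ((infVal ℝ).map_sub _ _).trans (max_le ?_ ?_)
      · rw [map_one, ← exp_zero, exp_le_exp]; norm_num
      · rw [map_mul, infVal_X, ← exp_add]; norm_num
    refine (mul_le_mul' this h2).trans ?_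
    rw [← exp_add]; norm_num
  obtain ⟨C, _, hC⟩ := exists_bound_ev_axis (mul_mem h1 hg) hv
  refine ⟨C, fun w => ?_⟩
  have := hC w
  have hw : (w * Complex.I : ℂ) ∈ imAxis := by simp
  rw [ev_mul hw h1 hg, ev_sub hw (one_mem _) (mul_mem hX hX), ev_mul hw hX hX] at this
  simp only [ev, RatFunc.eval_X, RatFunc.eval_one] at this
  have he : (1 - (w : ℂ) * Complex.I * (w * Complex.I)) = ((1 + w ^ 2 : ℝ) : ℂ) := by
    push_cast
    linear_combination (-(w : ℂ) ^ 2) * Complex.I_sq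
  rw [he, norm_mul, Complex.norm_real, Real.norm_of_nonneg (by positivity)] at this
  rw [← div_eq_mul_inv, le_div_iff₀ (by positivity)]
  linarith

lemma integrable_ev_axis {g : RatFunc ℝ} (hg : g ∈ regularOn imAxis)
    (h2 : infVal ℝ g ≤ exp (-2)) : Integrable fun w : ℝ => ev (w * Complex.I) g := by
  obtain ⟨C, hC⟩ := exists_bound_ev_axis_sq hg h2
  exact (integrable_inv_one_add_sq.const_mul C).mono'
    (continuous_ev_axis hg).aestronglyMeasurable (ae_of_all _ hC)

/-- Cauchy's theorem on the rectangle [0, T] × [-T, T]. The three sides off the axis have total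
length 4T and carry an integrand bounded by C/T². -/
lemma integral_ev_axis_eq_zero {g : RatFunc ℝ} (hg : g ∈ regularOn rhp)
    (h2 : infVal ℝ g ≤ exp (-2)) : ∫ w : ℝ, ev (w * Complex.I) g = 0 := by
  have hga := regularOn_mono imAxis_subset_rhp hg
  have hlim := intervalIntegral_tendsto_integral (integrable_ev_axis hga h2)
    tendsto_neg_atTop_atBot tendsto_id
  refine tendsto_nhds_unique hlim ?_
  obtain ⟨C, R, hR, hC⟩ := exists_sq_bound_ev_of_large hg h2
  have hb : ∀ᶠ T : ℝ in atTop, ‖∫ w : ℝ in -T..T, ev (w * Complex.I) g‖ ≤ 4 * C / T := by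
    filter_upwards [eventually_ge_atTop R] with T hT
    have hT0 : 0 < T := hR.trans_le hT
    have hrect := Complex.integral_boundary_rect_eq_zero_of_differentiableOn (fun z => ev z g)
      (⟨0, -T⟩ : ℂ) ⟨T, T⟩ fun z hz => by
        refine (differentiableAt_ev (hg z ?_)).differentiableWithinAt
        have := hz.1
        rw [Set.mem_preimage, Set.uIcc_of_le hT0.le] at this
        exact this.1
    simp only [Complex.ofReal_zero, zero_add] at hrect
    have hbound (z : ℂ) (hz : 0 ≤ z.re) (hTz : T ≤ ‖z‖) : ‖ev z g‖ ≤ C / T ^ 2 := by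
      refine (hC z hz (hT.trans hTz)).trans ?_
      have hC0 : 0 ≤ C := by
        have := (norm_nonneg _).trans (hC z hz (hT.trans hTz))
        by_contra hneg
        have : C / ‖z‖ ^ 2 < 0 :=
          div_neg_of_neg_of_pos (not_le.1 hneg) (pow_pos (hT0.trans_le hTz) 2)
        linarith
      gcongr
    have b1 : ‖∫ x : ℝ in (0 : ℝ)..T, ev (x + (-T : ℝ) * Complex.I) g‖ ≤ C / T ^ 2 * |T - 0| := by
      refine intervalIntegral.norm_integral_le_of_norm_le_const fun x hx => ?_
      rw [Set.uIoc_of_le hT0.le] at hx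
      refine hbound _ (by simpa using hx.1.le) ?_
      refine le_trans ?_ (Complex.abs_im_le_norm _)
      simp [abs_of_pos hT0]
    have b2 : ‖∫ x : ℝ in (0 : ℝ)..T, ev (x + (T : ℝ) * Complex.I) g‖ ≤ C / T ^ 2 * |T - 0| := by
      refine intervalIntegral.norm_integral_le_of_norm_le_const fun x hx => ?_
      rw [Set.uIoc_of_le hT0.le] at hx
      refine hbound _ (by simpa using hx.1.le) ?_
      refine le_trans ?_ (Complex.abs_im_le_norm _)
      simp [abs_of_pos hT0]
    have b3 : ‖∫ y : ℝ in (-T)..T, ev (T + y * Complex.I) g‖ ≤ C / T ^ 2 * |T - -T| := by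
      refine intervalIntegral.norm_integral_le_of_norm_le_const fun x hx => ?_
      refine hbound _ (by simpa using hT0.le) ?_
      refine le_trans ?_ (Complex.abs_re_le_norm _)
      simp [abs_of_pos hT0]
    rw [sub_zero, abs_of_pos hT0] at b1 b2
    rw [sub_neg_eq_add, abs_of_pos (by linarith)] at b3
    have he : Complex.I • ∫ w : ℝ in -T..T, ev (w * Complex.I) g =
        (∫ x : ℝ in (0 : ℝ)..T, ev (x + (-T : ℝ) * Complex.I) g) -
        (∫ x : ℝ in (0 : ℝ)..T, ev (x + (T : ℝ) * Complex.I) g) +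
        Complex.I • ∫ y : ℝ in (-T)..T, ev (T + y * Complex.I) g := by
      linear_combination (-1 : ℂ) * hrect
    have hn : ‖∫ w : ℝ in -T..T, ev (w * Complex.I) g‖ =
        ‖Complex.I • ∫ w : ℝ in -T..T, ev (w * Complex.I) g‖ := by
      rw [norm_smul, Complex.norm_I, one_mul]
    rw [hn, he]
    refine (norm_add_le _ _).trans ((add_le_add (norm_sub_le _ _) le_rfl).trans ?_)
    rw [norm_smul, Complex.norm_I, one_mul]
    refine (add_le_add (add_le_add b1 b2) b3).trans (le_of_eq ?_)
    field_simp
    ring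
  exact squeeze_zero_norm' hb (tendsto_const_nhds.div_atTop tendsto_id)

/-- The real part of a strictly proper stable function along the imaginary axis. -/
lemma integral_re_ev_axis {f : RatFunc ℝ} {c : ℝ} (hf : f ∈ regularOn rhp) (hc : HasLead f c) :
    Integrable (fun w : ℝ => (ev (w * Complex.I) f).re) ∧
      ∫ w : ℝ, (ev (w * Complex.I) f).re = Real.pi * c := by
  have hX1 : (RatFunc.X + 1 : RatFunc ℝ) ≠ 0 := by
    have := RatFunc.algebraMap_ne_zero (K := ℝ) (Polynomial.X_add_C_ne_zero (1 : ℝ))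
    simpa using this
  -- The comparison function 1/(s+1) has leading coefficient 1, and its real part on the axis is
  -- 1/(1+ω²), with integral π. Subtracting `c` times it leaves a stable function of order s⁻², to
  -- which Cauchy's theorem applies.
  set h : RatFunc ℝ := (RatFunc.X + 1)⁻¹ with hh
  have hh' : h = algebraMap _ _ (1 : Polynomial ℝ) /
      algebraMap _ _ (Polynomial.X + 1 : Polynomial ℝ) := by
    rw [hh]; simp
  have hreg : h ∈ regularOn rhp := by
    rw [hh']
    refine div_mem_regularOn _ fun z hz h0 => ?_
    have hz' : 0 ≤ z.re := hz
    have := congrArg Complex.re h0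
    simp at this
    linarith
  have hev (w : ℝ) : (ev (w * Complex.I) h).re = (1 + w ^ 2)⁻¹ := by
    rw [hh', ev_div]
    · simp [Complex.normSq_apply]; ring_nf
    · intro h0
      have := congrArg Complex.re h0
      simp at this
  have hlead : HasLead h 1 := by
    have : RatFunc.X * h - RatFunc.C 1 = algebraMap _ (RatFunc ℝ) (-1 : Polynomial ℝ) /
        algebraMap _ _ (Polynomial.X + 1 : Polynomial ℝ) := by
      rw [hh]; simp; field_simp; ring
    rw [HasLead, this, infVal_div_lt_one_iff (by exact Polynomial.X_add_C_ne_zero (1 : ℝ))]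
    rw [Polynomial.degree_neg, Polynomial.degree_one]
    exact (Polynomial.degree_X_add_C (1 : ℝ)).symm ▸ zero_lt_one
  set g := f - RatFunc.C c * h with hg
  have hgreg : g ∈ regularOn rhp := sub_mem hf (mul_mem (C_mem_regularOn _ _) hreg)
  have hg2 : infVal ℝ g ≤ exp (-2) := by
    rw [← hasLead_zero_iff]
    simpa using hc.sub (hlead.C_mul c)
  have hgi := integrable_ev_axis (regularOn_mono imAxis_subset_rhp hgreg) hg2
  have hdec (w : ℝ) : (ev (w * Complex.I) f).re =
      (ev (w * Complex.I) g).re + c * (1 + w ^ 2)⁻¹ := by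
    have hw : (w * Complex.I : ℂ) ∈ rhp := by simp
    have : f = g + RatFunc.C c * h := by rw [hg]; ring
    conv_lhs => rw [this]
    rw [ev_add hw hgreg (mul_mem (C_mem_regularOn _ _) hreg), ev_mul hw (C_mem_regularOn _ _) hreg,
      ev_C, Complex.add_re, Complex.re_ofReal_mul, hev]
  simp only [hdec]
  refine ⟨hgi.re.add (integrable_inv_one_add_sq.const_mul c), ?_⟩
  have hre := integral_re hgi
  have hgr := hgi.re
  simp only [RCLike.re_eq_complex_re] at hre hgr
  rw [integral_add hgr (integrable_inv_one_add_sq.const_mul c), integral_const_mul,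
    integral_univ_inv_one_add_sq, hre, integral_ev_axis_eq_zero hgreg hg2]
  simp [mul_comm]

/-- Reflection makes the function stable and changes the sign of the leading coefficient, but not
the real part on the axis. -/
lemma integral_re_ev_axis_antistable {f : RatFunc ℝ} {c : ℝ} (hf : f ∈ regularOn lhp)
    (hc : HasLead f c) :
    Integrable (fun w : ℝ => (ev (w * Complex.I) f).re) ∧
      ∫ w : ℝ, (ev (w * Complex.I) f).re = -(Real.pi * c) := by
  have h := integral_re_ev_axis (negVar_antistable hf) hc.negVar
  have h2 (w : ℝ) : (ev (w * Complex.I) (negVar f)).re = (ev (w * Complex.I) f).re := by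
    rw [ev_negVar_axis (regularOn_mono imAxis_subset_lhp hf)]; simp
  simpa only [h2, mul_neg] using h

end LQG

end

noncomputable section

namespace LQG

open WithZero
open scoped RatFunc

/-! ### Residues -/

lemma residue_eq_coeff (z : ℂ) (f : RatFunc ℂ) :
    residue z f = (algebraMap (RatFunc ℂ) (LaurentSeries ℂ) (RatFunc.laurent z f)).coeff (-1) := by
  rw [residue, ← RatFunc.algebraMap_apply_div, RatFunc.num_div_denom]

lemma residue_add (z : ℂ) (f g : RatFunc ℂ) : residue z (f + g) = residue z f + residue z g := by
  simp [residue_eq_coeff]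

lemma algebraMap_polynomial_laurentSeries (p : Polynomial ℂ) :
    algebraMap (RatFunc ℂ) (LaurentSeries ℂ) (algebraMap _ _ p) =
      ((p : PowerSeries ℂ) : LaurentSeries ℂ) := by
  rw [RatFunc.coe_coe, RatFunc.coePolynomial_eq_algebraMap]

lemma residue_C_mul (z c : ℂ) (f : RatFunc ℂ) : residue z (RatFunc.C c * f) = c * residue z f := by
  rw [residue_eq_coeff, residue_eq_coeff, map_mul, RatFunc.laurent_C, map_mul,
    ← RatFunc.algebraMap_C, algebraMap_polynomial_laurentSeries, Polynomial.coe_C]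
  simp

/-- Recentred at `z`, the denominator has nonzero constant coefficient, so its inverse is a power
series without negative powers. -/
lemma residue_inv_pow_of_ne {z a : ℂ} (h : z ≠ a) (k : ℕ) :
    residue z ((RatFunc.X - RatFunc.C a)⁻¹ ^ k) = 0 := by
  have h0 : PowerSeries.constantCoeff ((Polynomial.X + Polynomial.C (z - a) : Polynomial ℂ) :
      PowerSeries ℂ) ≠ 0 := by
    simpa using sub_ne_zero.2 h
  have h1 : RatFunc.laurent z ((RatFunc.X - RatFunc.C a)⁻¹ ^ k) =
      (algebraMap _ _ (Polynomial.X + Polynomial.C (z - a) : Polynomial ℂ))⁻¹ ^ k := by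
    simp only [map_pow, map_inv₀, map_sub, RatFunc.laurent_X, RatFunc.laurent_C, map_add,
      RatFunc.algebraMap_X, RatFunc.algebraMap_C]
    ring
  have h2 : ((((Polynomial.X + Polynomial.C (z - a) : Polynomial ℂ) : PowerSeries ℂ)) :
      LaurentSeries ℂ)⁻¹ =
      ((((Polynomial.X + Polynomial.C (z - a) : Polynomial ℂ) : PowerSeries ℂ)⁻¹ :
        PowerSeries ℂ) : LaurentSeries ℂ) := by
    refine inv_eq_of_mul_eq_one_right ?_
    rw [← map_mul, PowerSeries.mul_inv_cancel _ h0, map_one]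
  rw [residue_eq_coeff, h1, map_pow, map_inv₀, algebraMap_polynomial_laurentSeries, h2, ← map_pow]
  rw [PowerSeries.coeff_coe]
  simp

lemma residue_inv_pow_self (z : ℂ) (j : ℕ) :
    residue z ((RatFunc.X - RatFunc.C z)⁻¹ ^ (j + 1)) = if j = 0 then 1 else 0 := by
  have h1 : RatFunc.laurent z ((RatFunc.X - RatFunc.C z)⁻¹ ^ (j + 1)) =
      RatFunc.X ^ (-(j + 1 : ℕ) : ℤ) := by
    simp only [map_pow, map_inv₀, map_sub, RatFunc.laurent_X, RatFunc.laurent_C,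
      add_sub_cancel_right, _root_.zpow_neg, zpow_natCast, inv_pow]
  rw [residue_eq_coeff, h1, map_zpow₀, RatFunc.coe_X, ← RatFunc.single_zpow,
    HahnSeries.coeff_single]
  congr 1
  rw [eq_iff_iff]
  push_cast
  omega

lemma hasLead_inv_pow (z : ℂ) (j : ℕ) :
    HasLead ((RatFunc.X - RatFunc.C z)⁻¹ ^ (j + 1) : RatFunc ℂ) (if j = 0 then 1 else 0) := by
  have hX : (RatFunc.X - RatFunc.C z : RatFunc ℂ) =
      algebraMap _ _ (Polynomial.X - Polynomial.C z : Polynomial ℂ) := by simp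
  have h0 : (RatFunc.X - RatFunc.C z : RatFunc ℂ) ≠ 0 := by
    rw [hX]; exact RatFunc.algebraMap_ne_zero (Polynomial.X_sub_C_ne_zero z)
  have hlt : infVal ℂ ((RatFunc.X - RatFunc.C z)⁻¹ : RatFunc ℂ) = exp (-1) := by
    rw [map_inv₀, hX, infVal_polynomial (Polynomial.X_sub_C_ne_zero z),
      Polynomial.natDegree_X_sub_C, WithZero.exp_neg]
    rfl
  rcases j with _ | j
  · have : RatFunc.X * (RatFunc.X - RatFunc.C z)⁻¹ ^ (0 + 1) - RatFunc.C 1 =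
      RatFunc.C z * (RatFunc.X - RatFunc.C z)⁻¹ := by
      rw [map_one, zero_add, pow_one, ← mul_inv_cancel₀ h0]; ring
    simp only [if_true]
    rw [HasLead, this, map_mul, hlt]
    refine (mul_le_of_le_one_left' (infVal_C_le z)).trans_lt ?_
    rw [← exp_zero, exp_lt_exp]; norm_num
  · simp only [Nat.add_eq_zero_iff, one_ne_zero, and_false, if_false]
    rw [hasLead_zero_iff, map_pow, hlt, ← WithZero.exp_nsmul, exp_le_exp]
    simp

/-- Both sides can be read off the partial fraction expansion: of the terms (s - z)^(-j-1), only j =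
0 contributes to the residue at z, and only j = 0 contributes to the leading coefficient, each time
with its own coefficient. -/
lemma sum_residue_eq_lead {f : RatFunc ℂ} {c : ℂ} (hc : HasLead f c) :
    ∑ z ∈ f.denom.roots.toFinset, residue z f = c := by
  classical
  set s := f.denom.roots.toFinset with hs
  set n : ℂ → ℕ := fun z => f.denom.roots.count z
  have hfac : f.denom = ∏ z ∈ s, (Polynomial.X - Polynomial.C z) ^ n z := by
    conv_lhs => rw [(IsAlgClosed.splits f.denom).eq_prod_roots_of_monic f.monic_denom]
    rw [Finset.prod_multiset_map_count]
  have hgi : ∀ z ∈ s, (fun z : ℂ => (RatFunc.X - RatFunc.C z : RatFunc ℂ)⁻¹) z *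
      algebraMap (Polynomial ℂ) (RatFunc ℂ) (Polynomial.X - Polynomial.C z) = 1 := by
    intro z _
    have h0 := RatFunc.algebraMap_ne_zero (K := ℂ) (Polynomial.X_sub_C_ne_zero z)
    simp only [map_sub, RatFunc.algebraMap_X, RatFunc.algebraMap_C] at h0 ⊢
    exact inv_mul_cancel₀ h0
  obtain ⟨q, r, hr, h⟩ := Polynomial.mul_prod_pow_inverse_eq_quo_add_sum_rem_mul_pow_inverse
    (K := RatFunc ℂ) (s := s) f.num (g := fun z => Polynomial.X - Polynomial.C z)
    (fun z _ => Polynomial.monic_X_sub_C z)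
    (fun z _ w _ hzw => Polynomial.isCoprime_X_sub_C_of_isUnit_sub (sub_ne_zero.2 hzw).isUnit)
    n hgi
  have hf : f = algebraMap _ (RatFunc ℂ) f.num *
      ∏ z ∈ s, (RatFunc.X - RatFunc.C z : RatFunc ℂ)⁻¹ ^ n z := by
    conv_lhs => rw [← RatFunc.num_div_denom f]
    rw [div_eq_mul_inv]
    congr 1
    conv_lhs => rw [hfac]
    simp [map_prod]
  rw [← hf] at h
  -- The remainders modulo the linear polynomials `X - C z` have degree below one, hence are
  -- constants.
  have hrc : ∀ z ∈ s, ∀ j, r z j = Polynomial.C ((r z j).coeff 0) := fun z hz j =>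
    by
      have h1 := hr z hz j
      rw [Polynomial.degree_X_sub_C, ← Nat.cast_one,
        Polynomial.degree_lt_iff_coeff_zero] at h1
      ext (_ | m)
      · simp
      · rw [h1 _ (Nat.le_add_left _ _), Polynomial.coeff_C_succ]
  set t : ℂ → ℂ := fun z => ∑ j : Fin (n z), (r z j).coeff 0 * (if (j : ℕ) = 0 then 1 else 0)
  set g : RatFunc ℂ := ∑ z ∈ s, ∑ j, algebraMap (Polynomial ℂ) (RatFunc ℂ) (r z j) *
    (RatFunc.X - RatFunc.C z)⁻¹ ^ (j.1 + 1) with hg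
  have hlg : HasLead g (∑ z ∈ s, t z) := by
    refine hasLead_sum _ fun z hz => hasLead_sum _ fun j _ => ?_
    rw [hrc z hz j, RatFunc.algebraMap_C, Polynomial.coeff_C_zero]
    exact (hasLead_inv_pow z j).C_mul _
  -- The polynomial part is the difference of two strictly proper functions.
  have hq : q = 0 := by
    by_contra hq
    have h1 : infVal ℂ (algebraMap _ (RatFunc ℂ) q) < 1 := by
      have : algebraMap _ (RatFunc ℂ) q = f - g := by rw [h]; ring
      rw [this]
      exact (hc.sub hlg).infVal_lt
    rw [infVal_polynomial hq, ← exp_zero, exp_lt_exp] at h1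
    omega
  rw [hq, map_zero, zero_add] at h
  rw [← h] at hlg
  rw [hc.unique hlg]
  refine Finset.sum_congr rfl fun w hw => ?_
  have hres0 (z : ℂ) : residue z 0 = 0 := by simpa using residue_C_mul z 0 0
  have hsum {ι : Type} (u : Finset ι) (φ : ι → RatFunc ℂ) :
      residue w (∑ i ∈ u, φ i) = ∑ i ∈ u, residue w (φ i) := by
    induction u using Finset.induction_on with
    | empty => simpa using hres0 w
    | insert i u hi ih => rw [Finset.sum_insert hi, Finset.sum_insert hi, residue_add, ih]
  rw [h, hsum]
  simp only [hsum]
  rw [Finset.sum_eq_single w]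
  · refine Finset.sum_congr rfl fun j _ => ?_
    rw [hrc w hw j, RatFunc.algebraMap_C, residue_C_mul, residue_inv_pow_self,
      Polynomial.coeff_C_zero]
  · intro z hz hzw
    refine Finset.sum_eq_zero fun j _ => ?_
    rw [hrc z hz j, RatFunc.algebraMap_C, residue_C_mul, residue_inv_pow_of_ne hzw.symm, mul_zero]
  · exact fun h => absurd hw h

lemma toComplex_algebraMap (p : Polynomial ℝ) :
    toComplex (algebraMap _ _ p) = algebraMap _ (RatFunc ℂ) (p.map (algebraMap ℝ ℂ)) := by
  have := RatFunc.map_apply_div (Polynomial.mapRingHom (algebraMap ℝ ℂ))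
    (nonZeroDivisors_le_comap_nonZeroDivisors_of_injective _
      (Polynomial.map_injective _ (algebraMap ℝ ℂ).injective)) p 1
  simp only [map_one, div_one] at this
  simpa [toComplex, RatFunc.coe_mapRingHom_eq_coe_map] using this

lemma toComplex_eq_div (f : RatFunc ℝ) : toComplex f =
    algebraMap _ (RatFunc ℂ) (f.num.map (algebraMap ℝ ℂ)) /
      algebraMap _ (RatFunc ℂ) (f.denom.map (algebraMap ℝ ℂ)) := by
  conv_lhs => rw [← RatFunc.num_div_denom f]
  rw [map_div₀, toComplex_algebraMap, toComplex_algebraMap]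

lemma map_ne_zero_of_ne_zero {p : Polynomial ℝ} (hp : p ≠ 0) : p.map (algebraMap ℝ ℂ) ≠ 0 :=
  (Polynomial.map_ne_zero_iff (algebraMap ℝ ℂ).injective).2 hp

lemma infVal_toComplex_lt_one {f : RatFunc ℝ} (hf : infVal ℝ f < 1) :
    infVal ℂ (toComplex f) < 1 := by
  rw [toComplex_eq_div, infVal_div_lt_one_iff (map_ne_zero_of_ne_zero f.denom_ne_zero),
    Polynomial.degree_map, Polynomial.degree_map]
  exact infVal_lt_one_iff.1 hf

lemma HasLead.toComplex {f : RatFunc ℝ} {c : ℝ} (hf : HasLead f c) :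
    HasLead (toComplex f) (c : ℂ) := by
  have h := infVal_toComplex_lt_one hf
  rw [map_sub, map_mul, ← RatFunc.algebraMap_X, ← RatFunc.algebraMap_C, toComplex_algebraMap,
    toComplex_algebraMap] at h
  simpa [HasLead] using h

/-- For a stable function the restriction to `Re s ≤ 0` discards no pole, so the sum runs over all
poles and equals the leading coefficient. That coefficient is real, so passing to the real part
loses nothing. -/
lemma residueSum_eq {f : RatFunc ℝ} {c : ℝ} (hf : f ∈ regularOn rhp) (hc : HasLead f c) :
    residueSum f = c := by
  classical
  have hroots : ∀ z ∈ (toComplex f).denom.roots.toFinset, z.re ≤ 0 := by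
    intro z hz
    by_contra hneg
    rw [Multiset.mem_toFinset, Polynomial.mem_roots', Polynomial.IsRoot] at hz
    have hdvd : (toComplex f).denom ∣ f.denom.map (algebraMap ℝ ℂ) := by
      rw [toComplex_eq_div]; exact RatFunc.denom_div_dvd _ _
    have := Polynomial.eval_eq_zero_of_dvd_of_eval_eq_zero hdvd hz.2
    rw [Polynomial.eval_map_algebraMap] at this
    exact hf z (not_le.1 hneg).le this
  rw [residueSum]
  have h := sum_residue_eq_lead hc.toComplex
  rw [show ({z ∈ (toComplex f).denom.roots.toFinset | z.re ≤ 0} : Finset ℂ) =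
    (toComplex f).denom.roots.toFinset from Finset.filter_true_of_mem hroots]
  rw [h]
  simp

end LQG

end

noncomputable section

namespace LQG

open WithZero

/-! ### Transfer matrices -/

section Matrices

variable {ι κ μ : Type*}

lemma const_mul [Fintype κ] (M : Matrix ι κ ℝ) (N : Matrix κ μ ℝ) :
    const (M * N) = const M * const N := Matrix.map_mul

lemma const_add (M N : Matrix ι κ ℝ) : const (M + N) = const M + const N :=
  Matrix.map_add _ (map_add _) M N

lemma const_neg (M : Matrix ι κ ℝ) : const (-M) = -const M := by ext; simp [const]

lemma const_zero : const (0 : Matrix ι κ ℝ) = 0 := by ext; simp [const]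

lemma const_one [DecidableEq ι] : const (1 : Matrix ι ι ℝ) = 1 :=
  Matrix.map_one _ (map_zero _) (map_one _)

lemma const_transpose (M : Matrix ι κ ℝ) : const Mᵀ = (const M)ᵀ := rfl

lemma const_injective : Function.Injective (const : Matrix ι κ ℝ → _) := fun M N h => by
  ext i j
  exact RatFunc.C_injective (congrFun (congrFun h i) j)

lemma const_fromBlocks {ι' κ' : Type*} (A : Matrix ι κ ℝ) (B : Matrix ι κ' ℝ) (C : Matrix ι' κ ℝ)
    (D : Matrix ι' κ' ℝ) :
    const (fromBlocks A B C D) = fromBlocks (const A) (const B) (const C) (const D) :=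
  fromBlocks_map _ _ _ _ _

lemma const_fromRows {ι' : Type*} (A : Matrix ι κ ℝ) (B : Matrix ι' κ ℝ) :
    const (fromRows A B) = fromRows (const A) (const B) := by
  ext (i | i) j <;> rfl

lemma const_fromCols {κ' : Type*} (A : Matrix ι κ ℝ) (B : Matrix ι κ' ℝ) :
    const (fromCols A B) = fromCols (const A) (const B) := by
  ext i (j | j) <;> rfl

/-- All entries are free of poles in `s`. -/
def RegMat (s : Set ℂ) (M : Matrix ι κ (RatFunc ℝ)) : Prop := ∀ i j, M i j ∈ regularOn s

/-- All entries are proper. -/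
def ProperMat (M : Matrix ι κ (RatFunc ℝ)) : Prop := ∀ i j, infVal ℝ (M i j) ≤ 1

/-- All entries are strictly proper. -/
def SProperMat (M : Matrix ι κ (RatFunc ℝ)) : Prop := ∀ i j, infVal ℝ (M i j) < 1

/-- `s M(s) → L` as `s → ∞`. -/
def HasLeadMat (M : Matrix ι κ (RatFunc ℝ)) (L : Matrix ι κ ℝ) : Prop :=
  ∀ i j, HasLead (M i j) (L i j)

lemma mem_RHinf0 {M : Matrix ι κ (RatFunc ℝ)} : M ∈ RHinf0 ι κ ↔ RegMat rhp M ∧ SProperMat M := by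
  simp only [RHinf0, RegMat, SProperMat, isStable_iff, isStrictlyProper_iff]
  exact ⟨fun h => ⟨fun i j => (h i j).1, fun i j => (h i j).2⟩, fun h i j => ⟨h.1 i j, h.2 i j⟩⟩

variable {s : Set ℂ}

lemma regMat_const (M : Matrix ι κ ℝ) : RegMat s (const M) := fun _ _ => C_mem_regularOn _ _

lemma RegMat.mono {t : Set ℂ} {M : Matrix ι κ (RatFunc ℝ)} (h : RegMat t M) (hst : s ⊆ t) :
    RegMat s M := fun i j => regularOn_mono hst (h i j)

lemma RegMat.axis {M : Matrix ι κ (RatFunc ℝ)} (h : RegMat rhp M) : RegMat imAxis M :=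
  h.mono imAxis_subset_rhp

lemma RegMat.axis' {M : Matrix ι κ (RatFunc ℝ)} (h : RegMat lhp M) : RegMat imAxis M :=
  h.mono imAxis_subset_lhp

lemma RegMat.add {M N : Matrix ι κ (RatFunc ℝ)} (hM : RegMat s M) (hN : RegMat s N) :
    RegMat s (M + N) := fun i j => add_mem (hM i j) (hN i j)

lemma RegMat.mul [Fintype κ] {M : Matrix ι κ (RatFunc ℝ)} {N : Matrix κ μ (RatFunc ℝ)}
    (hM : RegMat s M) (hN : RegMat s N) : RegMat s (M * N) := fun i j => by
  rw [Matrix.mul_apply]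
  exact sum_mem fun k _ => mul_mem (hM i k) (hN k j)

lemma RegMat.trace [Fintype ι] {M : Matrix ι ι (RatFunc ℝ)} (h : RegMat s M) :
    M.trace ∈ regularOn s := sum_mem fun i _ => h i i

lemma properMat_const (M : Matrix ι κ ℝ) : ProperMat (const M) := fun _ _ => infVal_C_le _

lemma SProperMat.proper {M : Matrix ι κ (RatFunc ℝ)} (h : SProperMat M) : ProperMat M :=
  fun i j => (h i j).le

lemma ProperMat.add {M N : Matrix ι κ (RatFunc ℝ)} (hM : ProperMat M) (hN : ProperMat N) :
    ProperMat (M + N) := fun i j => (infVal ℝ).map_add_le (hM i j) (hN i j)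

lemma SProperMat.add {M N : Matrix ι κ (RatFunc ℝ)} (hM : SProperMat M) (hN : SProperMat N) :
    SProperMat (M + N) := fun i j => (infVal ℝ).map_add_lt (hM i j) (hN i j)

lemma SProperMat.neg {M : Matrix ι κ (RatFunc ℝ)} (hM : SProperMat M) :
    SProperMat (-M) := fun i j => by
  rw [Matrix.neg_apply, Valuation.map_neg]; exact hM i j

lemma SProperMat.sub {M N : Matrix ι κ (RatFunc ℝ)} (hM : SProperMat M) (hN : SProperMat N) :
    SProperMat (M - N) := sub_eq_add_neg M N ▸ hM.add hN.neg

lemma ProperMat.mul [Fintype κ] {M : Matrix ι κ (RatFunc ℝ)} {N : Matrix κ μ (RatFunc ℝ)}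
    (hM : ProperMat M) (hN : ProperMat N) : ProperMat (M * N) := fun i j => by
  rw [Matrix.mul_apply]
  refine (infVal ℝ).map_sum_le fun k _ => ?_
  rw [map_mul]
  exact mul_le_one' (hM i k) (hN k j)

lemma SProperMat.mul_proper [Fintype κ] {M : Matrix ι κ (RatFunc ℝ)}
    {N : Matrix κ μ (RatFunc ℝ)} (hM : SProperMat M) (hN : ProperMat N) :
    SProperMat (M * N) := fun i j => by
  rw [Matrix.mul_apply]
  refine (infVal ℝ).map_sum_lt one_ne_zero fun k _ => ?_
  rw [map_mul]
  exact mul_lt_one_of_lt_of_le (hM i k) (hN k j)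

lemma ProperMat.mul_sproper [Fintype κ] {M : Matrix ι κ (RatFunc ℝ)}
    {N : Matrix κ μ (RatFunc ℝ)} (hM : ProperMat M) (hN : SProperMat N) :
    SProperMat (M * N) := fun i j => by
  rw [Matrix.mul_apply]
  refine (infVal ℝ).map_sum_lt one_ne_zero fun k _ => ?_
  rw [map_mul, mul_comm]
  exact mul_lt_one_of_lt_of_le (hN k j) (hM i k)

lemma HasLeadMat.sproper {M : Matrix ι κ (RatFunc ℝ)} {L : Matrix ι κ ℝ} (h : HasLeadMat M L) :
    SProperMat M := fun i j => (h i j).infVal_lt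

lemma HasLeadMat.const_mul [Fintype κ] (A : Matrix ι κ ℝ) {M : Matrix κ μ (RatFunc ℝ)}
    {L : Matrix κ μ ℝ} (h : HasLeadMat M L) : HasLeadMat (const A * M) (A * L) := fun i j => by
  rw [Matrix.mul_apply, Matrix.mul_apply]
  exact hasLead_sum _ fun k _ => (h k j).C_mul _

lemma HasLeadMat.mul_const [Fintype κ] (A : Matrix κ μ ℝ) {M : Matrix ι κ (RatFunc ℝ)}
    {L : Matrix ι κ ℝ} (h : HasLeadMat M L) : HasLeadMat (M * const A) (L * A) := fun i j => by
  rw [Matrix.mul_apply, Matrix.mul_apply]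
  refine hasLead_sum _ fun k _ => ?_
  rw [mul_comm, mul_comm (L i k)]
  exact (h i k).C_mul _

lemma HasLeadMat.trace [Fintype ι] {M : Matrix ι ι (RatFunc ℝ)} {L : Matrix ι ι ℝ}
    (h : HasLeadMat M L) : HasLead M.trace L.trace := hasLead_sum _ fun i _ => h i i

/-! ### Evaluation and para-conjugation -/

lemma evalAt_add {z : ℂ} (hz : z ∈ s) {M N : Matrix ι κ (RatFunc ℝ)} (hM : RegMat s M)
    (hN : RegMat s N) : evalAt (M + N) z = evalAt M z + evalAt N z := by
  ext i j; exact ev_add hz (hM i j) (hN i j)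

lemma evalAt_mul [Fintype κ] {z : ℂ} (hz : z ∈ s) {M : Matrix ι κ (RatFunc ℝ)}
    {N : Matrix κ μ (RatFunc ℝ)} (hM : RegMat s M) (hN : RegMat s N) :
    evalAt (M * N) z = evalAt M z * evalAt N z := by
  ext i j
  simp only [evalAt, Matrix.map_apply, Matrix.mul_apply]
  exact (ev_sum hz _ fun k _ => mul_mem (hM i k) (hN k j)).trans
    (Finset.sum_congr rfl fun k _ => ev_mul hz (hM i k) (hN k j))

lemma trace_evalAt [Fintype ι] {z : ℂ} (hz : z ∈ s) {M : Matrix ι ι (RatFunc ℝ)}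
    (hM : RegMat s M) : (evalAt M z).trace = ev z M.trace :=
  (ev_sum hz _ fun i _ => hM i i).symm

lemma evalAt_paraConj {M : Matrix ι κ (RatFunc ℝ)} (hM : RegMat imAxis M) (w : ℝ) :
    evalAt (paraConj M) (w * Complex.I) = (evalAt M (w * Complex.I))ᴴ := by
  ext i j; exact ev_negVar_axis (hM j i) w

lemma paraConj_mul [Fintype κ] (M : Matrix ι κ (RatFunc ℝ)) (N : Matrix κ μ (RatFunc ℝ)) :
    paraConj (M * N) = paraConj N * paraConj M := by
  rw [paraConj, Matrix.map_mul, Matrix.transpose_mul]; rfl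

lemma paraConj_add (M N : Matrix ι κ (RatFunc ℝ)) :
    paraConj (M + N) = paraConj M + paraConj N := by
  ext i j; exact map_add negVar _ _

lemma paraConj_const (M : Matrix ι κ ℝ) : paraConj (const M) = const Mᵀ := by
  ext i j; exact negVar_C _

lemma paraConj_paraConj (M : Matrix ι κ (RatFunc ℝ)) : paraConj (paraConj M) = M := by
  ext i j; exact negVar_negVar _

lemma paraConj_one [DecidableEq ι] : paraConj (1 : Matrix ι ι (RatFunc ℝ)) = 1 := by
  rw [← const_one, paraConj_const, Matrix.transpose_one]

lemma RegMat.paraConj_of_stable {M : Matrix ι κ (RatFunc ℝ)} (h : RegMat rhp M) :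
    RegMat lhp (paraConj M) := fun i j => negVar_stable (h j i)

lemma RegMat.paraConj_of_antistable {M : Matrix ι κ (RatFunc ℝ)} (h : RegMat lhp M) :
    RegMat rhp (paraConj M) := fun i j => negVar_antistable (h j i)

lemma RegMat.paraConj_axis {M : Matrix ι κ (RatFunc ℝ)} (h : RegMat imAxis M) :
    RegMat imAxis (paraConj M) := fun i j => negVar_imAxis (h j i)

lemma ProperMat.paraConj {M : Matrix ι κ (RatFunc ℝ)} (h : ProperMat M) :
    ProperMat (paraConj M) := fun i j => (infVal_negVar _).trans_le (h j i)

lemma SProperMat.paraConj {M : Matrix ι κ (RatFunc ℝ)} (h : SProperMat M) :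
    SProperMat (paraConj M) := fun i j => (infVal_negVar _).trans_lt (h j i)

/-! ### The inner product -/

lemma trace_paraConj_mul_isO2 [Fintype ι] [Fintype κ] {G H : Matrix ι κ (RatFunc ℝ)}
    (hG : SProperMat G) (hH : SProperMat H) : infVal ℝ (paraConj G * H).trace ≤ exp (-2) := by
  rw [← hasLead_zero_iff, Matrix.trace]
  have := hasLead_sum Finset.univ (f := fun i => (paraConj G * H).diag i) (a := fun _ => (0 : ℝ))
    fun i _ => by
      rw [Matrix.diag_apply, Matrix.mul_apply]
      have := hasLead_sum Finset.univ (f := fun k => paraConj G i k * H k i)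
        (a := fun _ => (0 : ℝ)) fun k _ => hasLead_mul (hG.paraConj i k) (hH k i)
      simpa using this
  simpa using this

lemma integrable_re_trace [Fintype ι] [Fintype κ] {G H : Matrix ι κ (RatFunc ℝ)}
    (hG : RegMat imAxis G) (hH : RegMat imAxis H) (hG' : SProperMat G) (hH' : SProperMat H) :
    Integrable fun w : ℝ => (ev (w * Complex.I) (paraConj G * H).trace).re :=
  (integrable_ev_axis (hG.paraConj_axis.mul hH).trace (trace_paraConj_mul_isO2 hG' hH')).re

lemma trace_evalAt_axis [Fintype ι] [Fintype κ] {G H : Matrix ι κ (RatFunc ℝ)}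
    (hG : RegMat imAxis G) (hH : RegMat imAxis H) (w : ℝ) :
    ((evalAt G (w * Complex.I))ᴴ * evalAt H (w * Complex.I)).trace =
      ev (w * Complex.I) (paraConj G * H).trace := by
  have hw : (w * Complex.I : ℂ) ∈ imAxis := by simp
  rw [← evalAt_paraConj hG, ← evalAt_mul hw hG.paraConj_axis hH,
    trace_evalAt hw (hG.paraConj_axis.mul hH)]

lemma h2Inner_eq [Fintype ι] [Fintype κ] {G H : Matrix ι κ (RatFunc ℝ)}
    (hG : RegMat imAxis G) (hH : RegMat imAxis H) :
    h2Inner G H = (2 * Real.pi)⁻¹ * ∫ w : ℝ, (ev (w * Complex.I) (paraConj G * H).trace).re := by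
  simp only [h2Inner, trace_evalAt_axis hG hH]

lemma h2Inner_comm [Fintype ι] [Fintype κ] (G H : Matrix ι κ (RatFunc ℝ)) :
    h2Inner G H = h2Inner H G := by
  unfold h2Inner
  congr 2
  ext w
  rw [← Complex.conj_re, starRingEnd_apply, ← Matrix.trace_conjTranspose,
    Matrix.conjTranspose_mul, Matrix.conjTranspose_conjTranspose]

lemma h2NormSq_nonneg [Fintype ι] [Fintype κ] (G : Matrix ι κ (RatFunc ℝ)) : 0 ≤ h2NormSq G := by
  unfold h2NormSq h2Inner
  refine mul_nonneg (by positivity) (integral_nonneg fun w => ?_)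
  simp only [Matrix.trace, Matrix.diag_apply, Matrix.mul_apply, Matrix.conjTranspose_apply,
    Complex.re_sum]
  refine Finset.sum_nonneg fun i _ => Finset.sum_nonneg fun j _ => ?_
  rw [Complex.star_def, ← Complex.normSq_eq_conj_mul_self, Complex.ofReal_re]
  exact Complex.normSq_nonneg _

lemma h2Inner_add_right [Fintype ι] [Fintype κ] {F G H : Matrix ι κ (RatFunc ℝ)}
    (hF : F ∈ RHinf0 ι κ) (hG : G ∈ RHinf0 ι κ) (hH : H ∈ RHinf0 ι κ) :
    h2Inner F (G + H) = h2Inner F G + h2Inner F H := by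
  rw [mem_RHinf0] at *
  have f := hF.1.axis; have g := hG.1.axis; have h := hH.1.axis
  rw [h2Inner_eq f (g.add h), h2Inner_eq f g, h2Inner_eq f h, ← mul_add,
    ← integral_add (integrable_re_trace f g hF.2 hG.2) (integrable_re_trace f h hF.2 hH.2)]
  congr 2
  ext w
  rw [Matrix.mul_add, Matrix.trace_add, ev_add (s := imAxis) (by simp) (f.paraConj_axis.mul g).trace
    (f.paraConj_axis.mul h).trace, Complex.add_re]

lemma h2Inner_smul_right [Fintype ι] [Fintype κ] (c : ℝ) {G H : Matrix ι κ (RatFunc ℝ)}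
    (hG : G ∈ RHinf0 ι κ) (hH : H ∈ RHinf0 ι κ) :
    h2Inner G (c • H) = c * h2Inner G H := by
  rw [mem_RHinf0] at *
  have g := hG.1.axis; have h := hH.1.axis
  have hc : RegMat imAxis (c • H) := fun i j => Subalgebra.smul_mem _ (h i j) c
  rw [h2Inner_eq g h, h2Inner_eq g hc, mul_left_comm c, ← integral_const_mul c]
  congr 1
  refine integral_congr_ae (ae_of_all _ fun w => ?_)
  beta_reduce
  rw [Matrix.mul_smul, Matrix.trace_smul, RatFunc.smul_eq_C_mul, ev_mul (s := imAxis) (by simp)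
    (C_mem_regularOn _ _) (g.paraConj_axis.mul h).trace, ev_C, Complex.re_ofReal_mul]

end Matrices

/-- `RH_{∞,0}` as a linear space. -/
def RHinf0Submodule (ι κ : Type*) : Submodule ℝ (Matrix ι κ (RatFunc ℝ)) where
  carrier := RHinf0 ι κ
  add_mem' {M N} hM hN := by
    rw [mem_RHinf0] at *
    exact ⟨hM.1.add hN.1, hM.2.add hN.2⟩
  zero_mem' := mem_RHinf0.2 ⟨fun _ _ => zero_mem _, fun _ _ => by simp⟩
  smul_mem' c M hM := by
    rw [mem_RHinf0] at *
    refine ⟨fun i j => Subalgebra.smul_mem _ (hM.1 i j) c, fun i j => ?_⟩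
    rw [Matrix.smul_apply, RatFunc.smul_eq_C_mul, map_mul]
    exact (mul_le_of_le_one_left' (infVal_C_le c)).trans_lt (hM.2 i j)

/-! ### Hurwitz matrices and resolvents -/

section Resolvent

variable {σ τ : Type*} [Fintype σ] [DecidableEq σ] [Fintype τ] [DecidableEq τ]

/-- All eigenvalues have negative real parts. -/
def Hurwitz (F : Matrix σ σ ℝ) : Prop :=
  ∀ z ∈ spectrum ℂ (F.map (algebraMap ℝ ℂ)), z.re < 0

lemma hurwitz_iff_charpoly {F : Matrix σ σ ℝ} :
    Hurwitz F ↔ ∀ z : ℂ, 0 ≤ z.re → Polynomial.aeval z F.charpoly ≠ 0 := by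
  simp only [Hurwitz, Matrix.mem_spectrum_iff_isRoot_charpoly, Matrix.charpoly_map,
    Polynomial.IsRoot, Polynomial.eval_map_algebraMap]
  exact forall_congr' fun z => by rw [← not_imp_not, not_lt]

lemma hurwitz_iff_eigenvector {F : Matrix σ σ ℝ} :
    Hurwitz F ↔ ∀ (z : ℂ) (v : σ → ℂ), v ≠ 0 → F.map (algebraMap ℝ ℂ) *ᵥ v = z • v → z.re < 0 := by
  have key (z : ℂ) : z ∈ spectrum ℂ (F.map (algebraMap ℝ ℂ)) ↔
      ∃ v : σ → ℂ, v ≠ 0 ∧ F.map (algebraMap ℝ ℂ) *ᵥ v = z • v := by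
    rw [spectrum.mem_iff, Matrix.isUnit_iff_isUnit_det, isUnit_iff_ne_zero, not_not,
      ← Matrix.exists_mulVec_eq_zero_iff]
    refine exists_congr fun v => and_congr_right fun _ => ?_
    rw [Matrix.sub_mulVec, sub_eq_zero, Algebra.algebraMap_eq_smul_one, Matrix.smul_mulVec,
      Matrix.one_mulVec, eq_comm]
  simp only [Hurwitz, key]
  exact ⟨fun h z v hv hz => h z ⟨v, hv, hz⟩, fun h z ⟨v, hv, hz⟩ => h z v hv hz⟩

lemma Hurwitz.transpose {F : Matrix σ σ ℝ} (h : Hurwitz F) : Hurwitz Fᵀ := by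
  rw [hurwitz_iff_charpoly] at *
  rwa [Matrix.charpoly_transpose]

lemma Hurwitz.fromBlocks_zero₁₂ {A : Matrix σ σ ℝ} {D : Matrix τ τ ℝ} (hA : Hurwitz A)
    (hD : Hurwitz D) (C : Matrix τ σ ℝ) : Hurwitz (fromBlocks A 0 C D) := by
  rw [hurwitz_iff_charpoly] at *
  intro z hz
  rw [Matrix.charpoly_fromBlocks_zero₁₂, map_mul]
  exact mul_ne_zero (hA z hz) (hD z hz)

lemma Hurwitz.fromBlocks_zero₂₁ {A : Matrix σ σ ℝ} {D : Matrix τ τ ℝ} (hA : Hurwitz A)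
    (hD : Hurwitz D) (B : Matrix σ τ ℝ) : Hurwitz (fromBlocks A B 0 D) := by
  rw [hurwitz_iff_charpoly] at *
  intro z hz
  rw [Matrix.charpoly_fromBlocks_zero₂₁, map_mul]
  exact mul_ne_zero (hA z hz) (hD z hz)

/-- `T` carries an eigenvector of `A` to one of `D` with the same eigenvalue, and a left inverse
keeps it nonzero. `T` need not be square, so redundant coordinates may be used. -/
lemma Hurwitz.of_intertwine {A : Matrix σ σ ℝ} {D : Matrix τ τ ℝ} (hD : Hurwitz D)
    {T : Matrix τ σ ℝ} {T' : Matrix σ τ ℝ} (hT : T' * T = 1) (h : T * A = D * T) :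
    Hurwitz A := by
  rw [hurwitz_iff_eigenvector] at *
  intro z v hv hz
  have hT' : T'.map (algebraMap ℝ ℂ) * T.map (algebraMap ℝ ℂ) = 1 := by
    rw [← Matrix.map_mul, hT, Matrix.map_one _ (map_zero _) (map_one _)]
  have h' : T.map (algebraMap ℝ ℂ) * A.map (algebraMap ℝ ℂ) =
      D.map (algebraMap ℝ ℂ) * T.map (algebraMap ℝ ℂ) := by
    rw [← Matrix.map_mul, h, Matrix.map_mul]
  refine hD z (T.map (algebraMap ℝ ℂ) *ᵥ v) (fun h0 => hv ?_) ?_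
  · rw [← Matrix.one_mulVec v, ← hT', ← Matrix.mulVec_mulVec, h0, Matrix.mulVec_zero]
  · rw [Matrix.mulVec_mulVec, ← h', ← Matrix.mulVec_mulVec, hz, Matrix.mulVec_smul]

/-- A strict Lyapunov inequality certifies stability. -/
lemma hurwitz_of_lyapunov {F X M : Matrix σ σ ℝ} (hX : X.PosSemidef) (hM : M.PosDef)
    (h : Fᵀ * X + X * F = -M) : Hurwitz F := by
  rw [hurwitz_iff_eigenvector]
  intro z v hv hz
  -- Splitting the complex eigenvector into real and imaginary parts keeps all quadratic forms real.
  -- Summing the Lyapunov form over both parts cancels the terms in `z.im` and leaves `-2 z.re`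
  -- times a nonnegative number, while the left side is positive.
  set a : σ → ℝ := fun i => (v i).re
  set b : σ → ℝ := fun i => (v i).im
  have ha : F *ᵥ a = z.re • a - z.im • b := by
    ext i
    have := congrArg Complex.re (congrFun hz i)
    simpa [Matrix.mulVec, dotProduct, a, b] using this
  have hb : F *ᵥ b = z.im • a + z.re • b := by
    ext i
    have := congrArg Complex.im (congrFun hz i)
    simp [Matrix.mulVec, dotProduct] at this
    simp [Matrix.mulVec, dotProduct, a, b, this]; ring
  have hsymm : Xᵀ = X := by simpa [Matrix.IsHermitian] using hX.1
  have hquad (u : σ → ℝ) : u ⬝ᵥ (M *ᵥ u) = -(2 * (u ⬝ᵥ (X *ᵥ (F *ᵥ u)))) := by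
    have h1 : M = -(Fᵀ * X + X * F) := by rw [h, neg_neg]
    have h2 : u ⬝ᵥ ((Fᵀ * X) *ᵥ u) = u ⬝ᵥ (X *ᵥ (F *ᵥ u)) := by
      rw [← Matrix.mulVec_mulVec, Matrix.dotProduct_mulVec, Matrix.vecMul_transpose,
        Matrix.dotProduct_mulVec, ← Matrix.mulVec_transpose, hsymm, dotProduct_comm]
    rw [h1, Matrix.neg_mulVec, dotProduct_neg, Matrix.add_mulVec, dotProduct_add, h2,
      ← Matrix.mulVec_mulVec]
    ring
  have hab : b ⬝ᵥ (X *ᵥ a) = a ⬝ᵥ (X *ᵥ b) := by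
    rw [Matrix.dotProduct_mulVec, ← Matrix.mulVec_transpose, hsymm, dotProduct_comm]
  have hsum : a ⬝ᵥ (M *ᵥ a) + b ⬝ᵥ (M *ᵥ b) =
      -(2 * (z.re * (a ⬝ᵥ (X *ᵥ a) + b ⬝ᵥ (X *ᵥ b)))) := by
    rw [hquad, hquad, ha, hb]
    simp only [Matrix.mulVec_sub, Matrix.mulVec_add, Matrix.mulVec_smul, dotProduct_sub,
      dotProduct_add, dotProduct_smul, smul_eq_mul]
    rw [hab]; ring
  have hpos : 0 < a ⬝ᵥ (M *ᵥ a) + b ⬝ᵥ (M *ᵥ b) := by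
    have pa : 0 ≤ a ⬝ᵥ (M *ᵥ a) := by simpa using hM.posSemidef.dotProduct_mulVec_nonneg a
    have pb : 0 ≤ b ⬝ᵥ (M *ᵥ b) := by simpa using hM.posSemidef.dotProduct_mulVec_nonneg b
    by_cases ha0 : a = 0
    · have hb0 : b ≠ 0 := by
        intro hb0
        exact hv (funext fun i => Complex.ext (congrFun ha0 i) (congrFun hb0 i))
      have : 0 < b ⬝ᵥ (M *ᵥ b) := by simpa using hM.dotProduct_mulVec_pos hb0
      linarith
    · have : 0 < a ⬝ᵥ (M *ᵥ a) := by simpa using hM.dotProduct_mulVec_pos ha0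
      linarith
  have hXpos : 0 ≤ a ⬝ᵥ (X *ᵥ a) + b ⬝ᵥ (X *ᵥ b) := by
    have pa : 0 ≤ a ⬝ᵥ (X *ᵥ a) := by simpa using hX.dotProduct_mulVec_nonneg a
    have pb : 0 ≤ b ⬝ᵥ (X *ᵥ b) := by simpa using hX.dotProduct_mulVec_nonneg b
    linarith
  by_contra hre
  have := mul_nonneg (not_lt.1 hre) hXpos
  linarith

lemma X_sub_const_eq (F : Matrix σ σ ℝ) :
    (RatFunc.X : RatFunc ℝ) • (1 : Matrix σ σ (RatFunc ℝ)) - const F =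
      (algebraMap (Polynomial ℝ) (RatFunc ℝ)).mapMatrix F.charmatrix := by
  ext i j
  by_cases h : i = j <;> simp [h, const]

lemma det_X_sub_const (F : Matrix σ σ ℝ) :
    ((RatFunc.X : RatFunc ℝ) • (1 : Matrix σ σ (RatFunc ℝ)) - const F).det =
      algebraMap _ _ F.charpoly := by
  rw [X_sub_const_eq, ← RingHom.map_det]; rfl

lemma isUnit_det_X_sub_const (F : Matrix σ σ ℝ) :
    IsUnit ((RatFunc.X : RatFunc ℝ) • (1 : Matrix σ σ (RatFunc ℝ)) - const F).det := by
  rw [det_X_sub_const]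
  exact (RatFunc.algebraMap_ne_zero F.charpoly_monic.ne_zero).isUnit

lemma sub_mul_resolvent (F : Matrix σ σ ℝ) :
    ((RatFunc.X : RatFunc ℝ) • (1 : Matrix σ σ (RatFunc ℝ)) - const F) * resolvent F = 1 :=
  Matrix.mul_nonsing_inv _ (isUnit_det_X_sub_const F)

lemma resolvent_mul_sub (F : Matrix σ σ ℝ) :
    resolvent F * ((RatFunc.X : RatFunc ℝ) • (1 : Matrix σ σ (RatFunc ℝ)) - const F) = 1 :=
  Matrix.nonsing_inv_mul _ (isUnit_det_X_sub_const F)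

lemma X_smul_resolvent (F : Matrix σ σ ℝ) :
    (RatFunc.X : RatFunc ℝ) • resolvent F = 1 + const F * resolvent F := by
  have := sub_mul_resolvent F
  rw [Matrix.sub_mul, Matrix.smul_mul, Matrix.one_mul] at this
  rw [← this]; abel

lemma resolvent_mul_eq {κ : Type*} {F : Matrix σ σ ℝ} {V G : Matrix σ κ (RatFunc ℝ)}
    (h : (RatFunc.X : RatFunc ℝ) • V = const F * V + G) : resolvent F * G = V := by
  have : G = ((RatFunc.X : RatFunc ℝ) • (1 : Matrix σ σ (RatFunc ℝ)) - const F) * V := by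
    rw [Matrix.sub_mul, Matrix.smul_mul, Matrix.one_mul, h]; abel
  rw [this, ← Matrix.mul_assoc, resolvent_mul_sub, Matrix.one_mul]

lemma Hurwitz.regMat_resolvent {F : Matrix σ σ ℝ} (hF : Hurwitz F) : RegMat rhp (resolvent F) := by
  intro i j
  have : resolvent F i j = algebraMap _ _ (F.charmatrix.adjugate i j) /
      algebraMap _ _ F.charpoly := by
    rw [resolvent, Matrix.inv_def, det_X_sub_const, X_sub_const_eq, ← RingHom.map_adjugate,
      Ring.inverse_eq_inv', Matrix.smul_apply, div_eq_inv_mul]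
    rfl
  rw [this]
  exact div_mem_regularOn _ fun z hz => hurwitz_iff_charpoly.1 hF z hz

/-- In a fixed column take the entry of largest valuation. If it were at least 1, the equation s R =
1 + F R would bound the valuation of s times this entry by that of the entry itself, which is
impossible since s has valuation `exp 1`. -/
lemma sproperMat_resolvent (F : Matrix σ σ ℝ) : SProperMat (resolvent F) := by
  intro i j
  have : Nonempty σ := ⟨i⟩
  obtain ⟨k, hk⟩ := Finite.exists_max fun k => infVal ℝ (resolvent F k j)
  refine (hk i).trans_lt ?_
  by_contra hlt
  rw [not_lt] at hlt
  have h1 := congrFun (congrFun (X_smul_resolvent F) k) j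
  have h2 : infVal ℝ (RatFunc.X * resolvent F k j) ≤ infVal ℝ (resolvent F k j) := by
    rw [Matrix.smul_apply, smul_eq_mul] at h1
    rw [h1, Matrix.add_apply, Matrix.mul_apply]
    refine (infVal ℝ).map_add_le ?_ ((infVal ℝ).map_sum_le fun l _ => ?_)
    · refine le_trans ?_ hlt
      rw [← const_one]
      exact infVal_C_le _
    · rw [map_mul]
      exact (mul_le_of_le_one_left' (infVal_C_le _)).trans (hk l)
  rw [map_mul, infVal_X] at h2
  have h0 : infVal ℝ (resolvent F k j) ≠ 0 := fun h0 => by simp [h0] at hlt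
  rw [← exp_log h0, ← exp_add, exp_le_exp] at h2
  omega

lemma hasLeadMat_resolvent (F : Matrix σ σ ℝ) : HasLeadMat (resolvent F) 1 := by
  intro i j
  have h1 := congrFun (congrFun (X_smul_resolvent F) i) j
  rw [Matrix.smul_apply, smul_eq_mul, Matrix.add_apply] at h1
  have h2 : RatFunc.C ((1 : Matrix σ σ ℝ) i j) = (1 : Matrix σ σ (RatFunc ℝ)) i j := by
    rw [← const_one]; rfl
  rw [HasLead, h1, h2, add_sub_cancel_left]
  exact (properMat_const F).mul_sproper (sproperMat_resolvent F) i j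

variable {ι κ : Type*}

lemma Hurwitz.regMat_transfer {F : Matrix σ σ ℝ} (hF : Hurwitz F) (G : Matrix σ κ ℝ)
    (H : Matrix ι σ ℝ) (D : Matrix ι κ ℝ) : RegMat rhp (transfer F G H D) :=
  (((regMat_const H).mul hF.regMat_resolvent).mul (regMat_const G)).add (regMat_const D)

lemma properMat_transfer (F : Matrix σ σ ℝ) (G : Matrix σ κ ℝ)
    (H : Matrix ι σ ℝ) (D : Matrix ι κ ℝ) : ProperMat (transfer F G H D) :=
  (((properMat_const H).mul (sproperMat_resolvent F).proper).mul (properMat_const G)).add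
    (properMat_const D)

lemma transfer_zero (F : Matrix σ σ ℝ) (G : Matrix σ κ ℝ) (H : Matrix ι σ ℝ) :
    transfer F G H 0 = const H * resolvent F * const G := by
  rw [transfer, const_zero, add_zero]

lemma hasLeadMat_transfer (F : Matrix σ σ ℝ) (G : Matrix σ κ ℝ) (H : Matrix ι σ ℝ) :
    HasLeadMat (transfer F G H 0) (H * G) := by
  rw [transfer_zero]
  simpa using ((hasLeadMat_resolvent F).const_mul H).mul_const G

lemma Hurwitz.transfer_mem {F : Matrix σ σ ℝ} (hF : Hurwitz F) (G : Matrix σ κ ℝ)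
    (H : Matrix ι σ ℝ) : transfer F G H 0 ∈ RHinf0 ι κ :=
  mem_RHinf0.2 ⟨hF.regMat_transfer _ _ _, (hasLeadMat_transfer F G H).sproper⟩

end Resolvent

end LQG

end

noncomputable section

namespace LQG

open WithZero

/-! ### Lyapunov equations -/

section Lyapunov

variable {σ τ ι κ : Type*} [Fintype σ] [DecidableEq σ] [Fintype τ] [DecidableEq τ]

/-- The equation says M = (s - F) X + X (-s - Fᵀ), so the outer resolvents cancel one factor in each
summand. This splits a product of resolvents into a stable and an antistable summand, and takes the
place of the integral formula for `X`. -/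
lemma lyapunov_resolvent_identity {F X M : Matrix σ σ ℝ} (h : F * X + X * Fᵀ = -M) :
    resolvent F * const M * paraConj (resolvent F) =
      resolvent F * const X + const X * paraConj (resolvent F) := by
  set A : Matrix σ σ (RatFunc ℝ) := (RatFunc.X : RatFunc ℝ) • (1 : Matrix σ σ (RatFunc ℝ)) - const F
    with hA
  have hB : paraConj A = -((RatFunc.X : RatFunc ℝ) • (1 : Matrix σ σ (RatFunc ℝ))) - const Fᵀ := by
    ext i j
    by_cases hij : i = j
    · simp [hA, paraConj, hij, const, negVar_X, negVar_C]
    · simp [hA, paraConj, hij, Ne.symm hij, const, negVar_C]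
  have h1 : paraConj A * paraConj (resolvent F) = 1 := by
    rw [← paraConj_mul, resolvent_mul_sub, paraConj_one]
  have h2 : const M = A * const X + const X * paraConj A := by
    have : M = -(F * X + X * Fᵀ) := by rw [h, neg_neg]
    rw [this, hB, hA, const_neg, const_add, const_mul, const_mul]
    simp only [Matrix.sub_mul, Matrix.mul_sub, Matrix.mul_neg, Matrix.smul_mul, Matrix.mul_smul,
      Matrix.one_mul, Matrix.mul_one]
    abel
  rw [h2, Matrix.mul_add, Matrix.add_mul, ← Matrix.mul_assoc, resolvent_mul_sub, Matrix.one_mul,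
    ← Matrix.mul_assoc, Matrix.mul_assoc _ (paraConj A), h1, Matrix.mul_one, add_comm]

/-- For `M = 0` the resolvent identity equates a stable strictly proper matrix with an antistable
one, so both vanish. The resolvent is then cancelled. -/
lemma Hurwitz.lyapunov_unique_zero {F X : Matrix σ σ ℝ} (hF : Hurwitz F)
    (h : F * X + X * Fᵀ = 0) : X = 0 := by
  have h1 := lyapunov_resolvent_identity (F := F) (X := X) (M := 0) (by rw [h, neg_zero])
  rw [const_zero, Matrix.mul_zero, Matrix.zero_mul, eq_comm, add_eq_zero_iff_eq_neg] at h1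
  have h2 : resolvent F * const X = 0 := by
    ext i j
    refine eq_zero_of_stable_of_antistable (hF.regMat_resolvent.mul (regMat_const X) i j) ?_
      ((sproperMat_resolvent F).mul_proper (properMat_const X) i j)
    rw [h1]
    exact neg_mem ((regMat_const X).mul hF.regMat_resolvent.paraConj_of_stable i j)
  apply const_injective
  rw [const_zero, ← Matrix.one_mul (const X), ← sub_mul_resolvent F, Matrix.mul_assoc, h2,
    Matrix.mul_zero]

lemma Hurwitz.lyapunov_unique {F X Y M : Matrix σ σ ℝ} (hF : Hurwitz F)
    (hX : F * X + X * Fᵀ = M) (hY : F * Y + Y * Fᵀ = M) : X = Y := by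
  refine sub_eq_zero.1 (hF.lyapunov_unique_zero ?_)
  rw [Matrix.mul_sub, Matrix.sub_mul, sub_add_sub_comm, hX, hY, sub_self]

lemma Hurwitz.exists_lyapunov {F : Matrix σ σ ℝ} (hF : Hurwitz F) (M : Matrix σ σ ℝ) :
    ∃ X, F * X + X * Fᵀ = M := by
  let T : Matrix σ σ ℝ →ₗ[ℝ] Matrix σ σ ℝ :=
    LinearMap.mulLeft ℝ F + LinearMap.mulRight ℝ Fᵀ
  have hT : Function.Injective T := by
    rw [injective_iff_map_eq_zero]
    exact fun X hX => hF.lyapunov_unique_zero hX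
  exact LinearMap.injective_iff_surjective.1 hT M

lemma Hurwitz.lyapunov_spec {F : Matrix σ σ ℝ} (hF : Hurwitz F) (M : Matrix σ σ ℝ) :
    F * lyapunov F M + lyapunov F M * Fᵀ = -M :=
  Classical.epsilon_spec (p := fun X => F * X + X * Fᵀ = -M) (hF.exists_lyapunov (-M))

lemma Hurwitz.lyapunov_symm {F X M : Matrix σ σ ℝ} (hF : Hurwitz F) (hM : Mᵀ = M)
    (h : F * X + X * Fᵀ = -M) : Xᵀ = X := by
  refine hF.lyapunov_unique ?_ h
  have := congrArg Matrix.transpose h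
  rw [Matrix.transpose_add, Matrix.transpose_mul, Matrix.transpose_mul, Matrix.transpose_transpose,
    Matrix.transpose_neg, hM] at this
  rw [← this, add_comm]

/-- The squared `H₂` norm of a strictly proper stable system. -/
lemma Hurwitz.h2NormSq_transfer [Fintype ι] [Fintype κ] {F X : Matrix σ σ ℝ} (hF : Hurwitz F)
    (G : Matrix σ κ ℝ) (H : Matrix ι σ ℝ) (h : F * X + X * Fᵀ = -(G * Gᵀ)) :
    h2NormSq (transfer F G H 0) = (H * X * Hᵀ).trace := by
  set T := transfer F G H 0 with hTdef
  set P : Matrix ι ι (RatFunc ℝ) := const H * resolvent F * const (X * Hᵀ) with hP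
  set P' : Matrix ι ι (RatFunc ℝ) := const H * resolvent F * const (Xᵀ * Hᵀ) with hP'
  have hreg := hF.regMat_resolvent
  have hT : RegMat rhp T := hF.regMat_transfer _ _ _
  have hPr : RegMat rhp P := ((regMat_const H).mul hreg).mul (regMat_const _)
  have hPr' : RegMat rhp P' := ((regMat_const H).mul hreg).mul (regMat_const _)
  -- By the Lyapunov equation, T T~ is a stable matrix plus the para-conjugate of a stable one. The
  -- real part of each trace integrates to π times its leading coefficient. `Xᵀ` appears in `P'`
  -- because `X` is not assumed symmetric.
  have hid : T * paraConj T = P + paraConj P' := by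
    have e1 : T * paraConj T = const H * (resolvent F * const (G * Gᵀ) * paraConj (resolvent F)) *
        const Hᵀ := by
      rw [hTdef, transfer_zero, paraConj_mul, paraConj_mul, paraConj_const, paraConj_const, const_mul]
      simp only [Matrix.mul_assoc]
    rw [e1, lyapunov_resolvent_identity h, hP, hP', paraConj_mul, paraConj_mul, paraConj_const,
      paraConj_const, const_mul, Matrix.transpose_mul, Matrix.transpose_transpose,
      Matrix.transpose_transpose, const_mul, Matrix.mul_add, Matrix.add_mul]
    simp only [Matrix.mul_assoc]
  have hint (w : ℝ) : (((evalAt T (w * Complex.I))ᴴ * evalAt T (w * Complex.I)).trace).re =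
      (ev (w * Complex.I) P.trace).re + (ev (w * Complex.I) P'.trace).re := by
    have hw : (w * Complex.I : ℂ) ∈ imAxis := by simp
    rw [Matrix.trace_mul_comm, ← evalAt_paraConj hT.axis,
      ← evalAt_mul hw hT.axis hT.axis.paraConj_axis, hid,
      evalAt_add hw hPr.axis hPr'.axis.paraConj_axis, Matrix.trace_add, Complex.add_re,
      evalAt_paraConj hPr'.axis, Matrix.trace_conjTranspose, trace_evalAt hw hPr.axis,
      trace_evalAt hw hPr'.axis]
    simp
  have l1 := integral_re_ev_axis hPr.trace
    (((hasLeadMat_resolvent F).const_mul H).mul_const (X * Hᵀ)).trace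
  have l2 := integral_re_ev_axis hPr'.trace
    (((hasLeadMat_resolvent F).const_mul H).mul_const (Xᵀ * Hᵀ)).trace
  rw [h2NormSq, h2Inner]
  simp only [hint]
  rw [integral_add l1.1 l2.1, l1.2, l2.2, Matrix.mul_one]
  have ht : (H * (Xᵀ * Hᵀ)).trace = (H * (X * Hᵀ)).trace := by
    rw [← Matrix.trace_transpose]
    simp [Matrix.mul_assoc]
  rw [ht, Matrix.mul_assoc]
  field_simp
  ring

lemma transpose_eq_of_posSemidef {M : Matrix σ σ ℝ} (h : M.PosSemidef) : Mᵀ = M := by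
  simpa [Matrix.IsHermitian] using h.1

lemma PosSemidef.quad_nonneg {M : Matrix σ σ ℝ} (h : M.PosSemidef) (x : σ → ℝ) :
    0 ≤ x ⬝ᵥ (M *ᵥ x) := by simpa using h.dotProduct_mulVec_nonneg x

lemma sqrt_transpose (M : Matrix σ σ ℝ) : (CFC.sqrt M)ᵀ = CFC.sqrt M :=
  transpose_eq_of_posSemidef (Matrix.nonneg_iff_posSemidef.1 (CFC.sqrt_nonneg M))

lemma sqrt_mul_sqrt {M : Matrix σ σ ℝ} (h : M.PosSemidef) : CFC.sqrt M * CFC.sqrt M = M :=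
  CFC.sqrt_mul_sqrt_self M h.nonneg

/-- The form xᵀ X x is the squared H₂ norm of the system with input matrix M^{1/2} and single output
xᵀ. -/
lemma Hurwitz.lyapunov_posSemidef {F X M : Matrix σ σ ℝ} (hF : Hurwitz F) (hM : M.PosSemidef)
    (h : F * X + X * Fᵀ = -M) : X.PosSemidef := by
  refine PosSemidef.of_dotProduct_mulVec_nonneg ?_ fun x => ?_
  · simpa [Matrix.IsHermitian] using hF.lyapunov_symm (transpose_eq_of_posSemidef hM) h
  · have h1 := hF.h2NormSq_transfer (X := X) (CFC.sqrt M) (Matrix.replicateRow Unit x)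
      (by rw [sqrt_transpose, sqrt_mul_sqrt hM, h])
    have h2 := h2NormSq_nonneg (transfer F (CFC.sqrt M) (Matrix.replicateRow Unit x) 0)
    rw [h1] at h2
    have h3 : star x ⬝ᵥ (X *ᵥ x) =
        (Matrix.replicateRow Unit x * X * (Matrix.replicateRow Unit x)ᵀ).trace := by
      rw [Matrix.mul_assoc]
      simp [Matrix.trace, Matrix.mul_apply, dotProduct, Matrix.mulVec]
    rw [h3]
    exact h2

/-- If xᵀ X x = 0, then X x = 0 by semidefiniteness, and the Lyapunov equation evaluated at x gives
xᵀ M x = 0. -/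
lemma Hurwitz.lyapunov_posDef {F X M : Matrix σ σ ℝ} (hF : Hurwitz F) (hM : M.PosDef)
    (h : F * X + X * Fᵀ = -M) : X.PosDef := by
  have hX := hF.lyapunov_posSemidef hM.posSemidef h
  refine PosDef.of_dotProduct_mulVec_pos hX.1 fun x hx => ?_
  refine lt_of_le_of_ne (hX.dotProduct_mulVec_nonneg x) fun h0 => ?_
  have h1 : X *ᵥ x = 0 := (hX.dotProduct_mulVec_zero_iff x).1 h0.symm
  have h2 : x ⬝ᵥ (M *ᵥ x) = 0 := by
    have : M = -(F * X + X * Fᵀ) := by rw [h, neg_neg]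
    rw [this, Matrix.neg_mulVec, Matrix.add_mulVec, ← Matrix.mulVec_mulVec, h1, Matrix.mulVec_zero,
      zero_add, ← Matrix.mulVec_mulVec, dotProduct_neg, Matrix.dotProduct_mulVec,
      ← Matrix.mulVec_transpose, transpose_eq_of_posSemidef hX, h1, zero_dotProduct, neg_zero]
  have := hM.dotProduct_mulVec_pos hx
  simp only [star_trivial] at this
  linarith

/-- The Lyapunov operators of `F` and `Fᵀ` are adjoint for the trace pairing. This converts a cost
computed from a covariance into one computed from an energy matrix. -/
lemma trace_lyapunov_duality {F X Y M N : Matrix σ σ ℝ} (hX : F * X + X * Fᵀ = -M)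
    (hY : Fᵀ * Y + Y * F = -N) : (N * X).trace = (M * Y).trace := by
  have h1 : N = -(Fᵀ * Y + Y * F) := by rw [hY, neg_neg]
  have h2 : M = -(F * X + X * Fᵀ) := by rw [hX, neg_neg]
  rw [h1, h2]
  simp only [Matrix.neg_mul, Matrix.add_mul, Matrix.trace_neg, Matrix.trace_add]
  have e1 : (Fᵀ * Y * X).trace = (X * Fᵀ * Y).trace := by
    rw [Matrix.trace_mul_comm, ← Matrix.mul_assoc]
  have e2 : (Y * F * X).trace = (F * X * Y).trace := by
    rw [Matrix.mul_assoc, Matrix.trace_mul_comm]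
  rw [e1, e2, add_comm]

end Lyapunov

/-! ### Riccati equations -/

section Riccati

variable {σ τ : Type*} [Fintype σ] [DecidableEq σ] [Fintype τ] [DecidableEq τ]

/-- `P` is the cost matrix of the stabilizing feedback `F`. -/
structure IsFeedbackCost (A : Matrix σ σ ℝ) (B : Matrix σ τ ℝ) (Q : Matrix σ σ ℝ)
    (R : Matrix τ τ ℝ) (F : Matrix τ σ ℝ) (P : Matrix σ σ ℝ) : Prop where
  stable : Hurwitz (A + B * F)
  lyap : (A + B * F)ᵀ * P + P * (A + B * F) = -(Q + Fᵀ * R * F)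

variable {A : Matrix σ σ ℝ} {B : Matrix σ τ ℝ} {Q : Matrix σ σ ℝ} {R : Matrix τ τ ℝ}

lemma exists_feedbackCost {F : Matrix τ σ ℝ} (hF : Hurwitz (A + B * F)) :
    ∃ P, IsFeedbackCost A B Q R F P := by
  obtain ⟨P, hP⟩ := hF.transpose.exists_lyapunov (-(Q + Fᵀ * R * F))
  rw [Matrix.transpose_transpose] at hP
  exact ⟨P, hF, hP⟩

lemma posDef_add_feedback (hQ : Q.PosDef) (hR : R.PosDef) (F : Matrix τ σ ℝ) :
    (Q + Fᵀ * R * F).PosDef := by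
  refine hQ.add_posSemidef ?_
  simpa using hR.posSemidef.conjTranspose_mul_mul_same F

lemma IsFeedbackCost.posSemidef (hQ : Q.PosDef) (hR : R.PosDef) {F : Matrix τ σ ℝ}
    {P : Matrix σ σ ℝ} (h : IsFeedbackCost A B Q R F P) : P.PosSemidef :=
  h.stable.transpose.lyapunov_posSemidef (posDef_add_feedback hQ hR F).posSemidef
    (by rw [Matrix.transpose_transpose]; exact h.lyap)

lemma mul_mul_inv_cancel (hR : R.PosDef) (X : Matrix τ σ ℝ) : R * (R⁻¹ * X) = X := by
  rw [← Matrix.mul_assoc, Matrix.mul_nonsing_inv _ ((Matrix.isUnit_iff_isUnit_det _).1 hR.isUnit),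
    Matrix.one_mul]

/-- The improved feedback of a policy iteration step. -/
lemma IsFeedbackCost.lyap_improved (hQ : Q.PosDef) (hR : R.PosDef) {F F' : Matrix τ σ ℝ}
    {P : Matrix σ σ ℝ} (h : IsFeedbackCost A B Q R F P) (hF' : R * F' = -(Bᵀ * P)) :
    (A + B * F')ᵀ * P + P * (A + B * F') =
      -((Q + F'ᵀ * R * F') + (F - F')ᵀ * R * (F - F')) := by
  have hPs := transpose_eq_of_posSemidef (h.posSemidef hQ hR)
  have hRs := transpose_eq_of_posSemidef hR.posSemidef
  have h1 : P * B = -(F'ᵀ * R) := by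
    have := congrArg Matrix.transpose hF'
    rw [Matrix.transpose_mul, hRs, Matrix.transpose_neg, Matrix.transpose_mul, hPs,
      Matrix.transpose_transpose] at this
    rw [this, neg_neg]
  have h2 : Bᵀ * P = -(R * F') := by rw [hF', neg_neg]
  have h3 := h.lyap
  have e (G : Matrix τ σ ℝ) : (A + B * G)ᵀ * P + P * (A + B * G) =
      Aᵀ * P + P * A - Gᵀ * R * F' - F'ᵀ * R * G := by
    rw [Matrix.transpose_add, Matrix.transpose_mul, Matrix.add_mul, Matrix.mul_add,
      Matrix.mul_assoc Gᵀ, h2, ← Matrix.mul_assoc P, h1]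
    simp only [Matrix.mul_neg, Matrix.neg_mul, Matrix.mul_assoc]
    abel
  rw [e] at h3 ⊢
  have h4 : Aᵀ * P + P * A = -(Q + Fᵀ * R * F) + Fᵀ * R * F' + F'ᵀ * R * F := by
    rw [← h3]; abel
  rw [h4]
  simp only [Matrix.transpose_sub, Matrix.sub_mul, Matrix.mul_sub]
  abel

/-- The cost matrix of the old feedback is a strict Lyapunov certificate for the new one. -/
lemma IsFeedbackCost.stable_improved (hQ : Q.PosDef) (hR : R.PosDef) {F F' : Matrix τ σ ℝ}
    {P : Matrix σ σ ℝ} (h : IsFeedbackCost A B Q R F P) (hF' : R * F' = -(Bᵀ * P)) :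
    Hurwitz (A + B * F') := by
  refine hurwitz_of_lyapunov (h.posSemidef hQ hR) (PosDef.add_posSemidef
    (posDef_add_feedback hQ hR F') ?_) (h.lyap_improved hQ hR hF')
  simpa using hR.posSemidef.conjTranspose_mul_mul_same (F - F')

/-- Policy iteration decreases the cost: the difference of the two cost matrices solves a Lyapunov
equation of the new loop with the semidefinite source (F - F')ᵀ R (F - F'). -/
lemma IsFeedbackCost.sub_improved (hQ : Q.PosDef) (hR : R.PosDef) {F F' : Matrix τ σ ℝ}
    {P P' : Matrix σ σ ℝ} (h : IsFeedbackCost A B Q R F P) (hF' : R * F' = -(Bᵀ * P))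
    (h' : IsFeedbackCost A B Q R F' P') : (P - P').PosSemidef := by
  have hM : ((F - F')ᵀ * R * (F - F')).PosSemidef := by
    simpa using hR.posSemidef.conjTranspose_mul_mul_same (F - F')
  refine h'.stable.transpose.lyapunov_posSemidef hM ?_
  rw [Matrix.transpose_transpose, Matrix.mul_sub, Matrix.sub_mul, sub_add_sub_comm,
    h.lyap_improved hQ hR hF', h'.lyap]
  abel

lemma quad_single_add (P : Matrix σ σ ℝ) (hP : Pᵀ = P) (i j : σ) :
    P i j = ((Pi.single i 1 + Pi.single j 1 : σ → ℝ) ⬝ᵥ (P *ᵥ (Pi.single i 1 + Pi.single j 1)) -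
      (Pi.single i 1 : σ → ℝ) ⬝ᵥ (P *ᵥ Pi.single i 1) -
      (Pi.single j 1 : σ → ℝ) ⬝ᵥ (P *ᵥ Pi.single j 1)) / 2 := by
  have : P j i = P i j := by conv_lhs => rw [← hP, Matrix.transpose_apply]
  simp [Matrix.mulVec_add, this]
  ring

/-- Each quadratic form decreases along the sequence and is bounded below by zero, hence converges.
Polarization recovers the entries. -/
lemma exists_tendsto_of_antitone {P : ℕ → Matrix σ σ ℝ} (h0 : ∀ k, (P k).PosSemidef)
    (h : ∀ k, (P k - P (k + 1)).PosSemidef) : ∃ X, Tendsto P atTop (𝓝 X) := by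
  have hq (x : σ → ℝ) : ∃ l, Tendsto (fun k => x ⬝ᵥ (P k *ᵥ x)) atTop (𝓝 l) := by
    refine ⟨_, tendsto_atTop_ciInf (antitone_nat_of_succ_le fun k => ?_)
      ⟨0, by rintro _ ⟨k, rfl⟩; exact PosSemidef.quad_nonneg (h0 k) x⟩⟩
    have := PosSemidef.quad_nonneg (h k) x
    rw [Matrix.sub_mulVec, dotProduct_sub] at this
    linarith
  choose l hl using hq
  refine ⟨fun i j => (l (Pi.single i 1 + Pi.single j 1) - l (Pi.single i 1) -
    l (Pi.single j 1)) / 2, tendsto_pi_nhds.2 fun i => tendsto_pi_nhds.2 fun j => ?_⟩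
  simp only [fun k => quad_single_add (P k) (transpose_eq_of_posSemidef (h0 k)) i j]
  exact (((hl _).sub (hl _)).sub (hl _)).div_const 2

/-- Existence of the stabilizing solution of the algebraic Riccati equation. -/
lemma exists_riccati (hQ : Q.PosDef) (hR : R.PosDef) {F₀ : Matrix τ σ ℝ}
    (hF₀ : Hurwitz (A + B * F₀)) :
    ∃ F P, IsFeedbackCost A B Q R F P ∧ R * F = -(Bᵀ * P) := by
  -- Policy iteration: the next gain is the minimizer -R⁻¹ Bᵀ P for the current cost matrix. The
  -- subtype carries stability along, so that the next cost matrix exists.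
  have hstep (G : {G : Matrix τ σ ℝ × Matrix σ σ ℝ // IsFeedbackCost A B Q R G.1 G.2}) :
      ∃ G' : {G : Matrix τ σ ℝ × Matrix σ σ ℝ // IsFeedbackCost A B Q R G.1 G.2},
        G'.1.1 = -(R⁻¹ * (Bᵀ * G.1.2)) := by
    have hs := G.2.stable_improved hQ hR (F' := -(R⁻¹ * (Bᵀ * G.1.2)))
      (by rw [Matrix.mul_neg, mul_mul_inv_cancel hR])
    obtain ⟨P', hP'⟩ := exists_feedbackCost (Q := Q) (R := R) hs
    exact ⟨⟨(_, P'), hP'⟩, rfl⟩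
  choose next hnext using hstep
  obtain ⟨P₀, hP₀⟩ := exists_feedbackCost (Q := Q) (R := R) hF₀
  let seq : ℕ → {G : Matrix τ σ ℝ × Matrix σ σ ℝ // IsFeedbackCost A B Q R G.1 G.2} :=
    fun k => next^[k] ⟨(F₀, P₀), hP₀⟩
  have hseq (k : ℕ) : seq (k + 1) = next (seq k) := Function.iterate_succ_apply' _ _ _
  have hF (k : ℕ) : (seq (k + 1)).1.1 = -(R⁻¹ * (Bᵀ * (seq k).1.2)) := by rw [hseq, hnext]
  obtain ⟨X, hX⟩ := exists_tendsto_of_antitone (P := fun k => (seq k).1.2)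
    (fun k => (seq k).2.posSemidef hQ hR) fun k => (seq k).2.sub_improved hQ hR
      (by rw [hF, Matrix.mul_neg, mul_mul_inv_cancel hR]) (seq (k + 1)).2
  set F : Matrix τ σ ℝ := -(R⁻¹ * (Bᵀ * X)) with hFdef
  have hRF : R * F = -(Bᵀ * X) := by rw [hFdef, Matrix.mul_neg, mul_mul_inv_cancel hR]
  have hXF : Tendsto (fun k => (seq (k + 1)).1.1) atTop (𝓝 F) := by
    simp only [hF]
    exact ((Continuous.tendsto (by fun_prop : Continuous fun Y : Matrix σ σ ℝ =>
      -(R⁻¹ * (Bᵀ * Y))) X).comp hX)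
  have hX1 : Tendsto (fun k => (seq (k + 1)).1.2) atTop (𝓝 X) :=
    hX.comp (tendsto_add_atTop_nat 1)
  have hlyap : (A + B * F)ᵀ * X + X * (A + B * F) = -(Q + Fᵀ * R * F) := by
    have l1 : Tendsto (fun k => (A + B * (seq (k + 1)).1.1)ᵀ * (seq (k + 1)).1.2 +
        (seq (k + 1)).1.2 * (A + B * (seq (k + 1)).1.1)) atTop
        (𝓝 ((A + B * F)ᵀ * X + X * (A + B * F))) :=
      (Continuous.tendsto (by fun_prop : Continuous fun Y : Matrix τ σ ℝ × Matrix σ σ ℝ =>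
        (A + B * Y.1)ᵀ * Y.2 + Y.2 * (A + B * Y.1)) (F, X)).comp (hXF.prodMk_nhds hX1)
    have l2 : Tendsto (fun k => -(Q + (seq (k + 1)).1.1ᵀ * R * (seq (k + 1)).1.1)) atTop
        (𝓝 (-(Q + Fᵀ * R * F))) :=
      (Continuous.tendsto (by fun_prop : Continuous fun Y : Matrix τ σ ℝ =>
        -(Q + Yᵀ * R * Y)) F).comp hXF
    refine tendsto_nhds_unique l1 (l2.congr fun k => ?_)
    exact ((seq (k + 1)).2.lyap).symm
  have hXpsd : X.PosSemidef := by
    refine PosSemidef.of_dotProduct_mulVec_nonneg ?_ fun x => ?_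
    · have : Xᵀ = X := by
        refine tendsto_nhds_unique ((Continuous.tendsto (by fun_prop :
          Continuous fun Y : Matrix σ σ ℝ => Yᵀ) X).comp hX) (hX.congr fun k => ?_)
        exact (transpose_eq_of_posSemidef ((seq k).2.posSemidef hQ hR)).symm
      simpa [Matrix.IsHermitian] using this
    · refine ge_of_tendsto' ((Continuous.tendsto (by fun_prop :
        Continuous fun Y : Matrix σ σ ℝ => star x ⬝ᵥ (Y *ᵥ x)) X).comp hX) fun k => ?_
      exact ((seq k).2.posSemidef hQ hR).dotProduct_mulVec_nonneg x
  -- Being Hurwitz is not a closed condition, so stability of the limiting loop is not inherited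
  -- from the sequence. It is certified by the limiting Lyapunov equation, whose source is positive
  -- definite because `Q` is.
  exact ⟨F, X, ⟨hurwitz_of_lyapunov hXpsd (posDef_add_feedback hQ hR F) hlyap, hlyap⟩, hRF⟩

/-- A stabilizing dynamic feedback yields a static state feedback. -/
lemma exists_static_feedback {D : Matrix σ τ ℝ} {E : Matrix τ σ ℝ} {G : Matrix τ τ ℝ}
    {ρ : Type*} [Fintype ρ] {B : Matrix σ ρ ℝ} {K : Matrix ρ τ ℝ} (hD : D = B * K)
    (h : Hurwitz (fromBlocks A D E G)) : ∃ F, Hurwitz (A + B * F) := by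
  obtain ⟨X, hX⟩ := h.exists_lyapunov (-1)
  have hpd := h.lyapunov_posDef PosDef.one hX
  have hXt : Xᵀ = X := transpose_eq_of_posSemidef hpd.posSemidef
  rw [← Matrix.fromBlocks_toBlocks X, Matrix.fromBlocks_transpose, Matrix.fromBlocks_multiply,
    Matrix.fromBlocks_multiply, Matrix.fromBlocks_add, ← Matrix.fromBlocks_one,
    Matrix.fromBlocks_neg, Matrix.fromBlocks_inj] at hX
  set X₁ := X.toBlocks₁₁
  have h1 := hX.1
  have hX₁ : X₁.PosDef := hpd.submatrix Sum.inl_injective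
  have hX₁t : X₁ᵀ = X₁ := transpose_eq_of_posSemidef hX₁.posSemidef
  have h12 : X.toBlocks₁₂ = X.toBlocks₂₁ᵀ := by
    ext i j
    simp only [Matrix.toBlocks₁₂, Matrix.toBlocks₂₁, Matrix.of_apply, Matrix.transpose_apply]
    conv_lhs => rw [← hXt]
    rfl
  -- The gain regresses the controller output on the plant state under the covariance `X`. With it,
  -- the top left block of the Lyapunov equation of the full loop becomes a Lyapunov equation for `A
  -- + B F` with the positive definite solution `X₁`.
  refine ⟨K * X.toBlocks₂₁ * X₁⁻¹, ?_⟩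
  have hu : IsUnit X₁.det := (Matrix.isUnit_iff_isUnit_det _).1 hX₁.isUnit
  have e1 : (A + B * (K * X.toBlocks₂₁ * X₁⁻¹)) * X₁ = A * X₁ + D * X.toBlocks₂₁ := by
    rw [Matrix.add_mul, Matrix.mul_assoc B, Matrix.mul_assoc (K * _), Matrix.nonsing_inv_mul _ hu,
      Matrix.mul_one, hD, Matrix.mul_assoc]
  have e2 : X₁ * (A + B * (K * X.toBlocks₂₁ * X₁⁻¹))ᵀ = X₁ * Aᵀ + X.toBlocks₁₂ * Dᵀ := by
    have := congrArg Matrix.transpose e1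
    rw [Matrix.transpose_mul, hX₁t] at this
    rw [this, Matrix.transpose_add, Matrix.transpose_mul, Matrix.transpose_mul, hX₁t, h12]
  have hH : Hurwitz (A + B * (K * X.toBlocks₂₁ * X₁⁻¹))ᵀ :=
    hurwitz_of_lyapunov hX₁.posSemidef PosDef.one
      (by rw [Matrix.transpose_transpose, e1, e2, h1])
  exact Matrix.transpose_transpose (A + B * (K * X.toBlocks₂₁ * X₁⁻¹)) ▸ hH.transpose

end Riccati

end LQG

end

noncomputable section

namespace LQG

/-! ### The optimal LQG value -/

section Value

variable {n m₁ m₂ q : ℕ}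

/-- A pair of stabilizing solutions `P`, `Y` of the control and the filter Riccati equations, with
the state feedback gain `F` and the filter gain `L`. -/
structure IsRiccatiPair (S : Plant n m₁ m₂) (F : Matrix (Fin m₁) (Fin n) ℝ)
    (P : Matrix (Fin n) (Fin n) ℝ) (L : Matrix (Fin n) (Fin m₂) ℝ)
    (Y : Matrix (Fin n) (Fin n) ℝ) : Prop where
  gainF : S.R * F = -(S.Bᵀ * P)
  gainF' : P * S.B = -(Fᵀ * S.R)
  eqP : S.Aᵀ * P + P * S.A = -S.Q + Fᵀ * S.R * F
  stableF : Hurwitz (S.A + S.B * F)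
  gainL : L * S.V = Y * S.Cᵀ
  gainL' : S.V * Lᵀ = S.C * Y
  eqY : S.A * Y + Y * S.Aᵀ = -S.W + L * S.V * Lᵀ
  stableL : Hurwitz (S.A - L * S.C)

/-- The filter equation is the control equation of the dual plant (Aᵀ, Cᵀ), which is again
stabilized since the transposed closed loop has the same shape. The filter gain is minus the
transposed dual feedback. `K₀` serves only to provide the two stabilizing feedbacks from which
policy iteration starts. -/
lemma exists_riccatiPair (S : Plant n m₁ m₂)
    (hQ : S.Q.PosDef) (hR : S.R.PosDef) (hW : S.W.PosDef) (hV : S.V.PosDef)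
    (K₀ : Controller q m₁ m₂) (hK₀ : Stabilizes S K₀) :
    ∃ F P L Y, IsRiccatiPair S F P L Y := by
  have h0 : Hurwitz (clA S K₀) := hK₀
  obtain ⟨F₀, hF₀⟩ := exists_static_feedback (B := S.B) (K := K₀.C) rfl h0
  have h0' : Hurwitz (fromBlocks S.Aᵀ (S.Cᵀ * K₀.Bᵀ) (S.B * K₀.C)ᵀ K₀.Aᵀ) := by
    have := h0.transpose
    rwa [clA, Matrix.fromBlocks_transpose, Matrix.transpose_mul K₀.B] at this
  obtain ⟨G₀, hG₀⟩ := exists_static_feedback (B := S.Cᵀ) (K := K₀.Bᵀ) rfl h0'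
  obtain ⟨F, P, hP, hF⟩ := exists_riccati hQ hR hF₀
  obtain ⟨G, Y, hY, hG⟩ := exists_riccati hW hV hG₀
  have aux {m : ℕ} {A : Matrix (Fin n) (Fin n) ℝ} {B : Matrix (Fin n) (Fin m) ℝ}
      {Q : Matrix (Fin n) (Fin n) ℝ} {R : Matrix (Fin m) (Fin m) ℝ} (hQ : Q.PosDef)
      (hR : R.PosDef) {F : Matrix (Fin m) (Fin n) ℝ} {P : Matrix (Fin n) (Fin n) ℝ}
      (hP : IsFeedbackCost A B Q R F P) (hF : R * F = -(Bᵀ * P)) :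
      P * B = -(Fᵀ * R) ∧ Aᵀ * P + P * A = -Q + Fᵀ * R * F := by
    have hPs := transpose_eq_of_posSemidef (hP.posSemidef hQ hR)
    have hRs := transpose_eq_of_posSemidef hR.posSemidef
    have h1 : P * B = -(Fᵀ * R) := by
      have := congrArg Matrix.transpose hF
      rw [Matrix.transpose_mul, hRs, Matrix.transpose_neg, Matrix.transpose_mul, hPs,
        Matrix.transpose_transpose] at this
      rw [this, neg_neg]
    refine ⟨h1, ?_⟩
    have h2 : Bᵀ * P = -(R * F) := by rw [hF, neg_neg]
    have h3 := hP.lyap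
    rw [Matrix.transpose_add, Matrix.transpose_mul, Matrix.add_mul, Matrix.mul_add,
      Matrix.mul_assoc Fᵀ, h2, ← Matrix.mul_assoc P, h1, Matrix.mul_neg, Matrix.neg_mul,
      ← Matrix.mul_assoc] at h3
    have h4 : Aᵀ * P + P * A = (Aᵀ * P + -(Fᵀ * R * F) + (P * A + -(Fᵀ * R * F))) +
        Fᵀ * R * F + Fᵀ * R * F := by abel
    rw [h4, h3]
    abel
  obtain ⟨hF', hP'⟩ := aux hQ hR hP hF
  obtain ⟨hG', hY'⟩ := aux hW hV hY hG
  rw [Matrix.transpose_transpose] at hG hY'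
  refine ⟨F, P, -Gᵀ, Y, hF, hF', hP', hP.stable, ?_, ?_, ?_, ?_⟩
  · rw [hG', Matrix.neg_mul]
  · rw [Matrix.transpose_neg, Matrix.transpose_transpose, Matrix.mul_neg, hG, neg_neg]
  · rw [hY', Matrix.transpose_neg, Matrix.transpose_transpose]
    simp
  · have := hY.stable.transpose
    rw [Matrix.transpose_add, Matrix.transpose_mul, Matrix.transpose_transpose,
      Matrix.transpose_transpose] at this
    rwa [Matrix.neg_mul, sub_neg_eq_add]

/-- The optimal value of the LQG problem. -/
def lqgValue (S : Plant n m₁ m₂) (F : Matrix (Fin m₁) (Fin n) ℝ)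
    (P Y : Matrix (Fin n) (Fin n) ℝ) : ℝ := (P * S.W).trace + (S.R * (F * Y * Fᵀ)).trace

variable {σ : Type*} [Fintype σ] [DecidableEq σ]

/-- A linear system with state matrix `𝔸` and noise intensity `Γ`, of which a state `x = E ζ`
obeys the dynamics of the plant under the input `u = U ζ`, whereas the rest is driven by the
observation only: `N` lifts `x`, and `G` is the gain of the observation. -/
structure IsLoop (S : Plant n m₁ m₂) (𝔸 Γ : Matrix σ σ ℝ) (N : Matrix σ (Fin n) ℝ)
    (G : Matrix σ (Fin m₂) ℝ) (E : Matrix (Fin n) σ ℝ) (U : Matrix (Fin m₁) σ ℝ) : Prop where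
  stable : Hurwitz 𝔸
  dynN : 𝔸 * N = N * S.A + G * S.C
  noise : Γ = N * S.W * Nᵀ + G * S.V * Gᵀ
  dynE : E * 𝔸 = S.A * E + S.B * U
  EN : E * N = 1
  UN : U * N = 0
  EG : E * G = 0

/-- The cost in terms of the stationary covariance. -/
def loopCost (S : Plant n m₁ m₂) (E : Matrix (Fin n) σ ℝ) (U : Matrix (Fin m₁) σ ℝ)
    (X : Matrix σ σ ℝ) : ℝ := (S.Q * (E * X * Eᵀ)).trace + (S.R * (U * X * Uᵀ)).trace

variable {S : Plant n m₁ m₂} {𝔸 Γ X : Matrix σ σ ℝ} {N : Matrix σ (Fin n) ℝ}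
  {G : Matrix σ (Fin m₂) ℝ} {E : Matrix (Fin n) σ ℝ} {U : Matrix (Fin m₁) σ ℝ}
  {F : Matrix (Fin m₁) (Fin n) ℝ} {P : Matrix (Fin n) (Fin n) ℝ} {L : Matrix (Fin n) (Fin m₂) ℝ}
  {Y : Matrix (Fin n) (Fin n) ℝ}

/-- Completion of squares. -/
lemma IsLoop.loopCost_eq_completed (h : IsLoop S 𝔸 Γ N G E U) (hr : IsRiccatiPair S F P L Y)
    (hX : 𝔸 * X + X * 𝔸ᵀ = -Γ) :
    loopCost S E U X =
      (P * S.W).trace + (S.R * ((U - F * E) * X * (U - F * E)ᵀ)).trace := by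
  have hΓ : E * Γ * Eᵀ = S.W := by
    have hN : Nᵀ * Eᵀ = 1 := by rw [← Matrix.transpose_mul, h.EN, Matrix.transpose_one]
    rw [h.noise, Matrix.mul_add, Matrix.add_mul]
    have e1 : E * (N * S.W * Nᵀ) * Eᵀ = (E * N) * S.W * (Nᵀ * Eᵀ) := by
      simp only [Matrix.mul_assoc]
    have e2 : E * (G * S.V * Gᵀ) * Eᵀ = (E * G) * S.V * (Gᵀ * Eᵀ) := by
      simp only [Matrix.mul_assoc]
    rw [e1, e2, h.EN, h.EG, hN]
    simp
  have hdE : 𝔸ᵀ * Eᵀ = Eᵀ * S.Aᵀ + Uᵀ * S.Bᵀ := by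
    rw [← Matrix.transpose_mul, h.dynE, Matrix.transpose_add, Matrix.transpose_mul,
      Matrix.transpose_mul]
  -- Compressing the stationary covariance equation by `E` gives the covariance balance of the plant
  -- state alone. It expresses `W` through the blocks that also enter the cost, and the traces below
  -- then assemble into a square.
  have hW : S.W = -(S.A * (E * X * Eᵀ) + S.B * (U * X * Eᵀ) + (E * X * Eᵀ) * S.Aᵀ +
      (E * X * Uᵀ) * S.Bᵀ) := by
    have hΓ' : Γ = -(𝔸 * X + X * 𝔸ᵀ) := by rw [hX, neg_neg]
    have e1 : E * (𝔸 * X) * Eᵀ = (E * 𝔸) * X * Eᵀ := by simp only [Matrix.mul_assoc]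
    have e2 : E * (X * 𝔸ᵀ) * Eᵀ = E * X * (𝔸ᵀ * Eᵀ) := by simp only [Matrix.mul_assoc]
    rw [← hΓ, hΓ', Matrix.mul_neg, Matrix.neg_mul, Matrix.mul_add, Matrix.add_mul, e1, e2, h.dynE,
      hdE]
    congr 1
    simp only [Matrix.add_mul, Matrix.mul_add, Matrix.mul_assoc]
    abel
  have hQ : S.Q = Fᵀ * S.R * F - (S.Aᵀ * P + P * S.A) := by rw [hr.eqP]; abel
  rw [loopCost, hQ, hW]
  have t1 : (S.Aᵀ * P * (E * X * Eᵀ)).trace = (P * (E * X * Eᵀ * S.Aᵀ)).trace := by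
    rw [Matrix.mul_assoc, Matrix.trace_mul_comm, Matrix.mul_assoc]
  have t2 : (P * (S.B * (U * X * Eᵀ))).trace = -(S.R * (U * X * Eᵀ * Fᵀ)).trace := by
    rw [← Matrix.mul_assoc, hr.gainF', Matrix.neg_mul, Matrix.trace_neg, Matrix.mul_assoc,
      Matrix.trace_mul_comm, Matrix.mul_assoc]
  have t3 : (P * (E * X * Uᵀ * S.Bᵀ)).trace = -(S.R * (F * (E * X * Uᵀ))).trace := by
    rw [← Matrix.mul_assoc, Matrix.trace_mul_comm, ← Matrix.mul_assoc, ← Matrix.mul_assoc,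
      ← neg_eq_iff_eq_neg.2 hr.gainF, Matrix.neg_mul, Matrix.neg_mul, Matrix.trace_neg]
    simp only [Matrix.mul_assoc]
  have t4 : (Fᵀ * S.R * F * (E * X * Eᵀ)).trace = (S.R * (F * (E * X * Eᵀ) * Fᵀ)).trace := by
    rw [Matrix.mul_assoc, Matrix.mul_assoc, Matrix.trace_mul_comm, Matrix.mul_assoc]
  have t5 : S.R * ((U - F * E) * X * (U - F * E)ᵀ) = S.R * (U * X * Uᵀ) -
      S.R * (F * (E * X * Uᵀ)) - S.R * (U * X * Eᵀ * Fᵀ) + S.R * (F * (E * X * Eᵀ) * Fᵀ) := by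
    simp only [Matrix.transpose_sub, Matrix.transpose_mul, Matrix.sub_mul, Matrix.mul_sub,
      Matrix.mul_assoc]
    abel
  rw [t5, Matrix.sub_mul, Matrix.add_mul]
  simp only [Matrix.mul_neg, Matrix.mul_add, Matrix.trace_neg, Matrix.trace_add, Matrix.trace_sub,
    t1, t2, t3, t4]
  rw [Matrix.mul_assoc P S.A]
  ring

/-- `Y` is the stationary error covariance of the optimal filter, and N Y Nᵀ is the share of it that
no loop driven by the observation can remove. Subtracting it cancels the process noise `W` and
leaves the semidefinite source with gain `N * L + G`. -/
lemma IsLoop.lyapunov_excess (h : IsLoop S 𝔸 Γ N G E U) (hr : IsRiccatiPair S F P L Y)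
    (hX : 𝔸 * X + X * 𝔸ᵀ = -Γ) :
    𝔸 * (X - N * Y * Nᵀ) + (X - N * Y * Nᵀ) * 𝔸ᵀ =
      -((N * L + G) * S.V * (N * L + G)ᵀ) := by
  have hN' : Nᵀ * 𝔸ᵀ = S.Aᵀ * Nᵀ + S.Cᵀ * Gᵀ := by
    rw [← Matrix.transpose_mul, h.dynN, Matrix.transpose_add, Matrix.transpose_mul,
      Matrix.transpose_mul]
  have e1 : 𝔸 * (N * Y * Nᵀ) = N * (S.A * Y) * Nᵀ + G * (S.V * Lᵀ) * Nᵀ := by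
    have : 𝔸 * (N * Y * Nᵀ) = (𝔸 * N) * Y * Nᵀ := by simp only [Matrix.mul_assoc]
    rw [this, h.dynN, hr.gainL']
    simp only [Matrix.add_mul, Matrix.mul_assoc]
  have e2 : (N * Y * Nᵀ) * 𝔸ᵀ = N * (Y * S.Aᵀ) * Nᵀ + N * (L * S.V) * Gᵀ := by
    rw [Matrix.mul_assoc, hN', hr.gainL]
    simp only [Matrix.mul_add, Matrix.mul_assoc]
  have e3 : N * (S.A * Y) * Nᵀ + N * (Y * S.Aᵀ) * Nᵀ =
      -(N * S.W * Nᵀ) + N * (L * S.V * Lᵀ) * Nᵀ := by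
    rw [← Matrix.add_mul, ← Matrix.mul_add, hr.eqY, Matrix.mul_add, Matrix.add_mul, Matrix.mul_neg,
      Matrix.neg_mul]
  have e4 : (N * L + G) * S.V * (N * L + G)ᵀ = N * (L * S.V * Lᵀ) * Nᵀ + N * (L * S.V) * Gᵀ +
      G * (S.V * Lᵀ) * Nᵀ + G * S.V * Gᵀ := by
    simp only [Matrix.transpose_add, Matrix.transpose_mul, Matrix.add_mul, Matrix.mul_add,
      Matrix.mul_assoc]
    abel
  calc 𝔸 * (X - N * Y * Nᵀ) + (X - N * Y * Nᵀ) * 𝔸ᵀ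
      = (𝔸 * X + X * 𝔸ᵀ) - (N * (S.A * Y) * Nᵀ + N * (Y * S.Aᵀ) * Nᵀ) -
        G * (S.V * Lᵀ) * Nᵀ - N * (L * S.V) * Gᵀ := by
        rw [Matrix.mul_sub, Matrix.sub_mul, e1, e2]; abel
    _ = _ := by rw [hX, h.noise, e3, e4]; abel

/-- Since `U * N = 0` and `E * N = 1`, the map `U - F * E` sends `N` to `-F`. The unavoidable
covariance N Y Nᵀ therefore costs exactly tr(R F Y Fᵀ), whatever the loop. -/
lemma IsLoop.loopCost_eq (h : IsLoop S 𝔸 Γ N G E U) (hr : IsRiccatiPair S F P L Y)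
    (hX : 𝔸 * X + X * 𝔸ᵀ = -Γ) :
    loopCost S E U X = lqgValue S F P Y +
      (S.R * ((U - F * E) * (X - N * Y * Nᵀ) * (U - F * E)ᵀ)).trace := by
  have hN : (U - F * E) * N = -F := by
    rw [Matrix.sub_mul, h.UN, Matrix.mul_assoc, h.EN, Matrix.mul_one, zero_sub]
  have hN' : Nᵀ * (U - F * E)ᵀ = -Fᵀ := by
    rw [← Matrix.transpose_mul, hN, Matrix.transpose_neg]
  have e : (U - F * E) * (N * Y * Nᵀ) * (U - F * E)ᵀ = F * Y * Fᵀ := by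
    have : (U - F * E) * (N * Y * Nᵀ) * (U - F * E)ᵀ =
        ((U - F * E) * N) * Y * (Nᵀ * (U - F * E)ᵀ) := by simp only [Matrix.mul_assoc]
    rw [this, hN, hN']
    simp
  rw [h.loopCost_eq_completed hr hX, lqgValue, Matrix.mul_sub (U - F * E),
    Matrix.sub_mul _ _ (U - F * E)ᵀ, e, Matrix.mul_sub, Matrix.trace_sub]
  ring

lemma trace_mul_nonneg {τ : Type*} [Fintype τ] [DecidableEq τ] {R M : Matrix τ τ ℝ}
    (hR : R.PosSemidef) (hM : M.PosSemidef) : 0 ≤ (R * M).trace := by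
  rw [← sqrt_mul_sqrt hR, Matrix.mul_assoc, Matrix.trace_mul_comm]
  have := hM.mul_mul_conjTranspose_same (CFC.sqrt R)
  rw [Matrix.conjTranspose_eq_transpose_of_trivial, sqrt_transpose] at this
  exact this.trace_nonneg

/-- The excess covariance solves a Lyapunov equation of a stable loop with semidefinite source, so
it is semidefinite and its cost nonnegative. -/
lemma IsLoop.lqgValue_le (h : IsLoop S 𝔸 Γ N G E U) (hr : IsRiccatiPair S F P L Y)
    (hR : S.R.PosDef) (hV : S.V.PosDef) (hX : 𝔸 * X + X * 𝔸ᵀ = -Γ) :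
    lqgValue S F P Y ≤ loopCost S E U X := by
  rw [h.loopCost_eq hr hX]
  have hpsd : ((N * L + G) * S.V * (N * L + G)ᵀ).PosSemidef := by
    simpa using hV.posSemidef.mul_mul_conjTranspose_same (N * L + G)
  have hD := h.stable.lyapunov_posSemidef hpsd (h.lyapunov_excess hr hX)
  have hD' : ((U - F * E) * (X - N * Y * Nᵀ) * (U - F * E)ᵀ).PosSemidef := by
    simpa using hD.mul_mul_conjTranspose_same (U - F * E)
  linarith [trace_mul_nonneg hR.posSemidef hD']

/-- A loop is optimal if its input differs from the optimal one by an error `J Φ ζ`, where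
`Φ ζ` has stable autonomous dynamics. -/
lemma IsLoop.loopCost_eq_lqgValue (h : IsLoop S 𝔸 Γ N G E U) (hr : IsRiccatiPair S F P L Y)
    (hX : 𝔸 * X + X * 𝔸ᵀ = -Γ) {τ : Type*} [Fintype τ] [DecidableEq τ] {Φ : Matrix τ σ ℝ}
    {J : Matrix (Fin m₁) τ ℝ} {A' : Matrix τ τ ℝ} (hA' : Hurwitz A') (h1 : U - F * E = J * Φ)
    (h2 : Φ * 𝔸 = A' * Φ) (h3 : Φ * (N * L + G) = 0) :
    loopCost S E U X = lqgValue S F P Y := by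
  rw [h.loopCost_eq hr hX]
  set D := X - N * Y * Nᵀ with hD
  -- The error `Φ ζ` is autonomous and, by `h3`, not excited by the source of the excess covariance.
  -- Its part of that covariance solves a homogeneous stable Lyapunov equation.
  have hz : Φ * D * Φᵀ = 0 := by
    refine hA'.lyapunov_unique_zero ?_
    have h2' : Φᵀ * A'ᵀ = 𝔸ᵀ * Φᵀ := by
      rw [← Matrix.transpose_mul, ← h2, Matrix.transpose_mul]
    have e1 : A' * (Φ * D * Φᵀ) = Φ * (𝔸 * D) * Φᵀ := by
      rw [← Matrix.mul_assoc, ← Matrix.mul_assoc, ← h2]; simp only [Matrix.mul_assoc]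
    have e2 : Φ * D * Φᵀ * A'ᵀ = Φ * (D * 𝔸ᵀ) * Φᵀ := by
      rw [Matrix.mul_assoc, h2']; simp only [Matrix.mul_assoc]
    have e3 : Φ * ((N * L + G) * S.V * (N * L + G)ᵀ) * Φᵀ =
        (Φ * (N * L + G)) * S.V * (N * L + G)ᵀ * Φᵀ := by simp only [Matrix.mul_assoc]
    rw [e1, e2, ← Matrix.add_mul, ← Matrix.mul_add, h.lyapunov_excess hr hX, Matrix.mul_neg,
      Matrix.neg_mul, e3, h3]
    simp
  have e4 : (U - F * E) * D * (U - F * E)ᵀ = J * (Φ * D * Φᵀ) * Jᵀ := by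
    rw [h1, Matrix.transpose_mul]; simp only [Matrix.mul_assoc]
  rw [e4, hz]
  simp

end Value

end LQG

end

noncomputable section

namespace LQG

/-! ### Block matrices -/

section Blocks

variable {R ι ι' κ κ' : Type*} [AddCommGroup R]

lemma fromRows_add (A A' : Matrix ι κ R) (B B' : Matrix ι' κ R) :
    fromRows A B + fromRows A' B' = fromRows (A + A') (B + B') := by
  ext (i | i) j <;> rfl

lemma fromCols_add (A A' : Matrix ι κ R) (B B' : Matrix ι κ' R) :
    fromCols A B + fromCols A' B' = fromCols (A + A') (B + B') := by
  ext i (j | j) <;> rfl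

lemma fromCols_sub (A A' : Matrix ι κ R) (B B' : Matrix ι κ' R) :
    fromCols A B - fromCols A' B' = fromCols (A - A') (B - B') := by
  ext i (j | j) <;> rfl

lemma fromBlocks_eq_fromRows (A : Matrix ι κ R) (B : Matrix ι κ' R) (C : Matrix ι' κ R)
    (D : Matrix ι' κ' R) : fromBlocks A B C D = fromRows (fromCols A B) (fromCols C D) :=
  (fromRows_fromCols_eq_fromBlocks _ _ _ _).symm

lemma fromCols_fromRows (A : Matrix ι κ R) (B : Matrix ι' κ R) (C : Matrix ι κ' R)
    (D : Matrix ι' κ' R) :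
    fromCols (fromRows A B) (fromRows C D) = fromRows (fromCols A C) (fromCols B D) := by
  ext (i | i) (j | j) <;> rfl

lemma fromCols_fromRows_zero (A : Matrix ι κ R) (B : Matrix ι' κ R) :
    fromCols (fromRows A B) (0 : Matrix _ κ' R) = fromRows (fromCols A 0) (fromCols B 0) := by
  ext (i | i) (j | j) <;> rfl

lemma fromCols_zero_fromRows (A : Matrix ι κ R) (B : Matrix ι' κ R) :
    fromCols (0 : Matrix _ κ' R) (fromRows A B) = fromRows (fromCols 0 A) (fromCols 0 B) := by
  ext (i | i) (j | j) <;> rfl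

end Blocks

lemma one_eq_fromRows {ι κ R : Type*} [DecidableEq ι] [DecidableEq κ] [Ring R] :
    (1 : Matrix (ι ⊕ κ) (ι ⊕ κ) R) = fromRows (fromCols 1 0) (fromCols 0 1) := by
  rw [← fromBlocks_one, fromBlocks_eq_fromRows]

lemma hurwitz_neg_one {σ : Type*} [Fintype σ] [DecidableEq σ] : Hurwitz (-1 : Matrix σ σ ℝ) := by
  refine hurwitz_of_lyapunov (X := 1) (M := 1 + 1) Matrix.PosDef.one.posSemidef
    (Matrix.PosDef.one.add Matrix.PosDef.one) ?_
  simp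

/-! ### Loops of controllers -/

section Loops

variable {n m₁ m₂ q : ℕ}

/-- The noise intensity of the closed loop. -/
def clNoise (S : Plant n m₁ m₂) (K : Controller q m₁ m₂) :
    Matrix (Fin n ⊕ Fin q) (Fin n ⊕ Fin q) ℝ := fromBlocks S.W 0 0 (K.B * S.V * K.Bᵀ)

lemma isLoop_controller (S : Plant n m₁ m₂) {K : Controller q m₁ m₂} (hK : Stabilizes S K) :
    IsLoop S (clA S K) (clNoise S K) (fromRows 1 0) (fromRows 0 K.B) (fromCols 1 0)
      (fromCols 0 K.C) where
  stable := hK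
  dynN := by
    simp [clA, fromBlocks_mul_fromRows, fromRows_mul, fromRows_add]
  noise := by
    simp only [clNoise, fromRows_mul, transpose_fromRows, mul_fromCols, fromBlocks_eq_fromRows,
      fromRows_add, fromCols_add, fromCols_fromRows_zero, fromCols_zero_fromRows]
    simp
  dynE := by
    simp [clA, fromCols_mul_fromBlocks, mul_fromCols, fromCols_add]
  EN := by simp [fromCols_mul_fromRows]
  UN := by simp [fromCols_mul_fromRows]
  EG := by simp [fromCols_mul_fromRows]

/-- The stationary cost of a controller. -/
def controllerCost (S : Plant n m₁ m₂) (K : Controller q m₁ m₂) : ℝ :=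
  loopCost S (fromCols 1 0) (fromCols 0 K.C) (gramSigma S K)

variable {S : Plant n m₁ m₂} {F : Matrix (Fin m₁) (Fin n) ℝ}
  {P : Matrix (Fin n) (Fin n) ℝ} {L : Matrix (Fin n) (Fin m₂) ℝ} {Y : Matrix (Fin n) (Fin n) ℝ}

lemma gramSigma_eq {K : Controller q m₁ m₂} (hK : Stabilizes S K) :
    clA S K * gramSigma S K + gramSigma S K * (clA S K)ᵀ = -clNoise S K :=
  Hurwitz.lyapunov_spec (F := clA S K) hK _

lemma lqgValue_le_controllerCost (hr : IsRiccatiPair S F P L Y) (hR : S.R.PosDef)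
    (hV : S.V.PosDef) {K : Controller q m₁ m₂} (hK : Stabilizes S K) :
    lqgValue S F P Y ≤ controllerCost S K :=
  (isLoop_controller S hK).lqgValue_le hr hR hV (gramSigma_eq hK)

/-- The Kalman filter based controller, realized with order `q` by means of an isometric
embedding `J` of the state space. -/
def kalman (S : Plant n m₁ m₂) (F : Matrix (Fin m₁) (Fin n) ℝ) (L : Matrix (Fin n) (Fin m₂) ℝ)
    (J : Matrix (Fin q) (Fin n) ℝ) : Controller q m₁ m₂ where
  A := J * (S.A + S.B * F - L * S.C) * Jᵀ - (1 - J * Jᵀ)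
  B := J * L
  C := F * Jᵀ

/-- In the redundant coordinates x, Jᵀ z - x, (1 - J Jᵀ) z the loop is block triangular with
diagonal blocks A + BF, A - LC and -1. The last block comes from the summand -(1 - J Jᵀ) of the
controller, which makes the surplus states decay. -/
lemma stabilizes_kalman (hr : IsRiccatiPair S F P L Y) {J : Matrix (Fin q) (Fin n) ℝ}
    (hJ : Jᵀ * J = 1) : Stabilizes S (kalman S F L J) := by
  have hJ' {m : ℕ} (M : Matrix (Fin n) (Fin m) ℝ) : Jᵀ * (J * M) = M := by
    rw [← Matrix.mul_assoc, hJ, Matrix.one_mul]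
  have hD : Hurwitz (fromBlocks (S.A + S.B * F) (fromCols (S.B * F) (0 : Matrix _ (Fin q) ℝ)) 0
      (fromBlocks (S.A - L * S.C) 0 0 (-1))) :=
    hr.stableF.fromBlocks_zero₂₁ (hr.stableL.fromBlocks_zero₂₁ hurwitz_neg_one 0) _
  refine hD.of_intertwine
    (T := fromRows (fromCols 1 0) (fromRows (fromCols (-1) Jᵀ) (fromCols 0 (1 - J * Jᵀ))))
    (T' := fromRows (fromCols 1 0) (fromCols J (fromCols J 1))) ?_ ?_
  · simp only [fromRows_mul, fromCols_mul_fromRows, mul_fromCols, fromCols_add,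
      fromBlocks_eq_fromRows, one_eq_fromRows, fromRows_inj.eq_iff, fromCols_inj.eq_iff]
    simp
  · simp only [clA, kalman, fromRows_mul, fromCols_mul_fromRows, mul_fromCols, fromCols_add,
      fromBlocks_eq_fromRows, fromRows_add, fromRows_inj.eq_iff, fromCols_inj.eq_iff]
    simp only [Matrix.zero_mul, Matrix.one_mul, Matrix.mul_zero, zero_add, add_zero, fromCols_zero,
      Matrix.neg_mul, Matrix.mul_sub, Matrix.sub_mul, Matrix.mul_add, Matrix.add_mul,
      Matrix.mul_assoc, hJ', hJ, Matrix.mul_one, Matrix.mul_neg]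
    exact ⟨⟨by abel, by abel⟩, by abel_nf⟩

/-- The Kalman filter based controller attains the optimal value. -/
lemma controllerCost_kalman (hr : IsRiccatiPair S F P L Y) {J : Matrix (Fin q) (Fin n) ℝ}
    (hJ : Jᵀ * J = 1) : controllerCost S (kalman S F L J) = lqgValue S F P Y := by
  have hJ' {m : ℕ} (M : Matrix (Fin n) (Fin m) ℝ) : Jᵀ * (J * M) = M := by
    rw [← Matrix.mul_assoc, hJ, Matrix.one_mul]
  have hs := stabilizes_kalman hr hJ
  -- `Φ` is the estimation error Jᵀ z - x, with autonomous dynamics A - LC. The input differs from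
  -- the ideal state feedback by `F` times this error.
  refine (isLoop_controller S hs).loopCost_eq_lqgValue hr (gramSigma_eq hs) hr.stableL
    (J := F) (Φ := fromCols (-1) Jᵀ) ?_ ?_ ?_
  · simp [kalman, mul_fromCols, fromCols_sub]
  · simp only [clA, kalman, fromCols_mul_fromBlocks, mul_fromCols, fromCols_inj.eq_iff]
    simp only [Matrix.zero_mul, Matrix.one_mul, Matrix.mul_zero, zero_add, add_zero,
      Matrix.neg_mul, Matrix.mul_sub, Matrix.sub_mul, Matrix.mul_add, Matrix.add_mul,
      Matrix.mul_assoc, hJ', hJ, Matrix.mul_one, Matrix.mul_neg]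
    constructor <;> abel
  · simp [kalman, fromRows_mul, fromRows_add, fromCols_mul_fromRows, hJ']

lemma exists_isometry (h : n ≤ q) : ∃ J : Matrix (Fin q) (Fin n) ℝ, Jᵀ * J = 1 := by
  refine ⟨(1 : Matrix (Fin q) (Fin q) ℝ).submatrix id (Fin.castLE h), ?_⟩
  rw [Matrix.transpose_submatrix, Matrix.transpose_one,
    ← Matrix.submatrix_mul _ _ _ _ _ Function.bijective_id, Matrix.one_mul,
    Matrix.submatrix_one _ (Fin.castLE_injective h)]

end Loops

end LQG

end

noncomputable section

namespace LQG

/-! ### The cascade realization of the lifted closed loop -/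

lemma trace_fromBlocks {ι κ R : Type*} [Fintype ι] [Fintype κ] [AddCommMonoid R]
    (A : Matrix ι ι R) (B : Matrix ι κ R) (C : Matrix κ ι R) (D : Matrix κ κ R) :
    (fromBlocks A B C D).trace = A.trace + D.trace := by
  simp [Matrix.trace]

lemma smul_fromRows {ι ι' κ R : Type*} [Mul R] (c : R) (A : Matrix ι κ R) (B : Matrix ι' κ R) :
    c • fromRows A B = fromRows (c • A) (c • B) := by
  ext (i | i) j <;> rfl

lemma X_smul_resolvent_mul {σ κ : Type*} [Fintype σ] [DecidableEq σ] (A : Matrix σ σ ℝ)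
    (V : Matrix σ κ (RatFunc ℝ)) :
    (RatFunc.X : RatFunc ℝ) • (resolvent A * V) = const A * (resolvent A * V) + V := by
  rw [← Matrix.smul_mul, X_smul_resolvent, Matrix.add_mul, Matrix.one_mul, Matrix.mul_assoc,
    add_comm]

/-- The states are a copy of the loop driven by the noise, the parameter fed by the output of that
copy, and a second copy driven by the parameter. The first copy serves both the direct path and the
input of the parameter. The hypothesis on `D` removes the feedthrough of the composite. -/
lemma transfer_cascade {σ ρ ι κ μ ν : Type*} [Fintype σ] [DecidableEq σ] [Fintype ρ]
    [DecidableEq ρ] [Fintype μ] [DecidableEq μ] [Fintype ν] [DecidableEq ν]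
    (F : Matrix σ σ ℝ) (G₁ : Matrix σ κ ℝ) (G₂ : Matrix σ μ ℝ) (H₁ : Matrix ι σ ℝ)
    (H₂ : Matrix ν σ ℝ) (D₁ : Matrix ι μ ℝ) (D₂ : Matrix ν κ ℝ) (Aq : Matrix ρ ρ ℝ)
    (Bq : Matrix ρ ν ℝ) (Cq : Matrix μ ρ ℝ) (D : Matrix μ ν ℝ) (h : D₁ * D * D₂ = 0) :
    transfer (fromBlocks F 0 (fromRows (Bq * H₂) (G₂ * D * H₂)) (fromBlocks Aq 0 (G₂ * Cq) F))
        (fromRows G₁ (fromRows (Bq * D₂) (G₂ * D * D₂)))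
        (fromCols (H₁ + D₁ * D * H₂) (fromCols (D₁ * Cq) H₁)) 0 =
      transfer F G₁ H₁ 0 + transfer F G₂ H₁ D₁ * (transfer Aq Bq Cq 0 + const D) *
        transfer F G₁ H₂ D₂ := by
  obtain ⟨M, hM⟩ : ∃ M, M = transfer F G₁ H₂ D₂ := ⟨_, rfl⟩
  obtain ⟨N, hN⟩ : ∃ N, N = transfer Aq Bq Cq 0 + const D := ⟨_, rfl⟩
  rw [← hM, ← hN]
  have hN' : N = const Cq * (resolvent Aq * const Bq) + const D := by
    rw [hN, transfer, const_zero, add_zero, Matrix.mul_assoc]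
  have hM' : M = const H₂ * (resolvent F * const G₁) + const D₂ := by
    rw [hM, transfer, Matrix.mul_assoc]
  -- The resolvent need not be inverted: it suffices to exhibit the three state responses and check
  -- that they solve s V = 𝔸 V + G.
  have hV : resolvent (fromBlocks F 0 (fromRows (Bq * H₂) (G₂ * D * H₂))
        (fromBlocks Aq 0 (G₂ * Cq) F)) *
        const (fromRows G₁ (fromRows (Bq * D₂) (G₂ * D * D₂))) =
      fromRows (resolvent F * const G₁) (fromRows (resolvent Aq * (const Bq * M))
        (resolvent F * (const G₂ * (N * M)))) := by
    apply resolvent_mul_eq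
    rw [smul_fromRows, smul_fromRows, X_smul_resolvent_mul, X_smul_resolvent_mul,
      X_smul_resolvent_mul]
    simp only [const_fromBlocks, const_fromRows, const_zero, fromRows_mul,
      fromBlocks_mul_fromRows, fromRows_add, const_mul, fromRows_inj.eq_iff]
    refine ⟨by simp, ?_, ?_⟩
    · nth_rewrite 2 [hM']
      simp only [Matrix.mul_add, Matrix.zero_mul, add_zero, Matrix.mul_assoc]
      abel
    · generalize resolvent F * (const G₂ * (N * M)) = Z
      rw [hN', Matrix.add_mul (const Cq * _)]
      nth_rewrite 2 [hM']
      simp only [Matrix.mul_add, Matrix.add_mul, Matrix.zero_mul, Matrix.mul_assoc]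
      abel
  have h' : const D₁ * (const D * const D₂) = 0 := by
    rw [← const_mul, ← const_mul, ← Matrix.mul_assoc, h, const_zero]
  rw [transfer, Matrix.mul_assoc, hV, const_fromCols, const_fromCols, fromCols_mul_fromRows,
    fromCols_mul_fromRows, const_zero, add_zero, Matrix.mul_assoc _ N M, transfer, transfer,
    const_zero, add_zero, const_add, const_mul, const_mul, const_mul]
  have e : const D₁ * (N * M) = const D₁ * (const Cq * (resolvent Aq * (const Bq * M))) +
      const D₁ * (const D * (const H₂ * (resolvent F * const G₁))) := by
    rw [hN', Matrix.add_mul, Matrix.mul_add]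
    nth_rewrite 2 [hM']
    simp only [Matrix.mul_add, Matrix.mul_assoc, h', add_zero]
  rw [Matrix.add_mul _ (const D₁), e]
  simp only [Matrix.add_mul, Matrix.mul_assoc]
  abel

/-! ### The cascade as a loop around the plant -/

section Cascade

variable {n m₁ m₂ q : ℕ} {σ ρ : Type*} [Fintype σ] [DecidableEq σ] [Fintype ρ] [DecidableEq ρ]

/-- The input matrix factors the noise intensity and the output matrix factors the cost weights, so
the covariance formula for the H₂ norm becomes the stationary cost. -/
lemma IsLoop.h2NormSq_eq {S : Plant n m₁ m₂} {𝔸 Γ X : Matrix σ σ ℝ} {N : Matrix σ (Fin n) ℝ}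
    {G : Matrix σ (Fin m₂) ℝ} {E : Matrix (Fin n) σ ℝ} {U : Matrix (Fin m₁) σ ℝ}
    (h : IsLoop S 𝔸 Γ N G E U) (hQ : S.Q.PosDef) (hR : S.R.PosDef) (hW : S.W.PosDef)
    (hV : S.V.PosDef) (hX : 𝔸 * X + X * 𝔸ᵀ = -Γ) :
    h2NormSq (transfer 𝔸 (fromCols (N * CFC.sqrt S.W) (G * CFC.sqrt S.V))
      (fromRows (CFC.sqrt S.Q * E) (CFC.sqrt S.R * U)) 0) = loopCost S E U X := by
  have key {k : ℕ} {M : Matrix (Fin k) (Fin k) ℝ} (hM : M.PosDef) (Z : Matrix (Fin k) σ ℝ) :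
      (CFC.sqrt M * Z * X * (CFC.sqrt M * Z)ᵀ).trace = (M * (Z * X * Zᵀ)).trace := by
    conv_rhs => rw [← sqrt_mul_sqrt hM.posSemidef]
    rw [Matrix.transpose_mul, sqrt_transpose, ← Matrix.mul_assoc _ Zᵀ, Matrix.trace_mul_comm]
    simp only [Matrix.mul_assoc]
  rw [h.stable.h2NormSq_transfer (X := X)]
  · rw [transpose_fromRows, fromRows_mul, fromRows_mul_fromCols, trace_fromBlocks, key hQ, key hR,
      loopCost]
  · rw [hX, h.noise, transpose_fromCols, fromCols_mul_fromRows]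
    simp only [Matrix.transpose_mul, sqrt_transpose]
    congr 1
    conv_lhs => rw [← sqrt_mul_sqrt hW.posSemidef, ← sqrt_mul_sqrt hV.posSemidef]
    simp only [Matrix.mul_assoc]

/-- The inclusion of the first summand. -/
def inclL (k l : ℕ) : Matrix (Fin k ⊕ Fin l) (Fin k) ℝ := fromRows 1 0

/-- The projection onto the first summand. -/
def projL (k l : ℕ) : Matrix (Fin k) (Fin k ⊕ Fin l) ℝ := fromCols 1 0

variable (S : Plant n m₁ m₂) (K : Controller q m₁ m₂) (Aq : Matrix ρ ρ ℝ)
  (Bq : Matrix ρ (Fin m₂ ⊕ Fin q) ℝ) (Cq : Matrix (Fin m₁ ⊕ Fin q) ρ ℝ)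
  (D : Matrix (Fin m₁ ⊕ Fin q) (Fin m₂ ⊕ Fin q) ℝ)

/-- The state matrix of the cascade of the closed loop with a parameter. -/
def cascadeA : Matrix ((Fin n ⊕ Fin q) ⊕ (ρ ⊕ (Fin n ⊕ Fin q)))
    ((Fin n ⊕ Fin q) ⊕ (ρ ⊕ (Fin n ⊕ Fin q))) ℝ :=
  fromBlocks (clA S K) 0 (fromRows (Bq * extC S q) (extB S q * D * extC S q))
    (fromBlocks Aq 0 (extB S q * Cq) (clA S K))

/-- The lift of the plant state to the cascade. -/
def cascadeN (n q : ℕ) (ρ : Type*) :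
    Matrix ((Fin n ⊕ Fin q) ⊕ (ρ ⊕ (Fin n ⊕ Fin q))) (Fin n) ℝ :=
  fromRows (inclL n q) 0

/-- The gain of the observation in the cascade. -/
def cascadeG : Matrix ((Fin n ⊕ Fin q) ⊕ (ρ ⊕ (Fin n ⊕ Fin q))) (Fin m₂) ℝ :=
  fromRows (fromRows 0 K.B) (fromRows (Bq * inclL m₂ q) (extB S q * D * inclL m₂ q))

/-- The plant state as a function of the state of the cascade. -/
def cascadeE (n q : ℕ) (ρ : Type*) :
    Matrix (Fin n) ((Fin n ⊕ Fin q) ⊕ (ρ ⊕ (Fin n ⊕ Fin q))) ℝ :=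
  fromCols (projL n q) (fromCols 0 (projL n q))

/-- The input of the plant as a function of the state of the cascade. -/
def cascadeU : Matrix (Fin m₁) ((Fin n ⊕ Fin q) ⊕ (ρ ⊕ (Fin n ⊕ Fin q))) ℝ :=
  fromCols (fromCols 0 K.C + projL m₁ q * D * extC S q)
    (fromCols (projL m₁ q * Cq) (fromCols 0 K.C))

variable {S K Aq Bq Cq D}

lemma corner_eq_zero (hD : D.toBlocks₁₁ = 0) : projL m₁ q * D * inclL m₂ q = 0 := by
  rw [← Matrix.fromBlocks_toBlocks D, hD, projL, inclL, fromCols_mul_fromBlocks,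
    fromCols_mul_fromRows]
  simp

lemma projL_mul_inclL : projL n q * inclL n q = 1 := by
  simp [projL, inclL, fromCols_mul_fromRows]

lemma extC_mul_inclL : extC S q * inclL n q = inclL m₂ q * S.C := by
  simp only [extC, inclL, fromBlocks_mul_fromRows, fromRows_mul]
  simp

lemma projL_mul_extB : projL n q * extB S q = S.B * projL m₁ q := by
  simp only [extB, projL, fromCols_mul_fromBlocks, mul_fromCols]
  simp

lemma clA_mul_inclL : clA S K * inclL n q = inclL n q * S.A + fromRows 0 K.B * S.C := by
  simp only [clA, inclL, fromBlocks_mul_fromRows, fromRows_mul, fromRows_add]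
  simp

lemma projL_mul_clA : projL n q * clA S K = S.A * projL n q + S.B * fromCols 0 K.C := by
  simp only [clA, projL, fromCols_mul_fromBlocks, mul_fromCols, fromCols_add]
  simp

/-- By superposition the true plant state is the sum of the plant states of the two copies. The
vanishing top left block of `D` is what excludes an instantaneous path from the observation to the
input; this gives both `U * N = 0` and `E * G = 0`. Stability is clear from the block triangular
form. -/
lemma isLoop_cascade (hK : Stabilizes S K) (hAq : Hurwitz Aq) (hD : D.toBlocks₁₁ = 0) :
    IsLoop S (cascadeA S K Aq Bq Cq D)
      (cascadeN n q ρ * S.W * (cascadeN n q ρ)ᵀ +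
        cascadeG S K Bq D * S.V * (cascadeG S K Bq D)ᵀ)
      (cascadeN n q ρ) (cascadeG S K Bq D) (cascadeE n q ρ) (cascadeU S K Cq D) := by
  have hA : Hurwitz (clA S K) := hK
  have hc := corner_eq_zero hD
  refine ⟨hA.fromBlocks_zero₁₂ (hAq.fromBlocks_zero₁₂ hA _) _, ?_, rfl, ?_, ?_, ?_, ?_⟩
  · simp only [cascadeA, cascadeN, cascadeG, fromBlocks_mul_fromRows, fromRows_mul, fromRows_add,
      Matrix.mul_assoc, extC_mul_inclL, clA_mul_inclL, Matrix.mul_zero, Matrix.zero_mul, add_zero,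
      zero_add]
  · simp only [cascadeA, cascadeE, cascadeU, fromCols_mul_fromBlocks, fromCols_mul_fromRows,
      mul_fromCols, fromCols_add, Matrix.mul_add, fromCols_inj.eq_iff]
    simp only [← Matrix.mul_assoc, projL_mul_extB, projL_mul_clA, mul_fromCols, Matrix.mul_zero,
      Matrix.zero_mul, zero_add, add_zero, true_and, and_true]
    abel
  · simp only [cascadeE, cascadeN, fromCols_mul_fromRows, projL_mul_inclL, Matrix.mul_zero,
      add_zero]
  · simp only [cascadeU, cascadeN, fromCols_mul_fromRows, Matrix.add_mul, Matrix.mul_assoc,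
      extC_mul_inclL]
    rw [← Matrix.mul_assoc D, ← Matrix.mul_assoc (projL m₁ q), ← Matrix.mul_assoc (projL m₁ q), hc]
    simp [inclL, fromCols_mul_fromRows]
  · simp only [cascadeE, cascadeG, fromCols_mul_fromRows]
    rw [Matrix.mul_assoc (extB S q), ← Matrix.mul_assoc _ (extB S q), projL_mul_extB,
      Matrix.mul_assoc S.B, ← Matrix.mul_assoc _ D, hc]
    simp [projL, fromCols_mul_fromRows]

/-- This reads the lifted closed-loop map as the response of an `IsLoop` from normalized noise to
weighted state and input, so that its H₂ norm is a loop cost. The feedthroughs of M₁₂ and M₂₁ factor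
through the first summands, hence meet only the zero block of `D`. -/
lemma cascade_transfer_eq (hD : D.toBlocks₁₁ = 0) :
    M11 S K + M12 S K * (transfer Aq Bq Cq 0 + const D) * M21 S K =
      transfer (cascadeA S K Aq Bq Cq D)
        (fromCols (cascadeN n q ρ * CFC.sqrt S.W) (cascadeG S K Bq D * CFC.sqrt S.V))
        (fromRows (CFC.sqrt S.Q * cascadeE n q ρ) (CFC.sqrt S.R * cascadeU S K Cq D)) 0 := by
  have hc := corner_eq_zero hD
  set a : Matrix (Fin n ⊕ Fin m₁) (Fin m₁) ℝ := fromRows 0 (CFC.sqrt S.R) with ha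
  set b : Matrix (Fin m₂) (Fin n ⊕ Fin m₂) ℝ := fromCols 0 (CFC.sqrt S.V) with hb
  have h12 : fromBlocks 0 0 (CFC.sqrt S.R) 0 = a * projL m₁ q := by
    rw [ha, projL, fromRows_mul_fromCols]; simp
  have h21 : fromBlocks 0 (CFC.sqrt S.V) 0 0 = inclL m₂ q * b := by
    rw [hb, inclL, fromRows_mul_fromCols]; simp
  have h0 : a * projL m₁ q * D * (inclL m₂ q * b) = 0 := by
    have : a * projL m₁ q * D * (inclL m₂ q * b) = a * (projL m₁ q * D * inclL m₂ q) * b := by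
      simp only [Matrix.mul_assoc]
    rw [this, hc, Matrix.mul_zero, Matrix.zero_mul]
  rw [M11, M12, M21, h12, h21, ← transfer_cascade _ _ _ _ _ _ _ _ _ _ _ h0, cascadeA]
  congr 1
  · simp only [cascadeN, cascadeG, clB, fromRows_mul, fromCols_fromRows,
      fromRows_inj.eq_iff, fromBlocks_eq_fromRows, ← Matrix.mul_assoc, Matrix.zero_mul]
    simp only [inclL, hb, fromRows_mul, fromCols_fromRows, Matrix.zero_mul,
      Matrix.one_mul, mul_fromCols, Matrix.mul_zero, fromRows_inj.eq_iff, fromCols_zero_fromRows,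
      and_self]
  · have e (M : Matrix (Fin m₁) (Fin n ⊕ Fin q) ℝ) :
        clC S K + a * M = fromRows (CFC.sqrt S.Q * projL n q)
          (CFC.sqrt S.R * (fromCols 0 K.C + M)) := by
      simp only [clC, fromBlocks_eq_fromRows, ha, fromRows_mul, fromRows_add, projL, mul_fromCols,
        Matrix.mul_one, Matrix.mul_zero, Matrix.zero_mul, add_zero, Matrix.mul_add]
    have e0 : clC S K = fromRows (CFC.sqrt S.Q * projL n q) (CFC.sqrt S.R * fromCols 0 K.C) := by
      simpa using e 0
    rw [Matrix.mul_assoc (a * _), Matrix.mul_assoc a, Matrix.mul_assoc a, ← Matrix.mul_assoc _ D,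
      e, e0, ha]
    simp only [cascadeE, cascadeU, fromRows_mul, mul_fromCols, fromCols_fromRows,
      Matrix.zero_mul, Matrix.mul_zero]

end Cascade

end LQG

end

noncomputable section

namespace LQG

/-! ### State space realizations -/

/-- The companion matrix of a polynomial. -/
def companion (d : Polynomial ℝ) : Matrix (Fin d.natDegree) (Fin d.natDegree) ℝ :=
  Matrix.of fun i j =>
    if (i : ℕ) + 1 < d.natDegree then (if (j : ℕ) = i + 1 then 1 else 0) else -d.coeff j

/-- An arbitrary algebra is allowed because the computation is used twice: over ℂ for the
eigenvectors of the companion matrix, and over the rational functions for its resolvent. -/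
lemma sum_companion_row {R : Type*} [CommRing R] [Algebra ℝ R] {d : Polynomial ℝ} (x : R) (u : Fin d.natDegree → R) (hu : ∀ i j : Fin d.natDegree, (j : ℕ) = i + 1 → u j = x * u i)
    (i : Fin d.natDegree) :
    ∑ j, algebraMap ℝ R (companion d i j) * u j =
      if (i : ℕ) + 1 < d.natDegree then x * u i else - ∑ j : Fin d.natDegree, algebraMap ℝ R (d.coeff j) * u j := by
  split_ifs with h
  · rw [Finset.sum_eq_single ⟨i + 1, h⟩]
    · simp [companion, h, hu i ⟨i + 1, h⟩ rfl]
    · intro j _ hj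
      have : (j : ℕ) ≠ i + 1 := fun e => hj (Fin.ext e)
      simp [companion, h, this]
    · simp
  · simp [companion, h]

lemma aeval_eq_sum_fin {R : Type*} [CommRing R] [Algebra ℝ R] {d : Polynomial ℝ} (hd : d.Monic)
    (x : R) : Polynomial.aeval x d =
      ∑ j : Fin d.natDegree, algebraMap ℝ R (d.coeff j) * x ^ (j : ℕ) + x ^ d.natDegree := by
  rw [Polynomial.aeval_eq_sum_range, Finset.sum_range_succ, hd.coeff_natDegree, one_smul,
    Fin.sum_univ_eq_sum_range fun j => algebraMap ℝ R (d.coeff j) * x ^ j]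
  simp only [Algebra.smul_def]

/-- The upper rows force an eigenvector to be a multiple of (1, z, z², …), and the last row then
says that z is a root of `d`. -/
lemma hurwitz_companion {d : Polynomial ℝ} (hd : d.Monic)
    (h : ∀ z : ℂ, Polynomial.aeval z d = 0 → z.re < 0) : Hurwitz (companion d) := by
  rw [hurwitz_iff_eigenvector]
  intro z v hv hz
  have hrow (i) : ∑ j, algebraMap ℝ ℂ (companion d i j) * v j = z * v i := by
    simpa [Matrix.mulVec, dotProduct] using congrFun hz i
  have hstep (i j : Fin d.natDegree) (hij : (j : ℕ) = i + 1) : v j = z * v i := by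
    have hi : (i : ℕ) + 1 < d.natDegree := hij ▸ j.2
    rw [← hrow i, Finset.sum_eq_single j]
    · simp [companion, hi, hij]
    · intro k _ hk
      have : (k : ℕ) ≠ i + 1 := fun e => hk (Fin.ext (e.trans hij.symm))
      simp [companion, hi, this]
    · simp
  have hpos : 0 < d.natDegree := by
    by_contra hn
    apply hv
    ext i
    exact absurd i.2 (by omega)
  have hpow (k : ℕ) (hk : k < d.natDegree) : v ⟨k, hk⟩ = z ^ k * v ⟨0, hpos⟩ := by
    induction k with
    | zero => simp
    | succ k ih => rw [hstep ⟨k, by omega⟩ ⟨k + 1, hk⟩ rfl, ih, pow_succ]; ring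
  have hv0 : v ⟨0, hpos⟩ ≠ 0 := by
    intro h0
    apply hv
    ext i
    rw [hpow i i.2, h0, mul_zero]; rfl
  apply h
  have hlast := hrow ⟨d.natDegree - 1, by omega⟩
  rw [sum_companion_row z v hstep, if_neg (by simp; omega)] at hlast
  rw [aeval_eq_sum_fin hd]
  refine (mul_eq_zero.1 ?_).resolve_right hv0
  rw [add_mul, Finset.sum_mul]
  have e1 : z ^ d.natDegree * v ⟨0, hpos⟩ = z * v ⟨d.natDegree - 1, by omega⟩ := by
    rw [hpow (d.natDegree - 1), ← mul_assoc, ← pow_succ', Nat.sub_add_cancel hpos]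
  rw [e1, ← hlast, ← sub_eq_add_neg, sub_eq_zero]
  refine Finset.sum_congr rfl fun j _ => ?_
  rw [mul_assoc, ← hpow j j.2]

/-- A transfer matrix that has a stable state space realization without feedthrough. -/
def IsRealizable {ι κ : Type*} (M : Matrix ι κ (RatFunc ℝ)) : Prop :=
  ∃ (ρ : Type) (_ : Fintype ρ) (_ : DecidableEq ρ) (F : Matrix ρ ρ ℝ) (G : Matrix ρ κ ℝ)
    (H : Matrix ι ρ ℝ), Hurwitz F ∧ M = transfer F G H 0

/-! ### Closure properties of realizable transfer matrices -/

section

variable {ι κ : Type*}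

lemma isRealizable_zero : IsRealizable (0 : Matrix ι κ (RatFunc ℝ)) :=
  ⟨Fin 1, inferInstance, inferInstance, -1, 0, 0, hurwitz_neg_one, by simp [transfer, const_zero]⟩

lemma IsRealizable.add {M N : Matrix ι κ (RatFunc ℝ)} (hM : IsRealizable M)
    (hN : IsRealizable N) : IsRealizable (M + N) := by
  obtain ⟨ρ, _, _, F, G, H, hF, rfl⟩ := hM
  obtain ⟨ρ', _, _, F', G', H', hF', rfl⟩ := hN
  refine ⟨ρ ⊕ ρ', inferInstance, inferInstance, fromBlocks F 0 0 F', fromRows G G', fromCols H H',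
    hF.fromBlocks_zero₁₂ hF' 0, ?_⟩
  have hV : resolvent (fromBlocks F 0 0 F') * const (fromRows G G') =
      fromRows (resolvent F * const G) (resolvent F' * const G') := by
    apply resolvent_mul_eq
    rw [smul_fromRows, X_smul_resolvent_mul, X_smul_resolvent_mul, const_fromBlocks,
      const_fromRows, fromBlocks_mul_fromRows, fromRows_add, const_zero, const_zero]
    simp
  rw [transfer, transfer, transfer, Matrix.mul_assoc _ _ (const (fromRows G G')), hV,
    const_fromCols, fromCols_mul_fromRows, const_zero]
  simp [Matrix.mul_assoc]

lemma isRealizable_sum {α : Type*} (t : Finset α) (g : α → Matrix ι κ (RatFunc ℝ))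
    (h : ∀ i, IsRealizable (g i)) : IsRealizable (∑ i ∈ t, g i) := by
  classical
  induction t using Finset.induction_on with
  | empty => simpa using isRealizable_zero
  | insert a t ha ih => rw [Finset.sum_insert ha]; exact (h a).add ih

lemma IsRealizable.const_mul_mul_const {ι' κ' : Type*} [Fintype ι] [Fintype κ]
    {M : Matrix ι κ (RatFunc ℝ)} (hM : IsRealizable M) (A : Matrix ι' ι ℝ) (B : Matrix κ κ' ℝ) :
    IsRealizable (const A * M * const B) := by
  obtain ⟨ρ, _, _, F, G, H, hF, rfl⟩ := hM
  refine ⟨ρ, inferInstance, inferInstance, F, G * B, A * H, hF, ?_⟩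
  simp only [transfer, const_zero, add_zero, const_mul, Matrix.mul_assoc]

/-- Controller canonical form. With the last basis vector as input, the state response of the
companion matrix is s^i / d(s), and the output row carries the coefficients of the numerator. Strict
properness ensures that these powers suffice. -/
lemma isRealizable_scalar {f : RatFunc ℝ} (h : IsStable f) (hf : IsStrictlyProper f) :
    IsRealizable (Matrix.of fun _ _ : Unit => f) := by
  by_cases hf0 : f = 0
  · rw [hf0]
    exact isRealizable_zero
  set d := f.denom with hd
  have hm : d.Monic := RatFunc.monic_denom f
  set a := algebraMap (Polynomial ℝ) (RatFunc ℝ) with ha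
  have hd0 : a d ≠ 0 := RatFunc.algebraMap_ne_zero f.denom_ne_zero
  refine ⟨Fin d.natDegree, inferInstance, inferInstance, companion d,
    Matrix.of fun i _ => if (i : ℕ) + 1 < d.natDegree then 0 else 1,
    Matrix.of fun _ j => f.num.coeff j, hurwitz_companion hm h, ?_⟩
  have haeval (p : Polynomial ℝ) : Polynomial.aeval (RatFunc.X : RatFunc ℝ) p = a p := by
    rw [← RatFunc.algebraMap_X, Polynomial.aeval_algebraMap_apply, Polynomial.aeval_X_left_apply]
  have hV : resolvent (companion d) * const (Matrix.of fun (i : Fin d.natDegree) (_ : Unit) =>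
      if (i : ℕ) + 1 < d.natDegree then 0 else 1) =
      Matrix.of fun (i : Fin d.natDegree) (_ : Unit) => RatFunc.X ^ (i : ℕ) / a d := by
    apply resolvent_mul_eq
    ext i _
    have hu (i j : Fin d.natDegree) (hij : (j : ℕ) = i + 1) :
        (RatFunc.X : RatFunc ℝ) ^ (j : ℕ) / a d = RatFunc.X * (RatFunc.X ^ (i : ℕ) / a d) := by
      rw [hij, pow_succ]; ring
    have hrow := sum_companion_row (RatFunc.X : RatFunc ℝ)
      (fun j => RatFunc.X ^ (j : ℕ) / a d) hu i
    rw [Matrix.smul_apply, Matrix.add_apply, Matrix.mul_apply]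
    simp only [const, Matrix.map_apply, Matrix.of_apply, smul_eq_mul]
    simp only [← RatFunc.algebraMap_eq_C]
    rw [hrow]
    split_ifs with hi
    · simp
    · have hN : (i : ℕ) + 1 = d.natDegree := by omega
      have := aeval_eq_sum_fin hm (RatFunc.X : RatFunc ℝ)
      rw [haeval] at this
      have e : RatFunc.X * (RatFunc.X ^ (i : ℕ) / a d) =
          (RatFunc.X : RatFunc ℝ) ^ d.natDegree / a d := by
        rw [← mul_div_assoc, ← pow_succ', congrArg (fun k => RatFunc.X ^ k / a d) hN]
      rw [e, ← sub_eq_iff_eq_add'.2 this, sub_div, div_self hd0, Finset.sum_div, map_one]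
      simp only [mul_div_assoc]
      ring
  rw [transfer, Matrix.mul_assoc, hV, const_zero, add_zero]
  ext _ _
  rw [Matrix.mul_apply]
  simp only [const, Matrix.map_apply, Matrix.of_apply, ← RatFunc.algebraMap_eq_C]
  conv_lhs => rw [← RatFunc.num_div_denom f]
  rw [← ha, ← hd, ← haeval f.num, Polynomial.aeval_eq_sum_range' (n := d.natDegree), Finset.sum_div,
    ← Fin.sum_univ_eq_sum_range fun j => f.num.coeff j • (RatFunc.X : RatFunc ℝ) ^ j / a d]
  · simp only [Algebra.smul_def, mul_div_assoc]
  · exact (Polynomial.natDegree_lt_natDegree_iff (RatFunc.num_ne_zero hf0)).2 hf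

/-- Strictly proper stable real rational transfer matrices are realizable. -/
lemma isRealizable_of_mem [Fintype ι] [Fintype κ] [DecidableEq ι] [DecidableEq κ]
    {M : Matrix ι κ (RatFunc ℝ)} (hM : M ∈ RHinf0 ι κ) : IsRealizable M := by
  have hs (i : ι) (j : κ) : Matrix.single i j (M i j) =
      const (Matrix.single i () 1) * (Matrix.of fun _ _ : Unit => M i j) *
        const (Matrix.single () j 1) := by
    ext i' j'
    simp only [Matrix.mul_apply, const, Matrix.map_apply, Matrix.single_apply, Finset.univ_unique,
      Finset.sum_singleton, Matrix.of_apply]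
    by_cases hi : i = i' <;> by_cases hj : j = j' <;> simp [hi, hj]
  rw [Matrix.matrix_eq_sum_single M]
  refine isRealizable_sum _ _ fun i => isRealizable_sum _ _ fun j => ?_
  rw [hs]
  exact (isRealizable_scalar (hM i j).1 (hM i j).2).const_mul_mul_const _ _

end

/-! ### The optimal value of the lifted problem -/

section Optimal

variable {n m₁ m₂ q : ℕ} {S : Plant n m₁ m₂} {F : Matrix (Fin m₁) (Fin n) ℝ}
  {P : Matrix (Fin n) (Fin n) ℝ} {L : Matrix (Fin n) (Fin m₂) ℝ} {Y : Matrix (Fin n) (Fin n) ℝ}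
  {K : Controller q m₁ m₂}

/-- Once the dynamic part of the parameter is realized, the closed-loop map is that of a cascade,
and the universal lower bound for loops applies. -/
lemma lqgValue_le_liftedCost (hr : IsRiccatiPair S F P L Y) (hQ : S.Q.PosDef) (hR : S.R.PosDef)
    (hW : S.W.PosDef) (hV : S.V.PosDef) (hK : Stabilizes S K) {X : Param q m₁ m₂}
    (hX : X ∈ paramSpace q m₁ m₂) : lqgValue S F P Y ≤ liftedCost S K X := by
  obtain ⟨ρ, _, _, Aq, Bq, Cq, hAq, h1⟩ := isRealizable_of_mem hX.1
  have hl := isLoop_cascade (Bq := Bq) (Cq := Cq) hK hAq hX.2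
  have hZ := hl.stable.lyapunov_spec (cascadeN n q ρ * S.W * (cascadeN n q ρ)ᵀ +
        cascadeG S K Bq X.2 * S.V * (cascadeG S K Bq X.2)ᵀ)
  rw [liftedCost, Param.toTransfer, h1, cascade_transfer_eq hX.2, hl.h2NormSq_eq hQ hR hW hV hZ]
  exact hl.lqgValue_le hr hR hV hZ

variable (S K F L)

/-- The constant part of the optimal parameter. -/
def optD : Matrix (Fin m₁ ⊕ Fin q) (Fin m₂ ⊕ Fin q) ℝ := fromBlocks 0 (-K.C) (-K.B) (-(K.A + 1))

/-- The state matrix of the dynamic part of the optimal parameter. -/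
def optA : Matrix ((Fin n ⊕ Fin q) ⊕ Fin n) ((Fin n ⊕ Fin q) ⊕ Fin n) ℝ :=
  fromBlocks (clA S K + extB S q * optD K * extC S q) (extB S q * (fromRows F 0 : Matrix (Fin m₁ ⊕ Fin q) (Fin n) ℝ))
    (L * S.C * projL n q) (S.A + S.B * F - L * S.C)

/-- The input matrix of the dynamic part of the optimal parameter. -/
def optB : Matrix ((Fin n ⊕ Fin q) ⊕ Fin n) (Fin m₂ ⊕ Fin q) ℝ :=
  fromRows (extB S q * optD K) (L * projL m₂ q)

/-- The output matrix of the dynamic part of the optimal parameter. -/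
def optC : Matrix (Fin m₁ ⊕ Fin q) ((Fin n ⊕ Fin q) ⊕ Fin n) ℝ :=
  fromCols (optD K * extC S q) (fromRows F 0)

/-- The parameter that turns the closed loop into the one with the Kalman filter. -/
def optParam : Param q m₁ m₂ := (transfer (optA S F L K) (optB S L K) (optC S F K) 0, optD K)

variable {S K F L}

/-- Added to `clA`, this matrix removes the original controller: the plant runs in open loop, and
the controller state decouples with rate -1. -/
lemma extB_mul_optD_mul_extC :
    extB S q * optD K * extC S q = fromBlocks 0 (-(S.B * K.C)) (-(K.B * S.C)) (-(K.A + 1)) := by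
  simp [extB, extC, optD, fromBlocks_multiply]

/-- The parameter contains a model of the plant regulated by a Kalman filter. In the coordinates
model state, filter error and decoupled controller state it is block triangular, as for the Kalman
controller. -/
lemma hurwitz_optA (hr : IsRiccatiPair S F P L Y) : Hurwitz (optA S F L K) := by
  have hD : Hurwitz (fromBlocks (S.A + S.B * F) (fromCols (S.B * F) (0 : Matrix _ (Fin q) ℝ)) 0
      (fromBlocks (S.A - L * S.C) 0 0 (-1))) :=
    hr.stableF.fromBlocks_zero₂₁ (hr.stableL.fromBlocks_zero₂₁ hurwitz_neg_one 0) _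
  refine hD.of_intertwine
    (T := fromRows (fromCols (fromCols 1 0) 0) (fromRows (fromCols (fromCols (-1) 0) 1)
      (fromCols (fromCols 0 1) 0)))
    (T' := fromRows (fromRows (fromCols 1 0) (fromCols 0 (fromCols 0 1)))
      (fromCols 1 (fromCols 1 0))) ?_ ?_
  · simp only [fromRows_mul, fromCols_mul_fromRows, mul_fromCols, fromCols_add,
      fromBlocks_eq_fromRows, one_eq_fromRows, fromRows_inj.eq_iff, fromCols_inj.eq_iff,
      fromCols_fromRows, fromCols_fromRows_zero]
    simp
  · rw [optA, extB_mul_optD_mul_extC]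
    simp only [clA, extB, projL, fromRows_mul, mul_fromCols, fromCols_mul_fromRows, fromRows_add,
      fromCols_add, fromCols_sub, fromRows_neg, fromCols_neg, fromCols_fromRows,
      fromCols_zero_fromRows, fromCols_fromRows_zero, fromBlocks_eq_fromRows, one_eq_fromRows,
      fromRows_inj.eq_iff, fromCols_inj.eq_iff, fromRows_zero, fromCols_zero, Matrix.zero_mul,
      Matrix.one_mul, Matrix.mul_zero, zero_add, add_zero, neg_zero, sub_zero, zero_sub,
      Matrix.mul_one, Matrix.neg_mul, Matrix.mul_neg, neg_neg, Matrix.mul_sub, Matrix.sub_mul,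
      Matrix.mul_add, Matrix.add_mul, ← Matrix.mul_assoc, and_true, true_and, add_neg_cancel,
      neg_add_cancel, sub_eq_add_neg, neg_add]
    repeat' apply And.intro
    all_goals abel

lemma optParam_mem (hr : IsRiccatiPair S F P L Y) : optParam S F L K ∈ paramSpace q m₁ m₂ :=
  ⟨(hurwitz_optA hr).transfer_mem _ _, by simp [optParam, optD]⟩

/-- Two errors evolve autonomously: the filter state minus the plant state, and the loop state
simulated inside the parameter minus the state of the second copy in the cascade. Their joint
dynamics is triangular with stable blocks A - LC and `clA`, neither is excited by the gain `N * L +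
G`, and the input deviates from the ideal feedback only through them. -/
lemma liftedCost_optParam (hr : IsRiccatiPair S F P L Y) (hQ : S.Q.PosDef) (hR : S.R.PosDef)
    (hW : S.W.PosDef) (hV : S.V.PosDef) (hK : Stabilizes S K) :
    liftedCost S K (optParam S F L K) = lqgValue S F P Y := by
  have hD0 : (optD K).toBlocks₁₁ = 0 := by simp [optD]
  have hl := isLoop_cascade (Bq := optB S L K) (Cq := optC S F K) hK (hurwitz_optA (K := K) hr) hD0
  have hZ := hl.stable.lyapunov_spec
    (cascadeN n q ((Fin n ⊕ Fin q) ⊕ Fin n) * S.W * (cascadeN n q _)ᵀ +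
        cascadeG S K (optB S L K) (optD K) * S.V * (cascadeG S K (optB S L K) (optD K))ᵀ)
  have hs : Hurwitz (clA S K) := hK
  rw [liftedCost, Param.toTransfer, optParam, cascade_transfer_eq hD0,
    hl.h2NormSq_eq hQ hR hW hV hZ]
  refine hl.loopCost_eq_lqgValue hr hZ
    (A' := fromBlocks (S.A - L * S.C) (fromCols (L * S.C) (S.B * K.C)) 0 (clA S K))
    (hr.stableL.fromBlocks_zero₂₁ hs _) (J := fromCols F (fromCols 0 (-K.C)))
    (Φ := fromRows
      (fromCols (-projL n q) (fromCols (fromCols 0 1) (-projL n q)))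
      (fromCols 0 (fromCols (fromCols 1 0) (-1)))) ?_ ?_ ?_
  · simp only [cascadeU, cascadeE, optC, optD, projL, extC, fromRows_mul, mul_fromCols,
      fromCols_mul_fromRows, fromRows_add, fromCols_add, fromCols_sub, fromRows_neg,
      fromCols_neg, fromCols_fromRows, fromCols_zero_fromRows, fromCols_fromRows_zero,
      fromBlocks_eq_fromRows, one_eq_fromRows, fromRows_inj.eq_iff, fromCols_inj.eq_iff,
      fromRows_zero, fromCols_zero, Matrix.zero_mul, Matrix.one_mul, Matrix.mul_zero, zero_add,
      add_zero, neg_zero, sub_zero, zero_sub, Matrix.mul_one, Matrix.neg_mul, Matrix.mul_neg,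
      neg_neg, Matrix.mul_sub, Matrix.sub_mul, Matrix.mul_add, Matrix.add_mul, ← Matrix.mul_assoc,
      and_true, true_and, add_neg_cancel, neg_add_cancel, sub_eq_add_neg, neg_add]
  · rw [cascadeA, optA, extB_mul_optD_mul_extC]
    simp only [optB, optC, optD, projL, extC, extB, clA, fromRows_mul, mul_fromCols,
      fromCols_mul_fromRows, fromRows_add, fromCols_add, fromCols_sub, fromRows_neg,
      fromCols_neg, fromCols_fromRows, fromCols_zero_fromRows, fromCols_fromRows_zero,
      fromBlocks_eq_fromRows, one_eq_fromRows, fromRows_inj.eq_iff, fromCols_inj.eq_iff,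
      fromRows_zero, fromCols_zero, Matrix.zero_mul, Matrix.one_mul, Matrix.mul_zero, zero_add,
      add_zero, neg_zero, sub_zero, zero_sub, Matrix.mul_one, Matrix.neg_mul, Matrix.mul_neg,
      neg_neg, Matrix.mul_sub, Matrix.sub_mul, Matrix.mul_add, Matrix.add_mul, ← Matrix.mul_assoc,
      and_true, true_and, add_neg_cancel, neg_add_cancel, sub_eq_add_neg, neg_add]
    repeat' apply And.intro
    all_goals first | (abel; done) | (abel_nf; exact fromCols_zero)
  · simp only [cascadeN, cascadeG, optB, inclL, optD, projL, extB, fromRows_mul, mul_fromCols,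
      fromCols_mul_fromRows, fromRows_add, fromCols_add, fromCols_sub, fromRows_neg,
      fromCols_neg, fromCols_fromRows, fromCols_zero_fromRows, fromCols_fromRows_zero,
      fromBlocks_eq_fromRows, one_eq_fromRows, fromRows_inj.eq_iff, fromCols_inj.eq_iff,
      fromRows_zero, fromCols_zero, Matrix.zero_mul, Matrix.one_mul, Matrix.mul_zero, zero_add,
      add_zero, neg_zero, sub_zero, zero_sub, Matrix.mul_one, Matrix.neg_mul, Matrix.mul_neg,
      neg_neg, Matrix.mul_sub, Matrix.sub_mul, Matrix.mul_add, Matrix.add_mul, ← Matrix.mul_assoc,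
      and_true, true_and, add_neg_cancel, neg_add_cancel, sub_eq_add_neg, neg_add]

end Optimal

end LQG

end

noncomputable section

namespace LQG

/-! ### The search direction -/

section Search

variable {n m₁ m₂ q : ℕ} {S : Plant n m₁ m₂} {K : Controller q m₁ m₂}

variable (S K) in
/-- The closed-loop transfer matrix at a parameter. -/
def closedMap (X : Param q m₁ m₂) : Matrix (Fin n ⊕ Fin m₁) (Fin n ⊕ Fin m₂) (RatFunc ℝ) :=
  M11 S K + M12 S K * Param.toTransfer X * M21 S K

variable (S K) in
/-- The linear part of `closedMap`. -/
def deltaMap (H : Param q m₁ m₂) : Matrix (Fin n ⊕ Fin m₁) (Fin n ⊕ Fin m₂) (RatFunc ℝ) :=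
  M12 S K * Param.toTransfer H * M21 S K

lemma toTransfer_add (X Y : Param q m₁ m₂) :
    Param.toTransfer (X + Y) = Param.toTransfer X + Param.toTransfer Y := by
  simp only [Param.toTransfer, Prod.fst_add, Prod.snd_add, const_add]
  abel

lemma closedMap_add (X H : Param q m₁ m₂) :
    closedMap S K (X + H) = closedMap S K X + deltaMap S K H := by
  rw [closedMap, closedMap, deltaMap, toTransfer_add, Matrix.mul_add, Matrix.add_mul, add_assoc]

/-- Properness of the factors alone would not give strict properness, since the parameter has a
constant part. The cascade realization shows that the feedthrough vanishes. -/
lemma closedMap_mem (hK : Stabilizes S K) {X : Param q m₁ m₂} (hX : X ∈ paramSpace q m₁ m₂) :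
    closedMap S K X ∈ RHinf0 _ _ := by
  obtain ⟨ρ, _, _, Aq, Bq, Cq, hAq, h1⟩ := isRealizable_of_mem hX.1
  have hl := isLoop_cascade (Bq := Bq) (Cq := Cq) hK hAq hX.2
  rw [closedMap, Param.toTransfer, h1, cascade_transfer_eq hX.2]
  exact hl.stable.transfer_mem _ _

lemma M11_mem (hK : Stabilizes S K) : M11 S K ∈ RHinf0 _ _ :=
  Hurwitz.transfer_mem (F := clA S K) hK _ _

lemma deltaMap_mem (hK : Stabilizes S K) {H : Param q m₁ m₂} (hH : H ∈ paramSpace q m₁ m₂) :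
    deltaMap S K H ∈ RHinf0 _ _ := by
  have := (RHinf0Submodule _ _).sub_mem (closedMap_mem hK hH) (M11_mem hK)
  rwa [closedMap, add_sub_cancel_left] at this

lemma liftedCost_eq (X : Param q m₁ m₂) : liftedCost S K X = h2NormSq (closedMap S K X) := rfl

lemma liftedCost_add (hK : Stabilizes S K) {X H : Param q m₁ m₂} (hX : X ∈ paramSpace q m₁ m₂)
    (hH : H ∈ paramSpace q m₁ m₂) :
    liftedCost S K (X + H) = liftedCost S K X + 2 * h2Inner (closedMap S K X) (deltaMap S K H) +
      h2NormSq (deltaMap S K H) := by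
  have hT := closedMap_mem hK hX
  have hD := deltaMap_mem hK hH
  have hTD := (RHinf0Submodule _ _).add_mem hT hD
  rw [liftedCost_eq, closedMap_add, h2NormSq, h2Inner_add_right hTD hT hD,
    h2Inner_comm _ (closedMap S K X), h2Inner_comm _ (deltaMap S K H), h2Inner_add_right hT hT hD, h2Inner_add_right hD hT hD,
    liftedCost_eq, h2NormSq, h2NormSq, h2Inner_comm (deltaMap S K H) (closedMap S K X)]
  ring

lemma regMat_M12 (hK : Stabilizes S K) : RegMat rhp (M12 S K) :=
  Hurwitz.regMat_transfer (F := clA S K) hK _ _ _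

lemma regMat_M21 (hK : Stabilizes S K) : RegMat rhp (M21 S K) :=
  Hurwitz.regMat_transfer (F := clA S K) hK _ _ _

lemma regMat_toTransfer {X : Param q m₁ m₂} (hX : X ∈ paramSpace q m₁ m₂) :
    RegMat rhp (Param.toTransfer X) :=
  (mem_RHinf0.1 hX.1).1.add (regMat_const _)

lemma paraConj_transfer {σ ι κ : Type*} [Fintype σ] [DecidableEq σ] (F : Matrix σ σ ℝ)
    (G : Matrix σ κ ℝ) (H : Matrix ι σ ℝ) (D : Matrix ι κ ℝ) :
    paraConj (transfer F G H D) =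
      const Gᵀ * (paraConj (resolvent F) * const Hᵀ) + const Dᵀ := by
  rw [transfer, paraConj_add, paraConj_mul, paraConj_mul, paraConj_const, paraConj_const,
    paraConj_const]

lemma resolvent_transpose {σ : Type*} [Fintype σ] [DecidableEq σ] (F : Matrix σ σ ℝ) :
    resolvent Fᵀ = (resolvent F)ᵀ := by
  rw [resolvent, resolvent, Matrix.transpose_nonsing_inv, Matrix.transpose_sub,
    Matrix.transpose_smul, Matrix.transpose_one, const_transpose]

lemma clC_transpose_mul (hQ : S.Q.PosDef) (hR : S.R.PosDef) :
    (clC S K)ᵀ * clC S K = fromBlocks S.Q 0 0 (K.Cᵀ * S.R * K.C) := by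
  have h1 := sqrt_mul_sqrt hQ.posSemidef
  have h2 := sqrt_mul_sqrt hR.posSemidef
  have e : K.Cᵀ * CFC.sqrt S.R * (CFC.sqrt S.R * K.C) = K.Cᵀ * S.R * K.C := by
    conv_rhs => rw [← h2]
    simp only [Matrix.mul_assoc]
  rw [clC, fromBlocks_transpose, fromBlocks_multiply, Matrix.transpose_mul, sqrt_transpose,
    sqrt_transpose, h1, e]
  simp

lemma clB_mul_transpose (hW : S.W.PosDef) (hV : S.V.PosDef) :
    clB S K * (clB S K)ᵀ = fromBlocks S.W 0 0 (K.B * S.V * K.Bᵀ) := by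
  have h1 := sqrt_mul_sqrt hW.posSemidef
  have h2 := sqrt_mul_sqrt hV.posSemidef
  have e : K.B * CFC.sqrt S.V * (CFC.sqrt S.V * K.Bᵀ) = K.B * S.V * K.Bᵀ := by
    conv_rhs => rw [← h2]
    simp only [Matrix.mul_assoc]
  rw [clB, fromBlocks_transpose, fromBlocks_multiply, Matrix.transpose_mul, sqrt_transpose,
    sqrt_transpose, h1, e]
  simp

/-- The transfer matrix of which the search direction is the stable part. -/
lemma paraConj_M12_mul_M11_mul (hQ : S.Q.PosDef) (hR : S.R.PosDef) (hW : S.W.PosDef)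
    (hV : S.V.PosDef) (hK : Stabilizes S K) :
    paraConj (M12 S K) * M11 S K * paraConj (M21 S K) =
      transfer (clA S K) (algB0 S K - gramSigma S K * algC0 S q)
        (algC1 S K - algB1 S q * gramP S K) 0 +
      (const (algC1 S K - algB1 S q * gramP S K) * (const (gramSigma S K) *
          (paraConj (resolvent (clA S K)) * const (extC S q)ᵀ)) +
        const (extB S q)ᵀ * (paraConj (resolvent (clA S K)) * (const (gramP S K) *
          (const (clB S K) * paraConj (M21 S K))))) := by
  have hA : Hurwitz (clA S K) := hK
  set R := resolvent (clA S K) with hRdef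
  have hPeq := hA.transpose.lyapunov_spec (fromBlocks S.Q 0 0 (K.Cᵀ * S.R * K.C))
  change _ * gramP S K + gramP S K * _ = _ at hPeq
  have hPs : (gramP S K)ᵀ = gramP S K := by
    refine hA.transpose.lyapunov_symm ?_ hPeq
    rw [← clC_transpose_mul hQ hR, Matrix.transpose_mul, Matrix.transpose_transpose]
  have hRt : paraConj Rᵀ = (paraConj R)ᵀ := rfl
  -- The two Gramians split the products of resolvents on the output and on the input side into
  -- stable and antistable summands. The output side uses the transposed system.
  have hP : paraConj R * (const (clC S K)ᵀ * (const (clC S K) * R)) =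
      const (gramP S K) * R + paraConj R * const (gramP S K) := by
    have h1 := lyapunov_resolvent_identity hPeq
    rw [resolvent_transpose, ← hRdef, ← clC_transpose_mul hQ hR, hRt] at h1
    have h2 := congrArg Matrix.transpose h1
    rw [Matrix.transpose_add, Matrix.transpose_mul, Matrix.transpose_mul, Matrix.transpose_mul,
      Matrix.transpose_mul, Matrix.transpose_transpose, Matrix.transpose_transpose,
      ← const_transpose, ← const_transpose, Matrix.transpose_mul, Matrix.transpose_transpose, hPs,
      const_mul] at h2
    rw [← h2, Matrix.mul_assoc]
  have hS : R * (const (clB S K) * (const (clB S K)ᵀ * paraConj R)) =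
      R * const (gramSigma S K) + const (gramSigma S K) * paraConj R := by
    have h1 := lyapunov_resolvent_identity (gramSigma_eq hK)
    rw [clNoise, ← clB_mul_transpose hW hV, const_mul] at h1
    rw [← hRdef] at h1
    rw [← h1]
    simp only [Matrix.mul_assoc]
  have hC1 : algC1 S K = (fromBlocks 0 0 (CFC.sqrt S.R) 0 :
      Matrix (Fin n ⊕ Fin m₁) (Fin m₁ ⊕ Fin q) ℝ)ᵀ * clC S K := by
    rw [algC1, clC, fromBlocks_transpose, fromBlocks_multiply, sqrt_transpose,
      ← Matrix.mul_assoc (CFC.sqrt S.R), sqrt_mul_sqrt hR.posSemidef]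
    simp
  have hB0 : algB0 S K = clB S K * (fromBlocks 0 (CFC.sqrt S.V) 0 0 :
      Matrix (Fin m₂ ⊕ Fin q) (Fin n ⊕ Fin m₂) ℝ)ᵀ := by
    rw [algB0, clB, fromBlocks_transpose, fromBlocks_multiply, sqrt_transpose,
      Matrix.mul_assoc K.B, sqrt_mul_sqrt hV.posSemidef]
    simp
  have hB1 : algB1 S q = -(extB S q)ᵀ := by
    rw [algB1, extB, fromBlocks_transpose]; simp
  have hC0 : algC0 S q = -(extC S q)ᵀ := by
    rw [algC0, extC, fromBlocks_transpose]; simp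
  have hM11 : M11 S K = const (clC S K) * (R * const (clB S K)) := by
    rw [M11, transfer_zero, Matrix.mul_assoc]
  have hL : paraConj (M12 S K) * (const (clC S K) * R) =
      const (algC1 S K - algB1 S q * gramP S K) * R +
        const (extB S q)ᵀ * (paraConj R * const (gramP S K)) := by
    rw [M12, paraConj_transfer, Matrix.add_mul, ← hRdef, Matrix.mul_assoc, Matrix.mul_assoc, hP, hC1,
      hB1, Matrix.neg_mul, sub_neg_eq_add, const_add, const_mul, const_mul]
    simp only [Matrix.mul_add, Matrix.add_mul, Matrix.mul_assoc]
    abel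
  have hRr : R * (const (clB S K) * paraConj (M21 S K)) =
      R * const (algB0 S K - gramSigma S K * algC0 S q) +
        const (gramSigma S K) * (paraConj R * const (extC S q)ᵀ) := by
    have e : R * (const (clB S K) * (const (clB S K)ᵀ * (paraConj R * const (extC S q)ᵀ))) =
        R * (const (clB S K) * (const (clB S K)ᵀ * paraConj R)) * const (extC S q)ᵀ := by
      simp only [Matrix.mul_assoc]
    rw [M21, paraConj_transfer, ← hRdef, Matrix.mul_add, Matrix.mul_add, e, hS, hB0,
      hC0, Matrix.mul_neg, sub_neg_eq_add, const_add, const_mul, const_mul]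
    simp only [Matrix.mul_add, Matrix.add_mul, Matrix.mul_assoc]
    abel
  have e1 : paraConj (M12 S K) * M11 S K * paraConj (M21 S K) =
      (paraConj (M12 S K) * (const (clC S K) * R)) * (const (clB S K) * paraConj (M21 S K)) := by
    rw [hM11]; simp only [Matrix.mul_assoc]
  -- After both splittings a single product contains only the stable resolvent. All the others
  -- consist of constants and para-conjugated stable factors.
  rw [e1, hL, Matrix.add_mul, Matrix.mul_assoc, hRr, transfer_zero, ← hRdef, Matrix.mul_add]
  simp only [Matrix.mul_assoc]
  rw [add_assoc]

lemma exists_isStablePart {ι κ : Type*} {N : Matrix ι κ (RatFunc ℝ)}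
    (h : ∀ i j, HasStablePart (N i j)) : ∃ G, IsStablePart N G := by
  choose g hg using h
  refine ⟨Matrix.of g, mem_RHinf0.2 ⟨fun i j => (hg i j).1.1, fun i j => (hg i j).1.2⟩,
    fun i j => isAntistable_iff.2 (hg i j).2⟩

/-- The raw gradient, before projection to the stable part. -/
def rawGrad (S : Plant n m₁ m₂) (K : Controller q m₁ m₂) (X : Param q m₁ m₂) :
    Matrix (Fin m₁ ⊕ Fin q) (Fin m₂ ⊕ Fin q) (RatFunc ℝ) :=
  paraConj (M12 S K) * closedMap S K X * paraConj (M21 S K)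

/-- The algorithm replaces M₁₂(-s)ᵀ M₁₁ M₂₁(-s)ᵀ by its explicit stable summand. What is dropped is
antistable, so the search direction is also the stable part of the full `rawGrad`. Existence has to
be shown because `stablePart` is a choice; it holds as every remaining entry is a sum of products of
a stable and an antistable function. -/
lemma searchDir_spec (hQ : S.Q.PosDef) (hR : S.R.PosDef) (hW : S.W.PosDef)
    (hV : S.V.PosDef) (hK : Stabilizes S K) {X : Param q m₁ m₂} (hX : X ∈ paramSpace q m₁ m₂) :
    searchDir S K X ∈ RHinf0 _ _ ∧ RegMat lhp (rawGrad S K X - searchDir S K X) := by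
  have hA : Hurwitz (clA S K) := hK
  have h12 := (regMat_M12 hK).paraConj_of_stable
  have h21 := (regMat_M21 hK).paraConj_of_stable
  have hR' := hA.regMat_resolvent.paraConj_of_stable
  obtain ⟨Z, hZ⟩ : ∃ Z, Z = M12 S K * Param.toTransfer X * M21 S K := ⟨_, rfl⟩
  have hZr : RegMat rhp Z := hZ ▸ ((regMat_M12 hK).mul (regMat_toTransfer hX)).mul (regMat_M21 hK)
  obtain ⟨T, hT⟩ : ∃ T, T = transfer (clA S K) (algB0 S K - gramSigma S K * algC0 S q)
        (algC1 S K - algB1 S q * gramP S K) 0 := ⟨_, rfl⟩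
  have hTm : T ∈ RHinf0 _ _ := hT ▸ hA.transfer_mem _ _
  have hdef : searchDir S K X =
      stablePart (T + paraConj (M12 S K) * Z * paraConj (M21 S K)) := by
    rw [searchDir, hT, hZ]
    simp only [Matrix.mul_assoc]
  have hex : ∃ G, IsStablePart (T + paraConj (M12 S K) * Z * paraConj (M21 S K)) G := by
    refine exists_isStablePart fun i j => ?_
    rw [Matrix.add_apply]
    refine HasStablePart.add ⟨T i j, ⟨(mem_RHinf0.1 hTm).1 i j, (mem_RHinf0.1 hTm).2 i j⟩, ?_⟩ ?_
    · rw [sub_self]; exact zero_mem _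
    rw [Matrix.mul_apply]
    refine hasStablePart_sum _ fun k _ => ?_
    rw [Matrix.mul_apply, Finset.sum_mul]
    refine hasStablePart_sum _ fun l _ => ?_
    rw [mul_comm (paraConj (M12 S K) i l), mul_assoc]
    exact hasStablePart_mul (hZr l k) (mul_mem (h12 i l) (h21 k j))
  have hsp : IsStablePart (T + paraConj (M12 S K) * Z * paraConj (M21 S K)) (searchDir S K X) := by
    rw [hdef]; exact Classical.epsilon_spec hex
  refine ⟨hsp.1, ?_⟩
  have hlhp : RegMat lhp (T + paraConj (M12 S K) * Z * paraConj (M21 S K) - searchDir S K X) :=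
    fun i j => isAntistable_iff.1 (hsp.2 i j)
  have e : rawGrad S K X - searchDir S K X = (const (algC1 S K - algB1 S q * gramP S K) *
      (const (gramSigma S K) * (paraConj (resolvent (clA S K)) * const (extC S q)ᵀ)) +
        const (extB S q)ᵀ * (paraConj (resolvent (clA S K)) * (const (gramP S K) *
          (const (clB S K) * paraConj (M21 S K))))) +
      (T + paraConj (M12 S K) * Z * paraConj (M21 S K) - searchDir S K X) := by
    rw [rawGrad, closedMap, Matrix.mul_add, Matrix.add_mul,
      paraConj_M12_mul_M11_mul hQ hR hW hV hK, ← hT, ← hZ]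
    abel
  rw [e]
  refine RegMat.add (RegMat.add ?_ ?_) hlhp
  · exact (regMat_const _).mul ((regMat_const _).mul (hR'.mul (regMat_const _)))
  · exact (regMat_const _).mul (hR'.mul ((regMat_const _).mul ((regMat_const _).mul h21)))

end Search

end LQG

end

noncomputable section

namespace LQG

/-! ### The gradient -/

section Gradient

variable {n m₁ m₂ q : ℕ} {S : Plant n m₁ m₂} {K : Controller q m₁ m₂}

variable (S K) in
/-- Half the gradient of the lifted cost. -/
def halfGrad (X : Param q m₁ m₂) : Param q m₁ m₂ :=
  (searchDir S K X, zeroBlock ((searchDir S K X).map residueSum))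

lemma HasLeadMat.mul_sproper {ι κ μ : Type*} [Fintype κ] {M : Matrix ι κ (RatFunc ℝ)}
    {N : Matrix κ μ (RatFunc ℝ)} (hM : SProperMat M) (hN : SProperMat N) :
    HasLeadMat (M * N) 0 := fun i j => by
  rw [Matrix.mul_apply]
  simpa using hasLead_sum Finset.univ (f := fun k => M i k * N k j) (a := fun _ => (0 : ℝ))
    fun k _ => hasLead_mul (hM i k) (hN k j)

lemma HasLeadMat.add {ι κ : Type*} {M N : Matrix ι κ (RatFunc ℝ)} {L L' : Matrix ι κ ℝ}
    (hM : HasLeadMat M L) (hN : HasLeadMat N L') : HasLeadMat (M + N) (L + L') :=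
  fun i j => (hM i j).add (hN i j)

lemma exists_hasLeadMat {ι κ : Type*} {M : Matrix ι κ (RatFunc ℝ)} (h : SProperMat M) :
    ∃ L, HasLeadMat M L := by
  choose L hL using fun i j => exists_hasLead (h i j)
  exact ⟨Matrix.of L, hL⟩

lemma sproperMat_transfer_sub {σ ι κ : Type*} [Fintype σ] [DecidableEq σ] (F : Matrix σ σ ℝ)
    (G : Matrix σ κ ℝ) (H : Matrix ι σ ℝ) (D : Matrix ι κ ℝ) :
    SProperMat (transfer F G H D - const D) := by
  rw [transfer, add_sub_cancel_right, ← transfer_zero]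
  exact (hasLeadMat_transfer F G H).sproper

/-- Directions in the parameter space vanish on the erased block, so erasing it does not change the
pairing. -/
lemma trace_transpose_mul_zeroBlock
    {A D : Matrix (Fin m₁ ⊕ Fin q) (Fin m₂ ⊕ Fin q) ℝ} (hD : D.toBlocks₁₁ = 0) :
    ((zeroBlock A)ᵀ * D).trace = (Aᵀ * D).trace := by
  rw [← Matrix.fromBlocks_toBlocks D, hD]
  conv_rhs => rw [← Matrix.fromBlocks_toBlocks A]
  rw [zeroBlock, fromBlocks_transpose, fromBlocks_transpose, fromBlocks_multiply,
    fromBlocks_multiply, trace_fromBlocks, trace_fromBlocks]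
  simp

/-- The closed-loop map is already of order s⁻¹, so only the feedthroughs of the two outer factors
reach the s⁻¹ coefficient. They confine it to the top left block, exactly the one where constant
parameters vanish. -/
lemma exists_hasLeadMat_rawGrad (hK : Stabilizes S K) {X : Param q m₁ m₂}
    (hX : X ∈ paramSpace q m₁ m₂) :
    ∃ L : Matrix (Fin m₁) (Fin m₂) ℝ, HasLeadMat (rawGrad S K X) (fromBlocks L 0 0 0) := by
  have hT := (mem_RHinf0.1 (closedMap_mem hK hX)).2
  obtain ⟨T₁, hT₁⟩ := exists_hasLeadMat hT
  set D₁ : Matrix (Fin n ⊕ Fin m₁) (Fin m₁ ⊕ Fin q) ℝ := fromBlocks 0 0 (CFC.sqrt S.R) 0 with hD₁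
  set D₂ : Matrix (Fin m₂ ⊕ Fin q) (Fin n ⊕ Fin m₂) ℝ := fromBlocks 0 (CFC.sqrt S.V) 0 0 with hD₂
  have h12 : SProperMat (paraConj (M12 S K) - const D₁ᵀ) := by
    have := (sproperMat_transfer_sub (clA S K) (extB S q) (clC S K) D₁).paraConj
    intro i j
    have h := this i j
    rwa [paraConj, Matrix.transpose_apply, Matrix.map_apply, Matrix.sub_apply, map_sub,
      show negVar (const D₁ j i) = const D₁ j i from negVar_C _] at h
  have h21 : SProperMat (paraConj (M21 S K) - const D₂ᵀ) := by
    have := (sproperMat_transfer_sub (clA S K) (clB S K) (extC S q) D₂).paraConj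
    intro i j
    have h := this i j
    rwa [paraConj, Matrix.transpose_apply, Matrix.map_apply, Matrix.sub_apply, map_sub,
      show negVar (const D₂ j i) = const D₂ j i from negVar_C _] at h
  have hp21 : ProperMat (paraConj (M21 S K)) := (properMat_transfer _ _ _ _).paraConj
  have e : rawGrad S K X = (const D₁ᵀ * closedMap S K X * const D₂ᵀ +
      (paraConj (M12 S K) - const D₁ᵀ) * (closedMap S K X * paraConj (M21 S K))) +
      (const D₁ᵀ * closedMap S K X) * (paraConj (M21 S K) - const D₂ᵀ) := by
    rw [rawGrad, Matrix.sub_mul, Matrix.mul_sub, ← Matrix.mul_assoc, ← Matrix.mul_assoc]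
    abel
  have hl : D₁ᵀ * T₁ * D₂ᵀ = fromBlocks ((CFC.sqrt S.R)ᵀ * T₁.toBlocks₂₂ * (CFC.sqrt S.V)ᵀ) 0 0 0 := by
    rw [hD₁, hD₂]
    conv_lhs => rw [← Matrix.fromBlocks_toBlocks T₁]
    simp [fromBlocks_transpose, fromBlocks_multiply]
  refine ⟨(CFC.sqrt S.R)ᵀ * T₁.toBlocks₂₂ * (CFC.sqrt S.V)ᵀ, ?_⟩
  rw [e, ← hl]
  have h1 := (hT₁.const_mul D₁ᵀ).mul_const D₂ᵀ
  have h2 := HasLeadMat.mul_sproper h12 (hT.mul_proper hp21)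
  have h3 := HasLeadMat.mul_sproper (hT₁.const_mul D₁ᵀ).sproper h21
  simpa using (h1.add h2).add h3

/-- The pairing of the closed loop with a direction, in terms of the search direction. -/
lemma h2Inner_deltaMap (hQ : S.Q.PosDef) (hR : S.R.PosDef) (hW : S.W.PosDef)
    (hV : S.V.PosDef) (hK : Stabilizes S K) {X H : Param q m₁ m₂} (hX : X ∈ paramSpace q m₁ m₂)
    (hH : H ∈ paramSpace q m₁ m₂) :
    h2Inner (closedMap S K X) (deltaMap S K H) = paramInner (halfGrad S K X) H := by
  obtain ⟨hS, hanti⟩ := searchDir_spec hQ hR hW hV hK hX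
  obtain ⟨L, hL⟩ := exists_hasLeadMat_rawGrad hK hX
  have hT := mem_RHinf0.1 (closedMap_mem hK hX)
  have hD := mem_RHinf0.1 (deltaMap_mem hK hH)
  have hS' := mem_RHinf0.1 hS
  have hH' := mem_RHinf0.1 hH.1
  set N := rawGrad S K X with hN
  set G := searchDir S K X with hG
  have hres : HasLeadMat G (G.map residueSum) := fun i j => by
    obtain ⟨c, hc⟩ := exists_hasLead (hS'.2 i j)
    rw [Matrix.map_apply, residueSum_eq (hS'.1 i j) hc]
    exact hc
  have hNreg : RegMat imAxis N := by
    have := hanti.axis'.add hS'.1.axis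
    rwa [sub_add_cancel] at this
  have hAs : SProperMat (N - G) := hL.sproper.sub hS'.2
  -- the algebraic identity
  have htr : (paraConj (closedMap S K X) * deltaMap S K H).trace =
      (paraConj G * H.1).trace + (paraConj (N - G) * H.1).trace +
        negVar (const (H.2)ᵀ * N).trace := by
    have e1 : paraConj (N - G) = paraConj N - paraConj G := by
      ext i j; exact map_sub negVar _ _
    have e2 : negVar (const (H.2)ᵀ * N).trace = (paraConj N * const H.2).trace := by
      have h1 : negVar (const (H.2)ᵀ * N).trace = (paraConj (const (H.2)ᵀ * N)).trace := by
        rw [Matrix.trace, map_sum]; rfl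
      rw [h1, paraConj_mul, paraConj_const, Matrix.transpose_transpose]
    have e3 : paraConj N = M21 S K * (paraConj (closedMap S K X) * M12 S K) := by
      rw [hN, rawGrad, paraConj_mul, paraConj_mul, paraConj_paraConj, paraConj_paraConj]
    rw [e2, e1, ← Matrix.trace_add, ← Matrix.trace_add, ← Matrix.add_mul, add_sub_cancel,
      ← Matrix.mul_add, e3, Matrix.mul_assoc, Matrix.trace_mul_comm (M21 S K), deltaMap,
      Param.toTransfer]
    simp only [Matrix.mul_assoc]
  have hw (w : ℝ) : ((w * Complex.I : ℂ)) ∈ imAxis := by simp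
  have hs1 := (hS'.1.axis.paraConj_axis.mul hH'.1.axis).trace
  have hs2 := ((hanti.axis'.paraConj_axis).mul hH'.1.axis).trace
  have hs3 := ((regMat_const (s := imAxis) (H.2)ᵀ).mul hNreg).trace
  have hi1 := integrable_re_trace hS'.1.axis hH'.1.axis hS'.2 hH'.2
  have hi2 := integrable_re_trace hanti.axis' hH'.1.axis hAs hH'.2
  -- the lead of the constant part
  have hlead0 : HasLead (const (H.2)ᵀ * N).trace 0 := by
    have := (hL.const_mul (H.2)ᵀ).trace
    have e : ((H.2)ᵀ * (fromBlocks L 0 0 0 : Matrix (Fin m₁ ⊕ Fin q) (Fin m₂ ⊕ Fin q) ℝ)).trace =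
        0 := by
      conv_lhs => rw [← Matrix.fromBlocks_toBlocks H.2, hH.2]
      rw [fromBlocks_transpose, fromBlocks_multiply, trace_fromBlocks]
      simp
    rwa [e] at this
  have hleadG := (hres.const_mul (H.2)ᵀ).trace
  have hsub : (const (H.2)ᵀ * N).trace = (const (H.2)ᵀ * G).trace + (const (H.2)ᵀ * (N - G)).trace := by
    rw [← Matrix.trace_add, ← Matrix.mul_add, add_sub_cancel]
  -- The whole of `N` pairs to leading coefficient zero with the constant part, so the antistable
  -- part carries minus the coefficient of the stable part.
  have hleadA : HasLead (const (H.2)ᵀ * (N - G)).trace (-((H.2)ᵀ * G.map residueSum).trace) := by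
    have := hlead0.sub hleadG
    rwa [hsub, add_sub_cancel_left, zero_sub] at this
  have hrG := ((regMat_const (s := rhp) (H.2)ᵀ).mul hS'.1).trace
  have hrA := ((regMat_const (s := lhp) (H.2)ᵀ).mul hanti).trace
  obtain ⟨hi3, hv3⟩ := integral_re_ev_axis hrG hleadG
  obtain ⟨hi4, hv4⟩ := integral_re_ev_axis_antistable hrA hleadA
  have hpt (w : ℝ) : (ev (w * Complex.I) (paraConj (closedMap S K X) * deltaMap S K H).trace).re =
      (ev (w * Complex.I) (paraConj G * H.1).trace).re +
      (ev (w * Complex.I) (paraConj (N - G) * H.1).trace).re +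
      ((ev (w * Complex.I) (const (H.2)ᵀ * G).trace).re +
      (ev (w * Complex.I) (const (H.2)ᵀ * (N - G)).trace).re) := by
    rw [htr, ev_add (hw w) (add_mem hs1 hs2) (negVar_imAxis hs3), ev_add (hw w) hs1 hs2,
      ev_negVar_axis hs3, hsub, ev_add (hw w) (regularOn_mono imAxis_subset_rhp hrG)
      (regularOn_mono imAxis_subset_lhp hrA)]
    simp
  -- The para-conjugate of the antistable part is stable, and its product with the strictly proper
  -- direction is of order s⁻², so Cauchy's theorem applies.
  have hz : ∫ w : ℝ, (ev (w * Complex.I) (paraConj (N - G) * H.1).trace).re = 0 := by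
    have h0 := trace_paraConj_mul_isO2 hAs hH'.2
    have hr := (hanti.paraConj_of_antistable.mul hH'.1).trace
    have hint := integrable_ev_axis (regularOn_mono imAxis_subset_rhp hr) h0
    have := integral_ev_axis_eq_zero hr h0
    have h2 := integral_re hint
    simp only [RCLike.re_eq_complex_re] at h2
    rw [h2, this, Complex.zero_re]
  have hi12 : Integrable fun w : ℝ => (ev (w * Complex.I) (paraConj G * H.1).trace).re +
      (ev (w * Complex.I) (paraConj (N - G) * H.1).trace).re := hi1.add hi2
  have hi34 : Integrable fun w : ℝ => (ev (w * Complex.I) (const (H.2)ᵀ * G).trace).re +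
      (ev (w * Complex.I) (const (H.2)ᵀ * (N - G)).trace).re := hi3.add hi4
  rw [h2Inner_eq hT.1.axis hD.1.axis]
  simp only [hpt]
  -- `hv3` and `hv4` give the same value, π times the residue pairing: the opposite leading
  -- coefficient is compensated by the opposite sign of the antistable formula. Together they cancel
  -- the normalization 1/(2π).
  rw [integral_add hi12 hi34, integral_add hi1 hi2, integral_add hi3 hi4, hz, hv3,
    hv4, paramInner, halfGrad, ← hG, h2Inner_eq hS'.1.axis hH'.1.axis,
    trace_transpose_mul_zeroBlock hH.2]
  have ht : ((G.map residueSum)ᵀ * H.2).trace = ((H.2)ᵀ * G.map residueSum).trace := by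
    rw [← Matrix.trace_transpose, Matrix.transpose_mul, Matrix.transpose_transpose]
  rw [ht]
  generalize (∫ w : ℝ, (ev (w * Complex.I) (paraConj G * H.1).trace).re) = I
  field_simp
  ring

/-! ### The parameter space -/

lemma zeroBlock_toBlocks₁₁ (D : Matrix (Fin m₁ ⊕ Fin q) (Fin m₂ ⊕ Fin q) ℝ) :
    (zeroBlock D).toBlocks₁₁ = 0 := by simp [zeroBlock]

/-- The parameter space as a linear space. -/
def paramSubmodule (q m₁ m₂ : ℕ) : Submodule ℝ (Param q m₁ m₂) where
  carrier := paramSpace q m₁ m₂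
  add_mem' {X Y} hX hY := ⟨(RHinf0Submodule _ _).add_mem hX.1 hY.1, by
    ext i j
    have h1 := congrFun (congrFun hX.2 i) j
    have h2 := congrFun (congrFun hY.2 i) j
    change X.2 (Sum.inl i) (Sum.inl j) + Y.2 (Sum.inl i) (Sum.inl j) = 0
    rw [show X.2 (Sum.inl i) (Sum.inl j) = 0 from h1, show Y.2 (Sum.inl i) (Sum.inl j) = 0 from h2,
      add_zero]⟩
  zero_mem' := ⟨(RHinf0Submodule _ _).zero_mem, rfl⟩
  smul_mem' c X hX := ⟨(RHinf0Submodule _ _).smul_mem c hX.1, by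
    ext i j
    have h1 := congrFun (congrFun hX.2 i) j
    change c * X.2 (Sum.inl i) (Sum.inl j) = 0
    rw [show X.2 (Sum.inl i) (Sum.inl j) = 0 from h1, mul_zero]⟩

lemma halfGrad_mem (hQ : S.Q.PosDef) (hR : S.R.PosDef) (hW : S.W.PosDef)
    (hV : S.V.PosDef) (hK : Stabilizes S K) {X : Param q m₁ m₂} (hX : X ∈ paramSpace q m₁ m₂) :
    halfGrad S K X ∈ paramSpace q m₁ m₂ :=
  ⟨(searchDir_spec hQ hR hW hV hK hX).1, zeroBlock_toBlocks₁₁ _⟩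

lemma paramInner_comm (X Y : Param q m₁ m₂) : paramInner X Y = paramInner Y X := by
  rw [paramInner, paramInner, h2Inner_comm, ← Matrix.trace_transpose, Matrix.transpose_mul,
    Matrix.transpose_transpose]

lemma paramInner_self_nonneg (X : Param q m₁ m₂) : 0 ≤ paramInner X X := by
  refine add_nonneg (h2NormSq_nonneg _) ?_
  have := Matrix.posSemidef_conjTranspose_mul_self X.2
  rw [Matrix.conjTranspose_eq_transpose_of_trivial] at this
  exact this.trace_nonneg

lemma paramNorm_sq (X : Param q m₁ m₂) : paramNorm X ^ 2 = paramInner X X :=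
  Real.sq_sqrt (paramInner_self_nonneg X)

lemma paramInner_add_right {X Y Z : Param q m₁ m₂} (hX : X ∈ paramSpace q m₁ m₂)
    (hY : Y ∈ paramSpace q m₁ m₂) (hZ : Z ∈ paramSpace q m₁ m₂) :
    paramInner X (Y + Z) = paramInner X Y + paramInner X Z := by
  simp only [paramInner, Prod.fst_add, Prod.snd_add, h2Inner_add_right hX.1 hY.1 hZ.1,
    Matrix.mul_add, Matrix.trace_add]
  ring

lemma paramInner_smul_right (c : ℝ) {X Y : Param q m₁ m₂} (hX : X ∈ paramSpace q m₁ m₂)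
    (hY : Y ∈ paramSpace q m₁ m₂) : paramInner X (c • Y) = c * paramInner X Y := by
  simp only [paramInner, Prod.smul_fst, Prod.smul_snd, h2Inner_smul_right c hX.1 hY.1,
    Matrix.mul_smul, Matrix.trace_smul, smul_eq_mul]
  ring

end Gradient

end LQG

end

noncomputable section

namespace LQG

/-! ### Bounds for the `H₂` norm -/

section Bounds

variable {ι κ μ : Type*} [Fintype ι] [Fintype κ] [Fintype μ]

/-- The squared Frobenius norm. -/
def froSq (A : Matrix ι κ ℂ) : ℝ := ∑ i, ∑ j, ‖A i j‖ ^ 2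

lemma froSq_nonneg (A : Matrix ι κ ℂ) : 0 ≤ froSq A :=
  Finset.sum_nonneg fun _ _ => Finset.sum_nonneg fun _ _ => sq_nonneg _

lemma re_trace_conjTranspose_mul_self (A : Matrix ι κ ℂ) : ((Aᴴ * A).trace).re = froSq A := by
  simp only [Matrix.trace, Matrix.diag_apply, Matrix.mul_apply, Matrix.conjTranspose_apply,
    Complex.re_sum, froSq]
  rw [Finset.sum_comm]
  refine Finset.sum_congr rfl fun i _ => Finset.sum_congr rfl fun j _ => ?_
  rw [Complex.star_def, ← Complex.normSq_eq_conj_mul_self, Complex.ofReal_re,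
    Complex.normSq_eq_norm_sq]

lemma froSq_mul_le (A : Matrix ι κ ℂ) (B : Matrix κ μ ℂ) :
    froSq (A * B) ≤ froSq A * froSq B := by
  have h (i : ι) (j : μ) :
      ‖(A * B) i j‖ ^ 2 ≤ (∑ k, ‖A i k‖ ^ 2) * ∑ k, ‖B k j‖ ^ 2 := by
    rw [Matrix.mul_apply]
    refine le_trans ?_ (Finset.sum_mul_sq_le_sq_mul_sq Finset.univ (fun k => ‖A i k‖) _)
    refine pow_le_pow_left₀ (norm_nonneg _) ((norm_sum_le _ _).trans (le_of_eq ?_)) 2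
    simp only [norm_mul]
  calc froSq (A * B) ≤ ∑ i, ∑ j, (∑ k, ‖A i k‖ ^ 2) * ∑ k, ‖B k j‖ ^ 2 :=
        Finset.sum_le_sum fun i _ => Finset.sum_le_sum fun j _ => h i j
    _ = froSq A * froSq B := by
        simp only [← Finset.mul_sum, ← Finset.sum_mul, froSq]
        rw [Finset.sum_comm (f := fun i j => ‖B i j‖ ^ 2)]

lemma h2NormSq_eq (G : Matrix ι κ (RatFunc ℝ)) :
    h2NormSq G = (2 * Real.pi)⁻¹ * ∫ w : ℝ, froSq (evalAt G (w * Complex.I)) := by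
  simp only [h2NormSq, h2Inner, re_trace_conjTranspose_mul_self]

lemma integrable_froSq {G : Matrix ι κ (RatFunc ℝ)} (hG : G ∈ RHinf0 ι κ) :
    Integrable fun w : ℝ => froSq (evalAt G (w * Complex.I)) := by
  have h := mem_RHinf0.1 hG
  have := integrable_re_trace h.1.axis h.1.axis h.2 h.2
  simpa only [← trace_evalAt_axis h.1.axis h.1.axis, re_trace_conjTranspose_mul_self] using this

lemma exists_froSq_bound {A : Matrix ι κ (RatFunc ℝ)} (hA : RegMat imAxis A) (hA' : ProperMat A) :
    ∃ C : ℝ, 0 ≤ C ∧ ∀ w : ℝ, froSq (evalAt A (w * Complex.I)) ≤ C := by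
  choose C hC0 hC using fun i j => exists_bound_ev_axis (hA i j) (hA' i j)
  refine ⟨∑ i, ∑ j, C i j ^ 2, Finset.sum_nonneg fun _ _ => Finset.sum_nonneg fun _ _ => sq_nonneg _,
    fun w => Finset.sum_le_sum fun i _ => Finset.sum_le_sum fun j _ =>
      pow_le_pow_left₀ (norm_nonneg _) (hC i j w) 2⟩

lemma h2NormSq_le_of_froSq_le {ι' κ' : Type*} [Fintype ι'] [Fintype κ']
    {G : Matrix ι κ (RatFunc ℝ)} {H : Matrix ι' κ' (RatFunc ℝ)}
    (hG : G ∈ RHinf0 ι κ) (hH : H ∈ RHinf0 ι' κ') {c : ℝ}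
    (h : ∀ w : ℝ, froSq (evalAt H (w * Complex.I)) ≤ c * froSq (evalAt G (w * Complex.I))) :
    h2NormSq H ≤ c * h2NormSq G := by
  rw [h2NormSq_eq, h2NormSq_eq, mul_left_comm, ← integral_const_mul c]
  exact mul_le_mul_of_nonneg_left
    (integral_mono (integrable_froSq hH) ((integrable_froSq hG).const_mul c) h) (by positivity)

lemma h2NormSq_mul_left_le {A : Matrix ι κ (RatFunc ℝ)} {G : Matrix κ μ (RatFunc ℝ)}
    (hA : RegMat rhp A) (hA' : ProperMat A) (hG : G ∈ RHinf0 κ μ) {c : ℝ}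
    (hc : ∀ w : ℝ, froSq (evalAt A (w * Complex.I)) ≤ c) :
    A * G ∈ RHinf0 ι μ ∧ h2NormSq (A * G) ≤ c * h2NormSq G := by
  have h := mem_RHinf0.1 hG
  have hm : A * G ∈ RHinf0 ι μ := mem_RHinf0.2 ⟨hA.mul h.1, hA'.mul_sproper h.2⟩
  refine ⟨hm, h2NormSq_le_of_froSq_le hG hm fun w => ?_⟩
  rw [evalAt_mul (s := imAxis) (by simp) hA.axis h.1.axis]
  exact (froSq_mul_le _ _).trans (mul_le_mul_of_nonneg_right (hc w) (froSq_nonneg _))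

lemma h2NormSq_mul_right_le {B : Matrix κ μ (RatFunc ℝ)} {G : Matrix ι κ (RatFunc ℝ)}
    (hB : RegMat rhp B) (hB' : ProperMat B) (hG : G ∈ RHinf0 ι κ) {c : ℝ}
    (hc : ∀ w : ℝ, froSq (evalAt B (w * Complex.I)) ≤ c) :
    G * B ∈ RHinf0 ι μ ∧ h2NormSq (G * B) ≤ c * h2NormSq G := by
  have h := mem_RHinf0.1 hG
  have hm : G * B ∈ RHinf0 ι μ := mem_RHinf0.2 ⟨h.1.mul hB, h.2.mul_proper hB'⟩
  refine ⟨hm, h2NormSq_le_of_froSq_le hG hm fun w => ?_⟩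
  rw [evalAt_mul (s := imAxis) (by simp) h.1.axis hB.axis, mul_comm c]
  exact (froSq_mul_le _ _).trans (mul_le_mul_of_nonneg_left (hc w) (froSq_nonneg _))

lemma h2NormSq_add_le {F G : Matrix ι κ (RatFunc ℝ)} (hF : F ∈ RHinf0 ι κ) (hG : G ∈ RHinf0 ι κ) :
    h2NormSq (F + G) ≤ 2 * (h2NormSq F + h2NormSq G) := by
  have hm := (RHinf0Submodule ι κ).add_mem hF hG
  rw [h2NormSq_eq, h2NormSq_eq, h2NormSq_eq, ← mul_add, mul_left_comm,
    ← integral_add (integrable_froSq hF) (integrable_froSq hG), ← integral_const_mul (2 : ℝ)]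
  refine mul_le_mul_of_nonneg_left (integral_mono (integrable_froSq hm)
    (((integrable_froSq hF).add (integrable_froSq hG)).const_mul 2) fun w => ?_) (by positivity)
  beta_reduce
  rw [evalAt_add (s := imAxis) (by simp) (mem_RHinf0.1 hF).1.axis (mem_RHinf0.1 hG).1.axis]
  simp only [froSq, ← Finset.sum_add_distrib, Finset.mul_sum, Matrix.add_apply]
  refine Finset.sum_le_sum fun i _ => Finset.sum_le_sum fun j _ => ?_
  have h1 := norm_add_le (evalAt F (w * Complex.I) i j) (evalAt G (w * Complex.I) i j)
  have h2 := pow_le_pow_left₀ (norm_nonneg _) h1 2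
  nlinarith [sq_nonneg (‖evalAt F (w * Complex.I) i j‖ - ‖evalAt G (w * Complex.I) i j‖)]

lemma froSq_evalAt_const (D : Matrix ι κ ℝ) (z : ℂ) : froSq (evalAt (const D) z) = (Dᵀ * D).trace := by
  simp only [Matrix.trace, Matrix.diag_apply, Matrix.mul_apply, Matrix.transpose_apply, froSq]
  rw [Finset.sum_comm]
  refine Finset.sum_congr rfl fun i _ => Finset.sum_congr rfl fun j _ => ?_
  rw [evalAt, Matrix.map_apply, const, Matrix.map_apply, RatFunc.eval_C]
  simp [sq]

end Bounds

/-! ### Smoothness -/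

section Smooth

variable {n m₁ m₂ q : ℕ} {S : Plant n m₁ m₂} {K : Controller q m₁ m₂}

lemma feedthrough_eq_zero {D : Matrix (Fin m₁ ⊕ Fin q) (Fin m₂ ⊕ Fin q) ℝ}
    (hD : D.toBlocks₁₁ = 0) (M : Matrix (Fin m₁) (Fin m₁) ℝ) (M' : Matrix (Fin m₂) (Fin m₂) ℝ) :
    (fromBlocks 0 0 M 0 : Matrix (Fin n ⊕ Fin m₁) (Fin m₁ ⊕ Fin q) ℝ) * D *
      (fromBlocks 0 M' 0 0 : Matrix (Fin m₂ ⊕ Fin q) (Fin n ⊕ Fin m₂) ℝ) = 0 := by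
  rw [← Matrix.fromBlocks_toBlocks D, hD, fromBlocks_multiply, fromBlocks_multiply]
  simp

/-- For the strictly proper part of the parameter, both outer factors are bounded on the axis. The
constant part is not square-integrable by itself, so its H₂ norm must come from the strictly proper
parts `N₁`, `N₂` of the outer factors, and the product of three feedthroughs vanishes. -/
lemma exists_deltaMap_bound (hK : Stabilizes S K) :
    ∃ c : ℝ, 0 ≤ c ∧ ∀ H ∈ paramSpace q m₁ m₂, h2NormSq (deltaMap S K H) ≤ c * paramInner H H := by
  have hA : Hurwitz (clA S K) := hK
  set D₁ : Matrix (Fin n ⊕ Fin m₁) (Fin m₁ ⊕ Fin q) ℝ := fromBlocks 0 0 (CFC.sqrt S.R) 0 with hD₁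
  set D₂ : Matrix (Fin m₂ ⊕ Fin q) (Fin n ⊕ Fin m₂) ℝ := fromBlocks 0 (CFC.sqrt S.V) 0 0 with hD₂
  set N₁ := transfer (clA S K) (extB S q) (clC S K) 0 with hN₁
  set N₂ := transfer (clA S K) (clB S K) (extC S q) 0 with hN₂
  have h1 : M12 S K = N₁ + const D₁ := by rw [M12, transfer, hN₁, transfer_zero]
  have h2 : M21 S K = N₂ + const D₂ := by rw [M21, transfer, hN₂, transfer_zero]
  have hm1 : N₁ ∈ RHinf0 _ _ := hA.transfer_mem _ _
  have hm2 : N₂ ∈ RHinf0 _ _ := hA.transfer_mem _ _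
  have hr1 := regMat_M12 hK
  have hr2 := regMat_M21 hK
  have hp1 : ProperMat (M12 S K) := properMat_transfer _ _ _ _
  have hp2 : ProperMat (M21 S K) := properMat_transfer _ _ _ _
  obtain ⟨a, ha0, ha⟩ := exists_froSq_bound hr1.axis hp1
  obtain ⟨b, hb0, hb⟩ := exists_froSq_bound hr2.axis hp2
  set d := (D₁ᵀ * D₁).trace with hd
  have hd0 : 0 ≤ d := by rw [hd, ← froSq_evalAt_const _ 0]; exact froSq_nonneg _
  have hn1 := h2NormSq_nonneg N₁
  have hn2 := h2NormSq_nonneg N₂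
  -- The factors 2 and 4 come from applying ‖F + G‖² ≤ 2(‖F‖² + ‖G‖²) once for the dynamic part and
  -- twice for the two constant terms.
  refine ⟨2 * (a * b) + 4 * (b * h2NormSq N₁ + d * h2NormSq N₂), by positivity, fun H hH => ?_⟩
  set f := (H.2ᵀ * H.2).trace with hf
  have hf0 : 0 ≤ f := by rw [hf, ← froSq_evalAt_const _ 0]; exact froSq_nonneg _
  have e : deltaMap S K H = M12 S K * H.1 * M21 S K +
      (N₁ * const H.2 * M21 S K + const D₁ * (const H.2 * N₂)) := by
    have h0 : const D₁ * (const H.2 * const D₂) = 0 := by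
      rw [← const_mul, ← const_mul, ← Matrix.mul_assoc, hD₁, hD₂, feedthrough_eq_zero hH.2,
        const_zero]
    have e1 : M12 S K * const H.2 * M21 S K =
        N₁ * const H.2 * M21 S K + const D₁ * (const H.2 * N₂) := by
      have e2 : const D₁ * (const H.2 * M21 S K) = const D₁ * (const H.2 * N₂) := by
        rw [h2, Matrix.mul_add, Matrix.mul_add, h0, add_zero]
      rw [h1, Matrix.add_mul, Matrix.add_mul, Matrix.mul_assoc (const D₁), e2]
    rw [deltaMap, Param.toTransfer, Matrix.mul_add, Matrix.add_mul, e1]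
  have b1 := h2NormSq_mul_left_le hr1 hp1 hH.1 ha
  have b2 := h2NormSq_mul_right_le hr2 hp2 b1.1 hb
  have b3 := h2NormSq_mul_right_le (c := f) (regMat_const H.2) (properMat_const H.2) hm1
    fun w => (froSq_evalAt_const _ _).le
  have b4 := h2NormSq_mul_right_le hr2 hp2 b3.1 hb
  have b5 := h2NormSq_mul_left_le (c := f) (regMat_const H.2) (properMat_const H.2) hm2
    fun w => (froSq_evalAt_const _ _).le
  have b6 := h2NormSq_mul_left_le (c := d) (regMat_const D₁) (properMat_const D₁) b5.1
    fun w => (froSq_evalAt_const _ _).le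
  have b7 := h2NormSq_add_le b4.1 b6.1
  have b8 := h2NormSq_add_le b2.1 ((RHinf0Submodule _ _).add_mem b4.1 b6.1)
  rw [e, show paramInner H H = h2NormSq H.1 + f from rfl]
  have hn := h2NormSq_nonneg H.1
  have c2 : h2NormSq (M12 S K * H.1 * M21 S K) ≤ b * (a * h2NormSq H.1) :=
    b2.2.trans (mul_le_mul_of_nonneg_left b1.2 hb0)
  have c4 : h2NormSq (N₁ * const H.2 * M21 S K) ≤ b * (f * h2NormSq N₁) :=
    b4.2.trans (mul_le_mul_of_nonneg_left b3.2 hb0)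
  have c6 : h2NormSq (const D₁ * (const H.2 * N₂)) ≤ d * (f * h2NormSq N₂) :=
    b6.2.trans (mul_le_mul_of_nonneg_left b5.2 hd0)
  have p1 : 0 ≤ (a * b) * f := by positivity
  have p2 : 0 ≤ (b * h2NormSq N₁ + d * h2NormSq N₂) * h2NormSq H.1 := by positivity
  nlinarith

lemma liftedCost_add_eq (hQ : S.Q.PosDef) (hR : S.R.PosDef) (hW : S.W.PosDef) (hV : S.V.PosDef)
    (hK : Stabilizes S K) {X H : Param q m₁ m₂} (hX : X ∈ paramSpace q m₁ m₂)
    (hH : H ∈ paramSpace q m₁ m₂) :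
    liftedCost S K (X + H) = liftedCost S K X + 2 * paramInner (halfGrad S K X) H +
      h2NormSq (deltaMap S K H) := by
  rw [liftedCost_add hK hX hH, h2Inner_deltaMap hQ hR hW hV hK hX hH]

lemma paramInner_smul_left (c : ℝ) {X Y : Param q m₁ m₂} (hX : X ∈ paramSpace q m₁ m₂)
    (hY : Y ∈ paramSpace q m₁ m₂) : paramInner (c • X) Y = c * paramInner X Y := by
  rw [paramInner_comm, paramInner_smul_right c hY hX, paramInner_comm]

lemma paramNorm_smul (c : ℝ) {X : Param q m₁ m₂} (hX : X ∈ paramSpace q m₁ m₂) :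
    paramNorm (c • X) = |c| * paramNorm X := by
  rw [paramNorm, paramInner_smul_left c hX ((paramSubmodule _ _ _).smul_mem c hX),
    paramInner_smul_right c hX hX, ← mul_assoc, ← sq, Real.sqrt_mul (sq_nonneg c),
    Real.sqrt_sq_eq_abs, paramNorm]

/-- The remainder of the expansion is exactly the quadratic term, bounded by c‖H‖², so the radius
ε/(c + 1) works. -/
lemma isGradient_two_smul_halfGrad (hQ : S.Q.PosDef) (hR : S.R.PosDef) (hW : S.W.PosDef)
    (hV : S.V.PosDef) (hK : Stabilizes S K) {X : Param q m₁ m₂} (hX : X ∈ paramSpace q m₁ m₂) :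
    IsGradient S K X ((2 : ℝ) • halfGrad S K X) := by
  have hg := halfGrad_mem hQ hR hW hV hK hX
  obtain ⟨c, hc0, hc⟩ := exists_deltaMap_bound hK
  refine ⟨(paramSubmodule _ _ _).smul_mem 2 hg, fun ε hε => ⟨ε / (c + 1), by positivity,
    fun H hH hle => ?_⟩⟩
  have hn : 0 ≤ paramNorm H := Real.sqrt_nonneg _
  rw [liftedCost_add_eq hQ hR hW hV hK hX hH, paramInner_smul_left 2 hg hH,
    show ∀ a b d : ℝ, a + b + d - a - b = d by intros; ring, abs_of_nonneg (h2NormSq_nonneg _)]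
  refine (hc H hH).trans ?_
  rw [← paramNorm_sq, sq, ← mul_assoc]
  refine mul_le_mul_of_nonneg_right ?_ hn
  rw [le_div_iff₀ (by positivity)] at hle
  nlinarith

/-- Comparison of the two expansions along t H for small t. This is needed because the definition of
smoothness supplies an unspecified gradient. Only the pairings matter, so definiteness of the inner
product plays no role. -/
lemma paramInner_eq_of_isGradient {X g g' : Param q m₁ m₂} (hg : IsGradient S K X g)
    (hg' : IsGradient S K X g') {H : Param q m₁ m₂} (hH : H ∈ paramSpace q m₁ m₂) :
    paramInner g H = paramInner g' H := by
  have hn : 0 ≤ paramNorm H := Real.sqrt_nonneg _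
  have key (ε : ℝ) (hε : 0 < ε) : |paramInner g H - paramInner g' H| ≤ 2 * ε * paramNorm H := by
    obtain ⟨δ, hδ, h⟩ := hg.2 ε hε
    obtain ⟨δ', hδ', h'⟩ := hg'.2 ε hε
    set t := min δ δ' / (paramNorm H + 1) with ht
    have htpos : 0 < t := by positivity
    have hmem := (paramSubmodule _ _ _).smul_mem t hH
    have htn : paramNorm (t • H) = t * paramNorm H := by
      rw [paramNorm_smul t hH, abs_of_pos htpos]
    have hle : paramNorm (t • H) ≤ min δ δ' := by
      rw [htn, ht, div_mul_eq_mul_div, div_le_iff₀ (by positivity)]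
      nlinarith [lt_min hδ hδ']
    have h1 := h _ hmem (hle.trans (min_le_left _ _))
    have h2 := h' _ hmem (hle.trans (min_le_right _ _))
    rw [htn, paramInner_smul_right t hg.1 hH] at h1
    rw [htn, paramInner_smul_right t hg'.1 hH] at h2
    rw [abs_le] at *
    constructor
    · by_contra hlt
      push Not at hlt
      nlinarith
    · by_contra hlt
      push Not at hlt
      nlinarith
  rw [← sub_eq_zero, ← abs_eq_zero]
  refine le_antisymm (le_of_forall_pos_le_add fun ε hε => ?_) (abs_nonneg _)
  have := key (ε / (2 * (paramNorm H + 1))) (by positivity)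
  refine this.trans ?_
  rw [zero_add, mul_div_assoc', mul_comm 2 ε, mul_comm 2 (paramNorm H + 1),
    mul_div_mul_right _ _ two_ne_zero, div_mul_eq_mul_div, div_le_iff₀ (by positivity)]
  nlinarith

lemma exists_smoothnessConstant (hQ : S.Q.PosDef) (hR : S.R.PosDef) (hW : S.W.PosDef)
    (hV : S.V.PosDef) (hK : Stabilizes S K) : ∃ L, IsSmoothnessConstant S K L := by
  obtain ⟨c, hc0, hc⟩ := exists_deltaMap_bound hK
  -- The bound `c` may be zero, and the added 1 keeps the constant positive.
  refine ⟨2 * c + 1, by positivity, fun X hX Y hY => ⟨_, isGradient_two_smul_halfGrad hQ hR hW hV hK hY, ?_⟩⟩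
  have hH : X - Y ∈ paramSpace q m₁ m₂ := (paramSubmodule _ _ _).sub_mem hX hY
  have h := liftedCost_add_eq hQ hR hW hV hK hY hH
  rw [add_sub_cancel] at h
  rw [h, paramInner_smul_left 2 (halfGrad_mem hQ hR hW hV hK hY) hH, paramNorm_sq]
  have := hc _ hH
  have := paramInner_self_nonneg (X - Y)
  linarith

/-- At base point 0 the smoothness inequality and the exact expansion differ only in the quadratic
term, so every admissible `L` controls it. -/
lemma IsSmoothnessConstant.deltaMap_le {L : ℝ} (hL : IsSmoothnessConstant S K L) (hQ : S.Q.PosDef)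
    (hR : S.R.PosDef) (hW : S.W.PosDef) (hV : S.V.PosDef) (hK : Stabilizes S K) {H : Param q m₁ m₂}
    (hH : H ∈ paramSpace q m₁ m₂) :
    h2NormSq (deltaMap S K H) ≤ L / 2 * paramInner H H := by
  have h0 : (0 : Param q m₁ m₂) ∈ paramSpace q m₁ m₂ := (paramSubmodule _ _ _).zero_mem
  obtain ⟨g, hg, h⟩ := hL.2 H hH 0 h0
  have h1 := liftedCost_add_eq hQ hR hW hV hK h0 hH
  have h2 := paramInner_eq_of_isGradient hg (isGradient_two_smul_halfGrad hQ hR hW hV hK h0) hH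
  rw [paramInner_smul_left 2 (halfGrad_mem hQ hR hW hV hK h0) hH] at h2
  rw [sub_zero, paramNorm_sq, h2] at h
  rw [zero_add] at h1
  linarith

/-! ### Convergence of the algorithm -/

lemma iterates_succ (η : ℝ) (k : ℕ) : iterates S K η (k + 1) =
    iterates S K η k + (-η) • halfGrad S K (iterates S K η k) := by
  rw [iterates, halfGrad]
  ext1 <;> simp [sub_eq_add_neg]

lemma iterates_mem (hQ : S.Q.PosDef) (hR : S.R.PosDef) (hW : S.W.PosDef)
    (hV : S.V.PosDef) (hK : Stabilizes S K) (η : ℝ) (k : ℕ) :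
    iterates S K η k ∈ paramSpace q m₁ m₂ := by
  induction k with
  | zero => exact (paramSubmodule _ _ _).zero_mem
  | succ k ih =>
    rw [iterates_succ]
    exact (paramSubmodule _ _ _).add_mem ih
      ((paramSubmodule _ _ _).smul_mem _ (halfGrad_mem hQ hR hW hV hK ih))

/-- With h = `halfGrad` X the expansion gives J(X⁺) ≤ J(X) - η(2 - ηL/2)‖h‖², and ηL < 2 makes the
bracket at least 1. -/
lemma descent {L η : ℝ} (hL : IsSmoothnessConstant S K L) (hη : 0 < η) (hηL : η < 2 / L)
    (hQ : S.Q.PosDef) (hR : S.R.PosDef) (hW : S.W.PosDef) (hV : S.V.PosDef) (hK : Stabilizes S K)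
    {X : Param q m₁ m₂} (hX : X ∈ paramSpace q m₁ m₂) :
    liftedCost S K (X + (-η) • halfGrad S K X) ≤
      liftedCost S K X - η * paramInner (halfGrad S K X) (halfGrad S K X) := by
  have hg := halfGrad_mem hQ hR hW hV hK hX
  have hm := (paramSubmodule _ _ _).smul_mem (-η) hg
  have h1 := liftedCost_add_eq hQ hR hW hV hK hX hm
  have h2 := hL.deltaMap_le hQ hR hW hV hK hm
  rw [paramInner_smul_left (-η) hg hm] at h2
  rw [paramInner_smul_right (-η) hg hg] at h1 h2
  have h3 := paramInner_self_nonneg (halfGrad S K X)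
  rw [lt_div_iff₀ hL.1] at hηL
  have h4 : 0 ≤ η * (2 - η * L) * paramInner (halfGrad S K X) (halfGrad S K X) :=
    mul_nonneg (mul_nonneg hη.le (by linarith)) h3
  nlinarith

lemma paramInner_add_self {X Y : Param q m₁ m₂} (hX : X ∈ paramSpace q m₁ m₂)
    (hY : Y ∈ paramSpace q m₁ m₂) : paramInner (X + Y) (X + Y) =
      paramInner X X + 2 * paramInner X Y + paramInner Y Y := by
  have hs := (paramSubmodule _ _ _).add_mem hX hY
  have h1 := paramInner_add_right hs hX hY
  have h2 := paramInner_add_right hX hX hY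
  have h3 := paramInner_add_right hY hX hY
  rw [paramInner_comm X (X + Y)] at h2
  rw [paramInner_comm Y (X + Y), paramInner_comm Y X] at h3
  rw [h1]
  linarith

/-- Expanding the square gives ‖X - Y‖² - 2η⟨h, X - Y⟩ + η²‖h‖². Convexity bounds 2⟨h, X - Y⟩ below
by J(X) - J(Y), and `descent` bounds η‖h‖² by J(X) - J(X⁺). -/
lemma distance_decrease {L η : ℝ} (hL : IsSmoothnessConstant S K L) (hη : 0 < η) (hηL : η < 2 / L)
    (hQ : S.Q.PosDef) (hR : S.R.PosDef) (hW : S.W.PosDef) (hV : S.V.PosDef) (hK : Stabilizes S K)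
    {X Y : Param q m₁ m₂} (hX : X ∈ paramSpace q m₁ m₂) (hY : Y ∈ paramSpace q m₁ m₂) :
    paramInner (X + (-η) • halfGrad S K X - Y) (X + (-η) • halfGrad S K X - Y) ≤
      paramInner (X - Y) (X - Y) -
        η * (liftedCost S K (X + (-η) • halfGrad S K X) - liftedCost S K Y) := by
  have hg := halfGrad_mem hQ hR hW hV hK hX
  have hm := (paramSubmodule _ _ _).smul_mem (-η) hg
  have hYX : Y - X ∈ paramSpace q m₁ m₂ := (paramSubmodule _ _ _).sub_mem hY hX
  have hXY : X - Y ∈ paramSpace q m₁ m₂ := (paramSubmodule _ _ _).sub_mem hX hY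
  have h1 := descent hL hη hηL hQ hR hW hV hK hX
  have h2 := liftedCost_add_eq hQ hR hW hV hK hX hYX
  rw [add_sub_cancel] at h2
  have h3 := h2NormSq_nonneg (deltaMap S K (Y - X))
  have e : Y - X = (-1 : ℝ) • (X - Y) := by rw [neg_smul, one_smul, neg_sub]
  rw [e, paramInner_smul_right _ hg hXY] at h2
  rw [e] at h3
  have e2 : X + (-η) • halfGrad S K X - Y = (X - Y) + (-η) • halfGrad S K X := by abel
  rw [e2, paramInner_add_self hXY hm, paramInner_smul_right _ hXY hg, paramInner_smul_left _ hg hm,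
    paramInner_smul_right _ hg hg, paramInner_comm (X - Y) (halfGrad S K X)]
  nlinarith

/-- Telescoping: since `a` decreases, each step lowers `d` by enough to pay for the growth of η k
a(k). -/
lemma sublinear_of_decrease {a d : ℕ → ℝ} {η : ℝ} (hη : 0 < η) (ha : Antitone a)
    (hd : ∀ k, 0 ≤ d k) (h : ∀ k, d (k + 1) ≤ d k - η * a (k + 1)) (k : ℕ) :
    k * a k ≤ d 0 / η := by
  have key (k : ℕ) : d k + η * (k * a k) ≤ d 0 := by
    induction k with
    | zero => simp
    | succ k ih =>
      have h1 := h k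
      have h2 := ha (Nat.le_succ k)
      have h3 : η * (k * a (k + 1)) ≤ η * (k * a k) := by gcongr
      push_cast
      nlinarith
  rw [le_div_iff₀ hη]
  nlinarith [key k, hd k]

/-- The algorithm converges sublinearly to the cost of any minimizer. -/
lemma sublinear_convergence {L η : ℝ} (hL : IsSmoothnessConstant S K L) (hη : 0 < η)
    (hηL : η < 2 / L) (hQ : S.Q.PosDef) (hR : S.R.PosDef) (hW : S.W.PosDef) (hV : S.V.PosDef)
    (hK : Stabilizes S K) {Y : Param q m₁ m₂} (hY : Y ∈ paramSpace q m₁ m₂)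
    (hmin : ∀ X ∈ paramSpace q m₁ m₂, liftedCost S K Y ≤ liftedCost S K X) :
    Tendsto (fun k => liftedCost S K (iterates S K η k)) atTop (𝓝 (liftedCost S K Y)) ∧
      ∃ c : ℝ, ∀ k : ℕ, 1 ≤ k →
        liftedCost S K (iterates S K η k) - liftedCost S K Y ≤ c / k := by
  have hmem := iterates_mem hQ hR hW hV hK η
  have hk (k : ℕ) : k * (liftedCost S K (iterates S K η k) - liftedCost S K Y) ≤
      paramInner (iterates S K η 0 - Y) (iterates S K η 0 - Y) / η := by
    refine sublinear_of_decrease (a := fun k => liftedCost S K (iterates S K η k) - liftedCost S K Y)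
      (d := fun k => paramInner (iterates S K η k - Y) (iterates S K η k - Y)) hη
      (antitone_nat_of_succ_le fun k => ?_) (fun k => paramInner_self_nonneg _) (fun k => ?_) k
    · have h1 := descent hL hη hηL hQ hR hW hV hK (hmem k)
      have h2 := paramInner_self_nonneg (halfGrad S K (iterates S K η k))
      rw [iterates_succ]
      nlinarith
    · have := distance_decrease hL hη hηL hQ hR hW hV hK (hmem k) hY
      rwa [← iterates_succ] at this
  set c := paramInner (iterates S K η 0 - Y) (iterates S K η 0 - Y) / η with hc
  have hbound (k : ℕ) (h1 : 1 ≤ k) :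
      liftedCost S K (iterates S K η k) - liftedCost S K Y ≤ c / k := by
    rw [le_div_iff₀ (by exact_mod_cast h1), mul_comm]
    exact hk k
  refine ⟨?_, c, hbound⟩
  have hlim : Tendsto (fun k : ℕ => liftedCost S K Y + c / k) atTop (𝓝 (liftedCost S K Y)) := by
    simpa using (tendsto_const_div_atTop_nhds_zero_nat c).const_add (liftedCost S K Y)
  refine tendsto_of_tendsto_of_tendsto_of_le_of_le' tendsto_const_nhds hlim
    (Eventually.of_forall fun k => hmin _ (hmem k)) ?_
  filter_upwards [eventually_ge_atTop 1] with k h1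
  linarith [hbound k h1]

end Smooth

end LQG

end

noncomputable section

namespace LQG

/-! ### Linear differential equations with additive forcing -/

section Flow

variable {σ : Type*} [Fintype σ] [DecidableEq σ]

/-- The matrix exponential `e^{tA}`. -/
def flow (A : Matrix σ σ ℝ) (t : ℝ) : Matrix σ σ ℝ := NormedSpace.exp (t • A)

section

attribute [local instance] Matrix.linftyOpNormedRing Matrix.linftyOpNormedAlgebra

lemma hasDerivAt_flow (A : Matrix σ σ ℝ) (t : ℝ) (i j : σ) :
    HasDerivAt (fun t => flow A t i j) ((A * flow A t) i j) t := by
  have h := hasDerivAt_exp_smul_const' A t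
  exact ((Matrix.entryLinearMap ℝ ℝ i j).toContinuousLinearMap.hasFDerivAt).comp_hasDerivAt t h

lemma flow_commute (A : Matrix σ σ ℝ) (t : ℝ) : flow A t * A = A * flow A t :=
  (((Commute.refl A).smul_left t).exp_left).eq

lemma flow_mul_flow_neg (A : Matrix σ σ ℝ) (t : ℝ) : flow A t * flow A (-t) = 1 := by
  have h := NormedSpace.exp_add_of_commute (((Commute.refl A).smul_left t).smul_right (-t))
  rw [neg_smul, add_neg_cancel, NormedSpace.exp_zero] at h
  rw [flow, flow, neg_smul]
  exact h.symm

end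

lemma flow_zero (A : Matrix σ σ ℝ) : flow A 0 = 1 := by
  rw [flow, zero_smul, NormedSpace.exp_zero]

lemma continuous_flow (A : Matrix σ σ ℝ) (i j : σ) : Continuous fun t => flow A t i j :=
  continuous_iff_continuousAt.2 fun t => (hasDerivAt_flow A t i j).continuousAt

variable {H : Type*} [AddCommGroup H] [Module ℝ H]

/-- A real matrix acting on tuples of vectors. -/
def act {ι : Type*} (M : Matrix ι σ ℝ) (x : σ → H) (i : ι) : H := ∑ j, M i j • x j

lemma act_add {ι : Type*} (M : Matrix ι σ ℝ) (x y : σ → H) : act M (x + y) = act M x + act M y := by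
  ext i
  simp [act, Finset.sum_add_distrib]

lemma act_one (x : σ → H) : act 1 x = x := by
  ext i
  simp [act, Matrix.one_apply]

lemma act_mul {ι τ : Type*} [Fintype τ] (M : Matrix ι τ ℝ) (N : Matrix τ σ ℝ) (x : σ → H) :
    act (M * N) x = act M (act N x) := by
  ext i
  simp only [act, Matrix.mul_apply, Finset.sum_smul, Finset.smul_sum, smul_smul]
  exact Finset.sum_comm

lemma act_real {ι : Type*} (M : Matrix ι σ ℝ) (x : σ → ℝ) : act M x = M *ᵥ x := by
  ext i
  simp [act, Matrix.mulVec, dotProduct]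

end Flow

/-! ### Variation of constants and uniqueness -/

section Forced

variable {σ : Type*} [Fintype σ] [DecidableEq σ] {H : Type*} [NormedAddCommGroup H]
  [NormedSpace ℝ H] (A : Matrix σ σ ℝ) (g : ℝ → σ → H)

/-- The integral part `∫₀ᵗ e^{(t-r)A} A g(r) dr` of the solution of `x' = A x + g'`, `x(0) = g(0)`. -/
def drift (t : ℝ) : σ → H :=
  act (flow A t) fun i => ∫ r in (0 : ℝ)..t, act (flow A (-r) * A) (g r) i

/-- The solution of `x(t) = g(t) + ∫₀ᵗ A x(s) ds`. -/
def forced (t : ℝ) : σ → H := g t + drift A g t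

variable {A g}

lemma continuous_act_flow (hg : ∀ i, Continuous fun t => g t i) (i : σ) :
    Continuous fun r => act (flow A (-r) * A) (g r) i := by
  unfold act
  simp only [Matrix.mul_apply]
  exact continuous_finsetSum _ fun j _ => (continuous_finsetSum _ fun k _ =>
    ((continuous_flow A i k).comp continuous_neg).mul continuous_const).smul (hg j)

lemma drift_zero : drift A g 0 = 0 := by
  ext i
  simp [drift, act]

lemma hasDerivAt_act_flow (x : σ → H) (t : ℝ) (i : σ) :
    HasDerivAt (fun t => act (flow A t) x i) (act A (act (flow A t) x) i) t := by
  rw [← act_mul]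
  exact HasDerivAt.fun_sum fun j _ => (hasDerivAt_flow A t i j).smul_const (x j)

/-- Product rule: the upper limit contributes `A g(t)` because the two flows cancel, and the outer
flow contributes `A` times the drift. Only the drift is differentiated, never `g`, which for noise
is merely continuous. -/
lemma hasDerivAt_drift [CompleteSpace H] (hg : ∀ i, Continuous fun t => g t i) (t : ℝ) (i : σ) :
    HasDerivAt (fun t => drift A g t i) (act A (forced A g t) i) t := by
  have h (j : σ) : HasDerivAt (fun t => flow A t i j • ∫ r in (0 : ℝ)..t, act (flow A (-r) * A) (g r) j)
      (flow A t i j • act (flow A (-t) * A) (g t) j +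
        (A * flow A t) i j • ∫ r in (0 : ℝ)..t, act (flow A (-r) * A) (g r) j) t :=
    (hasDerivAt_flow A t i j).smul (intervalIntegral.integral_hasDerivAt_right
      ((continuous_act_flow hg j).intervalIntegrable _ _)
      ((continuous_act_flow hg j).stronglyMeasurableAtFilter _ _) (continuous_act_flow hg j).continuousAt)
  refine (HasDerivAt.fun_sum fun j (_ : j ∈ Finset.univ) => h j).congr_deriv ?_
  rw [Finset.sum_add_distrib, forced, act_add, Pi.add_apply]
  congr 1
  · change act (flow A t) (act (flow A (-t) * A) (g t)) i = _
    rw [← act_mul, ← Matrix.mul_assoc, flow_mul_flow_neg, Matrix.one_mul]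
  · rw [drift, ← act_mul]
    rfl

lemma continuous_forced [CompleteSpace H] (hg : ∀ i, Continuous fun t => g t i) (i : σ) :
    Continuous fun t => forced A g t i :=
  (hg i).add (continuous_iff_continuousAt.2 fun t => (hasDerivAt_drift hg t i).continuousAt)

lemma continuous_act {ι : Type*} (M : Matrix ι σ ℝ) (hg : ∀ i, Continuous fun t => g t i) (i : ι) :
    Continuous fun t => act M (g t) i :=
  continuous_finsetSum _ fun j _ => (hg j).const_smul _

/-- Uniqueness for linear differential equations. -/
lemma eq_flow_of_integral_eq {y : ℝ → σ → ℝ} (hy : ∀ i, ContinuousOn (fun t => y t i) (Set.Ici 0))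
    (h : ∀ t, 0 ≤ t → ∀ i, y t i = y 0 i + ∫ s in (0 : ℝ)..t, act A (y s) i) {t : ℝ} (ht : 0 ≤ t) :
    y t = act (flow A t) (y 0) := by
  -- The path is frozen at its initial value for negative times, so that the integrand is continuous
  -- on the line and two-sided derivatives exist at 0.
  set u : ℝ → σ → ℝ := fun t => y (max t 0) with hu
  have hmax (t : ℝ) : max t 0 ∈ Set.Ici (0 : ℝ) := Set.mem_Ici.2 (le_max_right _ _)
  have hcu (i : σ) : Continuous fun t => u t i :=
    (hy i).comp_continuous (continuous_id.max continuous_const) hmax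
  set Y : ℝ → σ → ℝ := fun t i => y 0 i + ∫ s in (0 : ℝ)..t, act A (u s) i with hY
  have hYd (t : ℝ) (i : σ) : HasDerivAt (fun t => Y t i) (act A (u t) i) t :=
    (intervalIntegral.integral_hasDerivAt_right ((continuous_act A hcu i).intervalIntegrable _ _)
      ((continuous_act A hcu i).stronglyMeasurableAtFilter _ _)
      (continuous_act A hcu i).continuousAt).const_add _
  have hYy (t : ℝ) (ht : 0 ≤ t) : Y t = y t := by
    ext i
    rw [h t ht i, hY]
    simp only [add_right_inj]
    refine intervalIntegral.integral_congr fun s hs => ?_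
    rw [Set.uIcc_of_le ht] at hs
    simp only [hu, max_eq_left hs.1]
  have huY (t : ℝ) (ht : 0 ≤ t) : u t = Y t := by rw [hYy t ht, hu]; simp only [max_eq_left ht]
  -- Integrating factor: e^{-tA} Y(t) has zero derivative for t ≥ 0, where `u` and `Y` agree.
  have hz (i : σ) (t : ℝ) : HasDerivAt (fun t => act (flow A (-t)) (Y t) i)
      (act (flow A (-t)) (act A (u t)) i - act (flow A (-t) * A) (Y t) i) t := by
    have hn (j : σ) : HasDerivAt (fun t => flow A (-t) i j) (-(flow A (-t) * A) i j) t := by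
      rw [flow_commute]
      exact ((hasDerivAt_flow A (-t) i j).scomp t (hasDerivAt_neg t)).congr_deriv (by simp)
    refine (HasDerivAt.fun_sum fun j (_ : j ∈ Finset.univ) => (hn j).smul (hYd t j)).congr_deriv ?_
    rw [Finset.sum_add_distrib, sub_eq_add_neg]
    simp [act]
  have hconst : act (flow A (-t)) (Y t) = y 0 := by
    ext i
    have := constant_of_has_deriv_right_zero (f := fun t => act (flow A (-t)) (Y t) i) (a := 0) (b := t)
      (fun s _ => (hz i s).continuousAt.continuousWithinAt) (fun s hs => by
        have := (hz i s).hasDerivWithinAt (s := Set.Ici s)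
        rwa [huY s hs.1, ← act_mul, sub_self] at this) t ⟨ht, le_rfl⟩
    rw [this, neg_zero, flow_zero, act_one, hYy 0 le_rfl]
  rw [← hconst, ← act_mul, flow_mul_flow_neg, act_one, hYy t ht]

end Forced

/-! ### Second moments -/

section Energy

variable {σ : Type*} [Fintype σ] [DecidableEq σ] {H : Type*} [NormedAddCommGroup H]
  [InnerProductSpace ℝ H]

/-- The bilinear form `∑ᵢⱼ Nᵢⱼ ⟨xᵢ, yⱼ⟩`. -/
def bil (N : Matrix σ σ ℝ) (x y : σ → H) : ℝ := ∑ i, inner ℝ (x i) (act N y i)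

lemma bil_eq_sum (N : Matrix σ σ ℝ) (x y : σ → H) :
    bil N x y = ∑ i, ∑ j, N i j * inner ℝ (x i) (y j) := by
  simp only [bil, act, inner_sum, real_inner_smul_right]

lemma bil_comm (N : Matrix σ σ ℝ) (x y : σ → H) : bil N x y = bil Nᵀ y x := by
  rw [bil_eq_sum, bil_eq_sum, Finset.sum_comm]
  simp only [Matrix.transpose_apply, real_inner_comm]

lemma bil_add_left (N : Matrix σ σ ℝ) (x x' y : σ → H) : bil N (x + x') y = bil N x y + bil N x' y := by
  simp [bil, inner_add_left, Finset.sum_add_distrib]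

lemma bil_add_right (N : Matrix σ σ ℝ) (x y y' : σ → H) : bil N x (y + y') = bil N x y + bil N x y' := by
  simp [bil, act_add, inner_add_right, Finset.sum_add_distrib]

lemma bil_smul_left (N : Matrix σ σ ℝ) (c : ℝ) (x y : σ → H) : bil N (c • x) y = c * bil N x y := by
  simp [bil, real_inner_smul_left, Finset.mul_sum]

lemma bil_smul_right (N : Matrix σ σ ℝ) (c : ℝ) (x y : σ → H) : bil N x (c • y) = c * bil N x y := by
  rw [bil_comm, bil_smul_left, ← bil_comm]

lemma bil_add_matrix (N N' : Matrix σ σ ℝ) (x y : σ → H) :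
    bil (N + N') x y = bil N x y + bil N' x y := by
  simp only [bil_eq_sum, Matrix.add_apply, add_mul, Finset.sum_add_distrib]

lemma bil_neg_matrix (N : Matrix σ σ ℝ) (x y : σ → H) : bil (-N) x y = -bil N x y := by
  simp only [bil_eq_sum, Matrix.neg_apply, neg_mul, Finset.sum_neg_distrib]

lemma bil_act_right (N M : Matrix σ σ ℝ) (x y : σ → H) : bil N x (act M y) = bil (N * M) x y := by
  simp only [bil, act_mul]

lemma bil_nonneg {N : Matrix σ σ ℝ} (hN : N.PosSemidef) (x : σ → H) : 0 ≤ bil N x x := by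
  have h : bil N x x = ∑ i, inner ℝ (act (CFC.sqrt N) x i) (act (CFC.sqrt N) x i) := by
    calc bil N x x = bil (CFC.sqrt N) x (act (CFC.sqrt N) x) := by
          rw [bil_act_right, sqrt_mul_sqrt hN]
      _ = bil (CFC.sqrt N)ᵀ (act (CFC.sqrt N) x) x := bil_comm _ _ _
      _ = _ := by rw [sqrt_transpose, bil]
  rw [h]
  exact Finset.sum_nonneg fun i _ => real_inner_self_nonneg

/-- `2 ⟨x, P A x⟩ = -⟨x, M x⟩` if `Aᵀ P + P A = -M`. -/
lemma two_mul_bil_lyapunov {A P M : Matrix σ σ ℝ} (hP : Pᵀ = P) (h : Aᵀ * P + P * A = -M)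
    (x : σ → H) : 2 * bil P x (act A x) = -bil M x x := by
  have h1 : bil (P * A) x x = bil (Aᵀ * P) x x := by
    rw [bil_comm, Matrix.transpose_mul, hP]
  rw [bil_act_right, ← bil_neg_matrix, ← h, bil_add_matrix, ← h1]
  ring

lemma exists_bil_le (N : Matrix σ σ ℝ) : ∃ k, 0 < k ∧ ∀ x : σ → H, bil N x x ≤ k * bil 1 x x := by
  refine ⟨1 + ∑ i, ∑ j, |N i j|, by positivity, fun x => ?_⟩
  have h1 : bil 1 x x = ∑ i, ‖x i‖ ^ 2 := by
    simp only [bil, act_one, real_inner_self_eq_norm_sq]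
  have hle (i : σ) : ‖x i‖ ^ 2 ≤ bil 1 x x := by
    rw [h1]
    exact Finset.single_le_sum (f := fun i => ‖x i‖ ^ 2) (fun _ _ => sq_nonneg _) (Finset.mem_univ i)
  have h0 : 0 ≤ bil 1 x x := by rw [h1]; positivity
  rw [bil_eq_sum, add_mul, one_mul, Finset.sum_mul]
  refine (Finset.sum_le_sum fun i _ => ?_).trans (le_add_of_nonneg_left h0)
  rw [Finset.sum_mul]
  refine Finset.sum_le_sum fun j _ => ?_
  calc N i j * inner ℝ (x i) (x j) ≤ |N i j| * |inner ℝ (x i) (x j)| := by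
        rw [← abs_mul]; exact le_abs_self _
    _ ≤ |N i j| * bil 1 x x := by
        gcongr
        refine (abs_real_inner_le_norm _ _).trans ?_
        nlinarith [hle i, hle j, sq_nonneg (‖x i‖ - ‖x j‖)]

lemma hasDerivAt_bil {N : Matrix σ σ ℝ} {x y : ℝ → σ → H} {x' y' : σ → H} {t : ℝ}
    (hx : ∀ i, HasDerivAt (fun t => x t i) (x' i) t) (hy : ∀ i, HasDerivAt (fun t => y t i) (y' i) t) :
    HasDerivAt (fun t => bil N (x t) (y t)) (bil N (x t) y' + bil N x' (y t)) t := by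
  simp only [bil_eq_sum]
  refine (HasDerivAt.fun_sum fun i (_ : i ∈ Finset.univ) => HasDerivAt.fun_sum fun j
    (_ : j ∈ Finset.univ) => (HasDerivAt.inner ℝ (hx i) (hy j)).const_mul (N i j)).congr_deriv ?_
  simp only [mul_add, Finset.sum_add_distrib]

lemma continuous_bil {N : Matrix σ σ ℝ} {x y : ℝ → σ → H} (hx : ∀ i, Continuous fun t => x t i)
    (hy : ∀ i, Continuous fun t => y t i) : Continuous fun t => bil N (x t) (y t) := by
  simp only [bil_eq_sum]
  exact continuous_finsetSum _ fun i _ => continuous_finsetSum _ fun j _ =>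
    ((hx i).inner (hy j)).const_mul _

variable [CompleteSpace H] {A Γ P M : Matrix σ σ ℝ} {g : ℝ → σ → H}

/-- `g` has the second moments of a Wiener process with intensity `Γ`. -/
def IsWhite (Γ : Matrix σ σ ℝ) (g : ℝ → σ → H) : Prop :=
  ∀ r t, 0 ≤ r → r ≤ t → ∀ i j, inner ℝ (g r i) (g t j) = r * Γ i j

/-- Increments after time s are orthogonal to g(r) for all r ≤ s, hence to the state at s, which is
built linearly from these values. -/
lemma IsWhite.inner_forced (hg : ∀ i, Continuous fun t => g t i) (h : IsWhite Γ g) {s t : ℝ} (hs : 0 ≤ s) (hst : s ≤ t) (i j : σ) :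
    inner ℝ (g t i) (forced A g s j) = inner ℝ (g s i) (forced A g s j) := by
  have h1 (r : ℝ) (h0 : 0 ≤ r) (hr : r ≤ s) (k : σ) : inner ℝ (g t i - g s i) (g r k) = 0 := by
    rw [inner_sub_left, real_inner_comm, h r t h0 (hr.trans hst), real_inner_comm, h r s h0 hr, sub_self]
  rw [← sub_eq_zero, ← inner_sub_left, forced, Pi.add_apply, inner_add_right, h1 s hs le_rfl, zero_add,
    drift, act, inner_sum]
  refine Finset.sum_eq_zero fun k _ => ?_
  rw [real_inner_smul_right, ← innerSL_apply_apply ℝ,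
    ← ContinuousLinearMap.intervalIntegral_comp_comm _ ((continuous_act_flow hg k).intervalIntegrable _ _)]
  rw [intervalIntegral.integral_congr (g := fun _ => (0 : ℝ)), intervalIntegral.integral_zero, mul_zero]
  intro r hr
  rw [Set.uIcc_of_le hs] at hr
  simp only [innerSL_apply_apply, act, inner_sum, real_inner_smul_right, h1 r hr.1 hr.2, mul_zero,
    Finset.sum_const_zero]

lemma bil_trace_of_white (hΓ : IsWhite Γ g) {t : ℝ} (ht : 0 ≤ t) :
    bil P (g t) (g t) = t * (P * Γᵀ).trace := by
  simp only [bil_eq_sum, hΓ t t ht le_rfl, Matrix.trace, Matrix.diag, Matrix.mul_apply,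
    Matrix.transpose_apply, Finset.mul_sum]
  exact Finset.sum_congr rfl fun i _ => Finset.sum_congr rfl fun j _ => by ring

/-- The energy balance of a linear system driven by white noise. -/
lemma IsWhite.energy (hg : ∀ i, Continuous fun t => g t i) (h : IsWhite Γ g) (hΓ : Γᵀ = Γ)
    (hP : Pᵀ = P) (hM : Aᵀ * P + P * A = -M) {t : ℝ} (ht : 0 ≤ t) :
    bil P (forced A g t) (forced A g t) =
      t * (P * Γ).trace - ∫ s in (0 : ℝ)..t, bil M (forced A g s) (forced A g s) := by
  have hf := continuous_forced (A := A) hg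
  have hd := hasDerivAt_drift (A := A) hg
  have hdc (i : σ) : Continuous fun t => drift A g t i :=
    continuous_iff_continuousAt.2 fun t => (hd t i).continuousAt
  have haf := fun i => continuous_act A hf i
  -- Here `g t` is frozen while the drift is differentiated in s. Orthogonality of increments then
  -- replaces `g t` by `g s` under the integral.
  have h1 : bil P (g t) (drift A g t) = ∫ s in (0 : ℝ)..t, bil P (g s) (act A (forced A g s)) := by
    have := intervalIntegral.integral_eq_sub_of_hasDerivAt
      (fun s _ => hasDerivAt_bil (N := P) (x := fun _ => g t) (x' := 0)
        (fun i => hasDerivAt_const s (g t i)) (hd s))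
      (Continuous.intervalIntegrable
        ((continuous_bil (N := P) (x := fun _ => g t) (fun _ => continuous_const) haf).add
          (continuous_bil (N := P) (x := fun _ => 0) (fun _ => continuous_const) hdc)) 0 t)
    rw [drift_zero] at this
    have e : bil P (g t) 0 = 0 := by simp [bil, act]
    rw [e, sub_zero] at this
    rw [← this]
    refine intervalIntegral.integral_congr fun s hs => ?_
    rw [Set.uIcc_of_le ht] at hs
    have e : bil P 0 (drift A g s) = 0 := by simp [bil]
    simp only [e, add_zero, bil_act_right]
    rw [bil_eq_sum, bil_eq_sum]
    simp only [h.inner_forced hg hs.1 hs.2]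
  have h2 : bil P (drift A g t) (drift A g t) =
      ∫ s in (0 : ℝ)..t, 2 * bil P (drift A g s) (act A (forced A g s)) := by
    have := intervalIntegral.integral_eq_sub_of_hasDerivAt
      (fun s _ => hasDerivAt_bil (N := P) (hd s) (hd s))
      (Continuous.intervalIntegrable ((continuous_bil hdc haf).add (continuous_bil haf hdc)) 0 t)
    rw [drift_zero] at this
    have e : bil P (0 : σ → H) 0 = 0 := by simp [bil]
    rw [e, sub_zero] at this
    rw [← this]
    refine intervalIntegral.integral_congr fun s hs => ?_
    rw [bil_comm P (act A _), hP]
    ring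
  have h3 : bil P (forced A g t) (forced A g t) = bil P (g t) (g t) + 2 * bil P (g t) (drift A g t) +
      bil P (drift A g t) (drift A g t) := by
    rw [forced, bil_add_left, bil_add_right, bil_add_right, bil_comm P (drift A g t) (g t), hP]
    ring
  -- The energy of `g t` itself supplies t tr(P Γ), the term that Itô's formula would give. The two
  -- integrals combine to twice the pairing of the state with `P * A`, which is minus the
  -- dissipation `M`.
  rw [h3, bil_trace_of_white h ht, hΓ, h1, h2, ← intervalIntegral.integral_const_mul, add_assoc,
    ← intervalIntegral.integral_add, sub_eq_add_neg, ← intervalIntegral.integral_neg]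
  · congr 1
    refine intervalIntegral.integral_congr fun s _ => ?_
    rw [← two_mul_bil_lyapunov hP hM, forced, bil_add_left]
    ring
  · exact ((continuous_bil hg haf).const_mul 2).intervalIntegrable _ _
  · exact ((continuous_bil hdc haf).const_mul 2).intervalIntegrable _ _

/-- Grönwall: F' = c - e ≤ c - δ F, so e^{δt}(F - c/δ) decreases for t ≥ 0, and it starts at -c/δ ≤
0. -/
lemma le_of_integral_balance {f e : ℝ → ℝ} {c δ : ℝ} (he : Continuous e) (hδ : 0 < δ) (hc : 0 ≤ c)
    (hfe : ∀ t, δ * f t ≤ e t) (hf : ∀ t, 0 ≤ t → f t = c * t - ∫ s in (0 : ℝ)..t, e s) {t : ℝ}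
    (ht : 0 ≤ t) : f t ≤ c / δ := by
  set F : ℝ → ℝ := fun t => c * t - ∫ s in (0 : ℝ)..t, e s
  have hF (t : ℝ) : HasDerivAt F (c - e t) t := by
    have := ((hasDerivAt_id t).const_mul c).fun_sub
      (intervalIntegral.integral_hasDerivAt_right (he.intervalIntegrable 0 t)
        (he.stronglyMeasurableAtFilter _ _) he.continuousAt)
    simpa using this
  have hG (t : ℝ) : HasDerivAt (fun t => Real.exp (δ * t) * (F t - c / δ))
      (Real.exp (δ * t) * (δ * F t - e t)) t := by
    refine (((hasDerivAt_id t).const_mul δ).exp.mul ((hF t).sub_const (c / δ))).congr_deriv ?_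
    simp only [id]
    field_simp
    ring
  have hanti : AntitoneOn (fun t => Real.exp (δ * t) * (F t - c / δ)) (Set.Ici 0) := by
    refine antitoneOn_of_deriv_nonpos (convex_Ici 0) (fun s _ => (hG s).continuousAt.continuousWithinAt)
      (fun s _ => (hG s).differentiableAt.differentiableWithinAt) fun s hs => ?_
    rw [interior_Ici] at hs
    rw [(hG s).deriv]
    refine mul_nonpos_of_nonneg_of_nonpos (Real.exp_pos _).le ?_
    have := hfe s
    rw [hf s (le_of_lt hs)] at this
    simpa using this
  have h := hanti (Set.mem_Ici.2 le_rfl) (Set.mem_Ici.2 ht) ht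
  have h0 : F 0 = 0 := by simp [F]
  simp only [h0, mul_zero, Real.exp_zero, zero_sub, one_mul] at h
  have hcδ : 0 ≤ c / δ := by positivity
  have hpos := Real.exp_pos (δ * t)
  rw [hf t ht]
  by_contra hlt
  push Not at hlt
  have : 0 < Real.exp (δ * t) * (F t - c / δ) := mul_pos hpos (by linarith)
  linarith

end Energy

end LQG

end

noncomputable section

namespace LQG

/-! ### Long-run averages -/

section Average

variable {σ : Type*} [Fintype σ] [DecidableEq σ] {H : Type*} [NormedAddCommGroup H]
  [InnerProductSpace ℝ H] {A Γ P M : Matrix σ σ ℝ} {g : ℝ → σ → H}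

lemma Hurwitz.exists_energyMatrix (hA : Hurwitz A) (hM : M.PosSemidef) :
    ∃ P : Matrix σ σ ℝ, P.PosSemidef ∧ Aᵀ * P + P * A = -M := by
  obtain ⟨P, hP⟩ := hA.transpose.exists_lyapunov (-M)
  exact ⟨P, hA.transpose.lyapunov_posSemidef hM hP, by simpa using hP⟩

/-- Along the flow the `P`-energy falls at the rate given by `M`, so the integral is the energy
lost, at most the initial energy. -/
lemma bil_flow_integral_le (hP : P.PosSemidef) (h : Aᵀ * P + P * A = -M) (x : σ → H) (T : ℝ) :
    ∫ t in (0 : ℝ)..T, bil M (act (flow A t) x) (act (flow A t) x) ≤ bil P x x := by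
  have hd := hasDerivAt_act_flow (A := A) x
  have hc (i : σ) : Continuous fun t => act (flow A t) x i :=
    continuous_iff_continuousAt.2 fun t => (hd t i).continuousAt
  have h1 := intervalIntegral.integral_eq_sub_of_hasDerivAt
      (fun s _ => hasDerivAt_bil (N := P) (hd s) (hd s))
      (Continuous.intervalIntegrable ((continuous_bil hc fun i => continuous_act A hc i).add
        (continuous_bil (fun i => continuous_act A hc i) hc)) 0 T)
  have h2 (s : ℝ) : bil M (act (flow A s) x) (act (flow A s) x) =
      -(bil P (act (flow A s) x) (act A (act (flow A s) x)) +
        bil P (act A (act (flow A s) x)) (act (flow A s) x)) := by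
    rw [bil_comm P (act A _), transpose_eq_of_posSemidef hP]
    have := two_mul_bil_lyapunov (transpose_eq_of_posSemidef hP) h (act (flow A s) x)
    linarith
  simp only [h2, intervalIntegral.integral_neg]
  rw [h1, flow_zero, act_one]
  linarith [bil_nonneg hP (act (flow A T) x)]

variable [CompleteSpace H]

/-- By the energy balance the average is tr(P Γ) minus the energy at T divided by T, so bounded
energy suffices. As `M` may be degenerate, the energy matrix `P₁` of the identity is added: the
dissipation `M + 1` then dominates a multiple of the energy of `P + P₁`. -/
lemma IsWhite.tendsto_average_forced (hA : Hurwitz A) (hg : ∀ i, Continuous fun t => g t i)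
    (h : IsWhite Γ g) (hΓ : Γᵀ = Γ) (hM : M.PosSemidef) (hP : P.PosSemidef)
    (hPM : Aᵀ * P + P * A = -M) :
    Tendsto (fun T : ℝ => (1 / T) * ∫ t in (0 : ℝ)..T, bil M (forced A g t) (forced A g t)) atTop
      (𝓝 (P * Γ).trace) := by
  obtain ⟨P₁, hP₁, hPM₁⟩ := hA.exists_energyMatrix (PosSemidef.one (n := σ) (R := ℝ))
  obtain ⟨k, hk, hle⟩ := exists_bil_le (H := H) (P + P₁)
  have hf := continuous_forced (A := A) hg
  have hP' := hP.add hP₁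
  have hbal (t : ℝ) (ht : 0 ≤ t) : bil (P + P₁) (forced A g t) (forced A g t) =
      ((P + P₁) * Γ).trace * t - ∫ s in (0 : ℝ)..t, bil (M + 1) (forced A g s) (forced A g s) := by
    rw [h.energy (M := M + 1) hg hΓ (transpose_eq_of_posSemidef hP') _ ht, mul_comm]
    rw [Matrix.mul_add, Matrix.add_mul, neg_add, ← hPM, ← hPM₁]
    abel
  have hpos (t : ℝ) : 0 ≤ bil (M + 1) (forced A g t) (forced A g t) :=
    bil_nonneg (hM.add PosSemidef.one) _
  have hc : 0 ≤ ((P + P₁) * Γ).trace := by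
    have h1 := hbal 1 zero_le_one
    have h2 := bil_nonneg hP' (forced A g 1)
    have h3 := intervalIntegral.integral_nonneg_of_forall (μ := volume) (zero_le_one (α := ℝ)) hpos
    linarith
  have hbd {t : ℝ} (ht : 0 ≤ t) := le_of_integral_balance (δ := 1 / k)
    (f := fun t => bil (P + P₁) (forced A g t) (forced A g t)) (continuous_bil hf hf) (by positivity) hc
    (fun t => by
      rw [bil_add_matrix M, one_div, inv_mul_le_iff₀ hk, mul_add]
      have := bil_nonneg hM (forced A g t)
      have := hle (forced A g t)
      nlinarith) hbal ht
  set c := ((P + P₁) * Γ).trace / (1 / k)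
  have hlim : Tendsto (fun T : ℝ => bil P (forced A g T) (forced A g T) / T) atTop (𝓝 0) := by
    refine tendsto_of_tendsto_of_tendsto_of_le_of_le' tendsto_const_nhds
      (tendsto_const_nhds.div_atTop tendsto_id : Tendsto (fun T : ℝ => c / T) atTop (𝓝 0)) ?_ ?_
    · filter_upwards [eventually_gt_atTop 0] with T hT
      exact div_nonneg (bil_nonneg hP _) hT.le
    · filter_upwards [eventually_gt_atTop 0] with T hT
      have h1 := hbd hT.le
      rw [bil_add_matrix] at h1
      have h2 := bil_nonneg hP₁ (forced A g T)
      gcongr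
      linarith
  have h0 := hlim.const_sub (P * Γ).trace
  rw [sub_zero] at h0
  refine h0.congr' ?_
  filter_upwards [eventually_gt_atTop 0] with T hT
  rw [h.energy hg hΓ (transpose_eq_of_posSemidef hP) hPM hT.le]
  field_simp
  ring

/-- The long-run average does not depend on the initial value. -/
lemma IsWhite.tendsto_average (hA : Hurwitz A) (hg : ∀ i, Continuous fun t => g t i)
    (h : IsWhite Γ g) (hΓ : Γᵀ = Γ) (hM : M.PosSemidef) (hP : P.PosSemidef)
    (hPM : Aᵀ * P + P * A = -M) (x : σ → H) :
    Tendsto (fun T : ℝ => (1 / T) * ∫ t in (0 : ℝ)..T,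
      bil M (act (flow A t) x + forced A g t) (act (flow A t) x + forced A g t)) atTop
      (𝓝 (P * Γ).trace) := by
  have hf := continuous_forced (A := A) hg
  have hy (i : σ) : Continuous fun t => act (flow A t) x i :=
    continuous_iff_continuousAt.2 fun t => (hasDerivAt_act_flow x t i).continuousAt
  have hlim := h.tendsto_average_forced hA hg hΓ hM hP hPM
  set φ : ℝ → ℝ := fun t => bil M (forced A g t) (forced A g t)
  set ψ : ℝ → ℝ := fun t => bil M (act (flow A t) x) (act (flow A t) x)
  set χ : ℝ → ℝ := fun t => bil M (act (flow A t) x + forced A g t) (act (flow A t) x + forced A g t)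
  set C := bil P x x
  have hMt := transpose_eq_of_posSemidef hM
  have hφc : Continuous φ := continuous_bil hf hf
  have hψc : Continuous ψ := continuous_bil hy hy
  have hχc : Continuous χ := continuous_bil (fun i => (hy i).add (hf i)) fun i => (hy i).add (hf i)
  have hψ (T : ℝ) : ∫ t in (0 : ℝ)..T, ψ t ≤ C := bil_flow_integral_le hP hPM x T
  have hexp (a : ℝ) (t : ℝ) (s : ℝ) : 0 ≤ a ^ 2 * ψ t + 2 * (a * s) * bil M (act (flow A t) x) (forced A g t) +
      s ^ 2 * φ t := by
    have := bil_nonneg hM (a • act (flow A t) x + s • forced A g t)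
    rw [bil_add_left, bil_add_right, bil_add_right, bil_comm M (s • forced A g t) (a • _), hMt] at this
    simp only [bil_smul_left, bil_smul_right] at this
    simp only [ψ, φ]
    linarith
  have hχ (t : ℝ) : χ t = ψ t + 2 * bil M (act (flow A t) x) (forced A g t) + φ t := by
    simp only [χ, ψ, φ]
    rw [bil_add_left, bil_add_right, bil_add_right, bil_comm M (forced A g t) (act _ _), hMt]
    ring
  -- The cross term is controlled by nonnegativity of the form at a y ± a⁻¹ ξ, with y the free and ξ
  -- the forced response.
  have hpt (a : ℝ) (ha : 0 < a) (t : ℝ) : |χ t - φ t| ≤ (1 + a ^ 2) * ψ t + (a ^ 2)⁻¹ * φ t := by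
    have e : a * a⁻¹ = 1 := mul_inv_cancel₀ ha.ne'
    have h1 := hexp a t a⁻¹
    have h2 := hexp a t (-a⁻¹)
    have h3 : 0 ≤ ψ t := bil_nonneg hM _
    rw [e, inv_pow] at h1
    rw [mul_neg, e, neg_sq, inv_pow] at h2
    rw [hχ, abs_le]
    constructor <;> nlinarith
  -- The choice a² = √T balances the errors: the integral of ψ stays bounded, so (1 + √T)/T suffices
  -- for it, and the average of φ converges, so its weight 1/√T tends to zero.
  have key (T : ℝ) (hT : 0 < T) : |(1 / T) * (∫ t in (0 : ℝ)..T, χ t) -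
      (1 / T) * ∫ t in (0 : ℝ)..T, φ t| ≤
      (1 / T + (√T)⁻¹) * C + (√T)⁻¹ * ((1 / T) * ∫ t in (0 : ℝ)..T, φ t) := by
    have hs : 0 < √T := Real.sqrt_pos.2 hT
    have h1 : |∫ t in (0 : ℝ)..T, (χ t - φ t)| ≤ (1 + √T) * C + (√T)⁻¹ * ∫ t in (0 : ℝ)..T, φ t := by
      calc |∫ t in (0 : ℝ)..T, (χ t - φ t)| ≤ ∫ t in (0 : ℝ)..T, |χ t - φ t| :=
            intervalIntegral.abs_integral_le_integral_abs hT.le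
        _ ≤ ∫ t in (0 : ℝ)..T, ((1 + √T) * ψ t + (√T)⁻¹ * φ t) := by
            refine intervalIntegral.integral_mono_on hT.le ((hχc.sub hφc).abs.intervalIntegrable _ _)
              (((hψc.const_mul _).add (hφc.const_mul _)).intervalIntegrable _ _) fun t _ => ?_
            simpa [Real.sq_sqrt hs.le] using hpt (√(√T)) (Real.sqrt_pos.2 hs) t
        _ = (1 + √T) * (∫ t in (0 : ℝ)..T, ψ t) + (√T)⁻¹ * ∫ t in (0 : ℝ)..T, φ t := by
            rw [intervalIntegral.integral_add ((hψc.const_mul _).intervalIntegrable _ _)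
              ((hφc.const_mul _).intervalIntegrable _ _), intervalIntegral.integral_const_mul,
              intervalIntegral.integral_const_mul]
        _ ≤ _ := by
            have := hψ T
            gcongr
    rw [← mul_sub, ← intervalIntegral.integral_sub (hχc.intervalIntegrable _ _)
      (hφc.intervalIntegrable _ _), abs_mul, abs_of_pos (by positivity : (0 : ℝ) < 1 / T)]
    refine (mul_le_mul_of_nonneg_left h1 (by positivity)).trans (le_of_eq ?_)
    have e : 1 / T * √T = (√T)⁻¹ := by
      field_simp
      exact Real.sq_sqrt hT.le
    rw [← e]
    ring
  have hz : Tendsto (fun T : ℝ => (√T)⁻¹) atTop (𝓝 0) :=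
    tendsto_inv_atTop_zero.comp Real.tendsto_sqrt_atTop
  have hz1 : Tendsto (fun T : ℝ => 1 / T) atTop (𝓝 0) := by
    simpa only [one_div] using tendsto_inv_atTop_zero
  have hb := ((hz1.add hz).mul_const C).add (hz.mul hlim)
  rw [add_zero, zero_mul, zero_mul, add_zero] at hb
  have hd : Tendsto (fun T : ℝ => (1 / T) * (∫ t in (0 : ℝ)..T, χ t) -
      (1 / T) * ∫ t in (0 : ℝ)..T, φ t) atTop (𝓝 0) := by
    refine squeeze_zero_norm' ?_ hb
    filter_upwards [eventually_gt_atTop 0] with T hT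
    exact key T hT
  simpa using hd.add hlim

end Average

/-! ### Square-integrable processes as paths in `L²` -/

section Paths

variable {Ω : Type*} [MeasurableSpace Ω] {P : Measure Ω} [IsProbabilityMeasure P]

/-- `h` is a measurable process with continuous paths, `hH` is its path in `L²`. -/
structure IsL2Process (P : Measure Ω) (h : ℝ → Ω → ℝ) (hH : ℝ → Lp ℝ 2 P) : Prop where
  cont : ∀ ω, Continuous fun t => h t ω
  meas : ∀ t, Measurable (h t)
  ae_eq : ∀ t, hH t =ᵐ[P] h t
  contH : Continuous hH

namespace IsL2Process

variable {h k : ℝ → Ω → ℝ} {hH kH : ℝ → Lp ℝ 2 P}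

lemma measurable_uncurry (hh : IsL2Process P h hH) : Measurable (Function.uncurry h) :=
  measurable_uncurry_of_continuous_of_measurable hh.cont hh.meas

lemma integrable_mul (hh : IsL2Process P h hH) (hk : IsL2Process P k kH) (s t : ℝ) :
    Integrable (fun ω => h s ω * k t ω) P := by
  refine (L2.integrable_inner (𝕜 := ℝ) (hH s) (kH t)).congr ?_
  filter_upwards [hh.ae_eq s, hk.ae_eq t] with ω h1 h2
  simp [h1, h2, mul_comm]

lemma inner_eq (hh : IsL2Process P h hH) (hk : IsL2Process P k kH) (s t : ℝ) :
    inner ℝ (hH s) (kH t) = ∫ ω, h s ω * k t ω ∂P := by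
  rw [L2.inner_def]
  refine integral_congr_ae ?_
  filter_upwards [hh.ae_eq s, hk.ae_eq t] with ω h1 h2
  simp [h1, h2, mul_comm]

/-- The product is dominated by h² + k², whose expectation is continuous in t, being a sum of
squared L² norms along continuous paths. -/
lemma integrable_prod (hh : IsL2Process P h hH) (hk : IsL2Process P k kH) (a b : ℝ) :
    Integrable (fun p : ℝ × Ω => h p.1 p.2 * k p.1 p.2) ((volume.restrict (Set.Ioc a b)).prod P) := by
  have hm : AEStronglyMeasurable (fun p : ℝ × Ω => h p.1 p.2 * k p.1 p.2)
      ((volume.restrict (Set.Ioc a b)).prod P) :=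
    (hh.measurable_uncurry.mul hk.measurable_uncurry).aestronglyMeasurable
  refine (integrable_prod_iff hm).2 ⟨Eventually.of_forall fun t => hh.integrable_mul hk t t, ?_⟩
  have hc : Continuous fun t => inner ℝ (hH t) (hH t) + inner ℝ (kH t) (kH t) :=
    (hh.contH.inner hh.contH).add (hk.contH.inner hk.contH)
  refine Integrable.mono' ((hc.integrableOn_Icc).mono_set Set.Ioc_subset_Icc_self)
    hm.norm.integral_prod_right' (Eventually.of_forall fun t => ?_)
  rw [hh.inner_eq hh, hk.inner_eq hk, ← integral_add (hh.integrable_mul hh t t) (hk.integrable_mul hk t t),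
    Real.norm_of_nonneg (integral_nonneg fun _ => norm_nonneg _)]
  refine integral_mono (hh.integrable_mul hk t t).norm
    ((hh.integrable_mul hh t t).add (hk.integrable_mul hk t t)) fun ω => ?_
  simp only [norm_mul, Real.norm_eq_abs]
  nlinarith [sq_nonneg (|h t ω| - |k t ω|), sq_abs (h t ω), sq_abs (k t ω), abs_nonneg (h t ω),
    abs_nonneg (k t ω), mul_nonneg (abs_nonneg (h t ω)) (abs_nonneg (k t ω))]

lemma integrable_integral_mul (hh : IsL2Process P h hH) (hk : IsL2Process P k kH) {a b : ℝ}
    (hab : a ≤ b) : Integrable (fun ω => ∫ t in a..b, h t ω * k t ω) P := by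
  simp only [intervalIntegral.integral_of_le hab]
  exact (hh.integrable_prod hk a b).integral_prod_right

lemma integral_integral_mul (hh : IsL2Process P h hH) (hk : IsL2Process P k kH) {a b : ℝ}
    (hab : a ≤ b) : ∫ ω, (∫ t in a..b, h t ω * k t ω) ∂P = ∫ t in a..b, inner ℝ (hH t) (kH t) := by
  simp only [intervalIntegral.integral_of_le hab, hh.inner_eq hk]
  exact (integral_integral_swap (f := fun t ω => h t ω * k t ω) (hh.integrable_prod hk a b)).symm

lemma const {f : Ω → ℝ} (hf : Measurable f) {fH : Lp ℝ 2 P} (h : fH =ᵐ[P] f) :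
    IsL2Process P (fun _ => f) (fun _ => fH) :=
  ⟨fun _ => continuous_const, fun _ => hf, fun _ => h, continuous_const⟩

lemma zero : IsL2Process P (fun _ _ => 0) (fun _ => 0) :=
  const measurable_const (Lp.coeFn_zero _ _ _)

lemma add (hh : IsL2Process P h hH) (hk : IsL2Process P k kH) :
    IsL2Process P (fun t ω => h t ω + k t ω) (fun t => hH t + kH t) :=
  ⟨fun ω => (hh.cont ω).add (hk.cont ω), fun t => (hh.meas t).add (hk.meas t), fun t => by
    filter_upwards [hh.ae_eq t, hk.ae_eq t, Lp.coeFn_add (hH t) (kH t)] with ω h1 h2 h3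
    rw [h3, Pi.add_apply, h1, h2], hh.contH.add hk.contH⟩

lemma smul {f : ℝ → ℝ} (hf : Continuous f) (hh : IsL2Process P h hH) :
    IsL2Process P (fun t ω => f t • h t ω) (fun t => f t • hH t) :=
  ⟨fun ω => hf.smul (hh.cont ω), fun t => (hh.meas t).const_smul (f t), fun t => by
    filter_upwards [hh.ae_eq t, Lp.coeFn_smul (f t) (hH t)] with ω h1 h2
    rw [h2, Pi.smul_apply, h1], hf.smul hh.contH⟩

lemma sum {ι : Type*} (s : Finset ι) {h : ι → ℝ → Ω → ℝ} {hH : ι → ℝ → Lp ℝ 2 P}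
    (hh : ∀ i, IsL2Process P (h i) (hH i)) :
    IsL2Process P (fun t ω => ∑ i ∈ s, h i t ω) (fun t => ∑ i ∈ s, hH i t) := by
  classical
  induction s using Finset.induction_on with
  | empty => simpa using zero
  | insert i s hi ih => simpa [Finset.sum_insert hi] using (hh i).add ih

/-- Pairing with the indicator of any measurable set commutes with the Bochner integral and, by
Fubini, with the pathwise one. The two therefore have equal integrals over every set. -/
lemma integral_ae_eq (hh : IsL2Process P h hH) {a b : ℝ} (hab : a ≤ b) :
    (∫ t in a..b, hH t : Lp ℝ 2 P) =ᵐ[P] fun ω => ∫ t in a..b, h t ω := by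
  have h1 : IsL2Process P (fun _ _ => (1 : ℝ)) (fun _ => indicatorConstLp 2 MeasurableSet.univ
      (measure_ne_top P _) (1 : ℝ)) := const measurable_const (by
    filter_upwards [indicatorConstLp_coeFn (p := 2) (hs := MeasurableSet.univ)
      (hμs := measure_ne_top P _) (c := (1 : ℝ))] with ω h
    rw [h]; simp)
  refine Integrable.ae_eq_of_forall_setIntegral_eq _ _
    ((Lp.memLp _).integrable (by norm_num)) ?_ fun s hs hμ => ?_
  · simpa using hh.integrable_integral_mul h1 hab
  · have h2 : IsL2Process P (fun _ => s.indicator fun _ => (1 : ℝ)) (fun _ => indicatorConstLp 2 hs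
        (measure_ne_top P _) (1 : ℝ)) :=
      const (measurable_const.indicator hs) indicatorConstLp_coeFn
    rw [← L2.inner_indicatorConstLp_one hs (measure_ne_top P _), ← innerSL_apply_apply ℝ,
      ← ContinuousLinearMap.intervalIntegral_comp_comm (innerSL ℝ _) (hh.contH.intervalIntegrable _ _)]
    simp only [innerSL_apply_apply]
    rw [← h2.integral_integral_mul hh hab, ← integral_indicator hs]
    refine integral_congr_ae (Eventually.of_forall fun ω => ?_)
    by_cases hω : ω ∈ s <;> simp [hω]

lemma integral (hh : IsL2Process P h hH) :
    IsL2Process P (fun t ω => ∫ s in (0 : ℝ)..t, h s ω) (fun t => ∫ s in (0 : ℝ)..t, hH s) := by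
  refine ⟨fun ω => intervalIntegral.continuous_primitive (fun _ _ => (hh.cont ω).intervalIntegrable _ _) 0,
    fun t => ?_, fun t => ?_,
    intervalIntegral.continuous_primitive (fun _ _ => hh.contH.intervalIntegrable _ _) 0⟩
  · have hm (a b : ℝ) : Measurable fun ω => ∫ s in Set.Ioc a b, h s ω :=
      (hh.measurable_uncurry.stronglyMeasurable.comp_measurable measurable_swap).integral_prod_right'.measurable
    simp only [intervalIntegral]
    exact (hm _ _).sub (hm _ _)
  · rcases le_total 0 t with ht | ht
    · exact hh.integral_ae_eq ht
    · rw [intervalIntegral.integral_symm]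
      filter_upwards [hh.integral_ae_eq ht, Lp.coeFn_neg (∫ s in t..(0 : ℝ), hH s)] with ω h1 h2
      rw [h2, Pi.neg_apply, h1, intervalIntegral.integral_symm t 0]

variable {σ : Type*} [Fintype σ] [DecidableEq σ] {x : ℝ → Ω → σ → ℝ} {xH : ℝ → σ → Lp ℝ 2 P}

lemma act {ι : Type*} {N : ℝ → Matrix ι σ ℝ} (hN : ∀ i j, Continuous fun t => N t i j)
    (hx : ∀ i, IsL2Process P (fun t ω => x t ω i) (fun t => xH t i)) (i : ι) :
    IsL2Process P (fun t ω => LQG.act (N t) (x t ω) i) (fun t => LQG.act (N t) (xH t) i) :=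
  sum _ fun j => (hx j).smul (hN i j)

lemma forced (A : Matrix σ σ ℝ)
    (hx : ∀ i, IsL2Process P (fun t ω => x t ω i) (fun t => xH t i)) (i : σ) :
    IsL2Process P (fun t ω => LQG.forced A (fun t => x t ω) t i) (fun t => LQG.forced A xH t i) := by
  refine (hx i).add (act (continuous_flow A)
    (x := fun t ω i => ∫ r in (0 : ℝ)..t, LQG.act (flow A (-r) * A) (x r ω) i)
    (fun i => integral (act (fun i j => ?_) hx i)) i)
  simp only [Matrix.mul_apply]
  exact continuous_finsetSum _ fun k _ =>
    ((continuous_flow A i k).comp continuous_neg).mul continuous_const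

lemma integrable_integral_bil (M : Matrix σ σ ℝ)
    (hx : ∀ i, IsL2Process P (fun t ω => x t ω i) (fun t => xH t i)) {T : ℝ} (hT : 0 ≤ T) :
    Integrable (fun ω => ∫ t in (0 : ℝ)..T, x t ω ⬝ᵥ (M *ᵥ x t ω)) P ∧
      ∫ ω, (∫ t in (0 : ℝ)..T, x t ω ⬝ᵥ (M *ᵥ x t ω)) ∂P =
        ∫ t in (0 : ℝ)..T, bil M (xH t) (xH t) := by
  have hax := act (N := fun _ => M) (fun _ _ => continuous_const) hx
  have e (ω : Ω) : ∫ t in (0 : ℝ)..T, x t ω ⬝ᵥ (M *ᵥ x t ω) =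
      ∑ i, ∫ t in (0 : ℝ)..T, x t ω i * LQG.act M (x t ω) i := by
    simp only [← act_real, dotProduct]
    exact intervalIntegral.integral_finsetSum fun i _ =>
      (((hx i).cont ω).mul ((hax i).cont ω)).intervalIntegrable _ _
  simp only [e, bil]
  refine ⟨integrable_finsetSum _ fun i _ => (hx i).integrable_integral_mul (hax i) hT, ?_⟩
  rw [integral_finsetSum _ fun i _ => (hx i).integrable_integral_mul (hax i) hT,
    intervalIntegral.integral_finsetSum fun i _ =>
      ((hx i).contH.inner (hax i).contH).intervalIntegrable _ _]
  exact Finset.sum_congr rfl fun i _ => (hx i).integral_integral_mul (hax i) hT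

end IsL2Process

end Paths

end LQG

end

noncomputable section

namespace LQG

/-! ### Second moments of the noise -/

section Noise

variable {Ω : Type*} [MeasurableSpace Ω] {P : Measure Ω} [IsProbabilityMeasure P]

/-- The paths are set to zero on a measurable null set containing all ω with a discontinuous path or
a mismatch at a dense sequence of times. Measurability at other times follows by continuity. -/
lemma exists_measurable_version {d : ℕ} {w : ℝ≥0 → Ω → Fin d → ℝ}
    (hm : ∀ t, AEMeasurable (w t) P) (hc : ∀ᵐ ω ∂P, Continuous fun t => w t ω) :
    ∃ h : ℝ≥0 → Ω → Fin d → ℝ, (∀ ω, Continuous fun t => h t ω) ∧ (∀ t, Measurable (h t)) ∧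
      ∀ᵐ ω ∂P, ∀ t, h t ω = w t ω := by
  classical
  set D := TopologicalSpace.denseSeq ℝ≥0
  have h0 : ∀ᵐ ω ∂P, (∀ k, w (D k) ω = (hm (D k)).mk _ ω) ∧ Continuous fun t => w t ω :=
    (ae_all_iff.2 fun k => (hm (D k)).ae_eq_mk).and hc
  obtain ⟨N, hsub, hN, hN0⟩ := exists_measurable_superset_of_null (ae_iff.1 h0)
  have hgood (ω : Ω) (hω : ω ∈ Nᶜ) :
      (∀ k, w (D k) ω = (hm (D k)).mk _ ω) ∧ Continuous fun t => w t ω := by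
    by_contra hcon
    exact hω (hsub hcon)
  have hD (k : ℕ) : Measurable (Nᶜ.indicator (w (D k))) := by
    have e : Nᶜ.indicator (w (D k)) = Nᶜ.indicator ((hm (D k)).mk _) :=
      Set.indicator_congr fun ω hω => (hgood ω hω).1 k
    rw [e]
    exact (hm (D k)).measurable_mk.indicator hN.compl
  have hcont (ω : Ω) : Continuous fun t => Nᶜ.indicator (w t) ω := by
    by_cases hω : ω ∈ Nᶜ
    · simpa [Set.indicator_of_mem hω] using (hgood ω hω).2
    · simpa only [Set.indicator_of_notMem hω] using continuous_const
  refine ⟨fun t => Nᶜ.indicator (w t), hcont, fun t => ?_, ?_⟩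
  · obtain ⟨u, hu, hut⟩ := mem_closure_iff_seq_limit.1
      ((TopologicalSpace.denseRange_denseSeq ℝ≥0).closure_range.symm ▸ Set.mem_univ t)
    choose k hk using hu
    refine measurable_of_tendsto_metrizable (f := fun j => Nᶜ.indicator (w (u j))) (fun j => ?_) ?_
    · rw [← hk]
      exact hD _
    · exact tendsto_pi_nhds.2 fun ω => ((hcont ω).tendsto t).comp hut
  · have : ∀ᵐ ω ∂P, ω ∈ Nᶜ := by
      rw [ae_iff]
      simpa using hN0
    filter_upwards [this] with ω hω t
    exact Set.indicator_of_mem hω _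

variable {d : ℕ} {Γ : Matrix (Fin d) (Fin d) ℝ} {w : ℝ≥0 → Ω → Fin d → ℝ}

lemma IsWiener.aemeasurable (hw : IsWiener P Γ w) (t : ℝ≥0) : AEMeasurable (w t) P := by
  have h := (hw.law 0 t zero_le).aemeasurable
  refine ((WithLp.measurable_ofLp 2 (Fin d → ℝ)).comp_aemeasurable h).congr ?_
  filter_upwards [hw.zero] with ω h0
  simp [h0]

lemma memLp_eval_multivariateGaussian (M : Matrix (Fin d) (Fin d) ℝ) (i : Fin d) :
    MemLp (fun x : EuclideanSpace ℝ (Fin d) => x i) 2 (multivariateGaussian 0 M) :=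
  (EuclideanSpace.proj (𝕜 := ℝ) i).comp_memLp' IsGaussian.memLp_two_id

lemma integral_eval_multivariateGaussian (M : Matrix (Fin d) (Fin d) ℝ) (i : Fin d) :
    ∫ x : EuclideanSpace ℝ (Fin d), x i ∂(multivariateGaussian 0 M) = 0 := by
  have h := ContinuousLinearMap.integral_comp_comm (EuclideanSpace.proj (𝕜 := ℝ) i)
    (IsGaussian.integrable_fun_id (μ := multivariateGaussian (0 : EuclideanSpace ℝ (Fin d)) M))
  rw [integral_id_multivariateGaussian] at h
  simpa using h

lemma IsWiener.memLp_sub (hw : IsWiener P Γ w) {s t : ℝ≥0} (hst : s ≤ t) (i : Fin d) :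
    MemLp (fun ω => w t ω i - w s ω i) 2 P := by
  have h := hw.law s t hst
  have := memLp_eval_multivariateGaussian (((t : ℝ) - (s : ℝ)) • Γ) i
  rw [← h.map_eq] at this
  exact (memLp_map_measure_iff this.1 h.aemeasurable).1 this

lemma IsWiener.integral_sub (hw : IsWiener P Γ w) {s t : ℝ≥0} (hst : s ≤ t) (i : Fin d) :
    ∫ ω, (w t ω i - w s ω i) ∂P = 0 := by
  have h := (hw.law s t hst).integral_comp (f := fun x => x i)
    (memLp_eval_multivariateGaussian _ i).1
  rw [integral_eval_multivariateGaussian] at h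
  exact h

lemma IsWiener.integral_sub_mul_sub (hw : IsWiener P Γ w) (hΓ : Γ.PosSemidef) {s t : ℝ≥0}
    (hst : s ≤ t) (i j : Fin d) :
    ∫ ω, (w t ω i - w s ω i) * (w t ω j - w s ω j) ∂P = ((t : ℝ) - s) * Γ i j := by
  have hst' : (0 : ℝ) ≤ (t : ℝ) - s := sub_nonneg.2 (by exact_mod_cast hst)
  have h := covariance_eval_multivariateGaussian (μ := 0) (hΓ.smul hst') i j
  rw [covariance_eq_sub (memLp_eval_multivariateGaussian _ i) (memLp_eval_multivariateGaussian _ j),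
    integral_eval_multivariateGaussian, zero_mul, sub_zero] at h
  have h2 := (hw.law s t hst).integral_comp (f := fun x => x i * x j)
    ((memLp_eval_multivariateGaussian _ i).1.mul (memLp_eval_multivariateGaussian _ j).1)
  simp only [Pi.mul_apply] at h
  rw [h] at h2
  simpa using h2

lemma IsWiener.eval_ae_eq (hw : IsWiener P Γ w) (t : ℝ≥0) (i : Fin d) :
    (fun ω => w t ω i - w 0 ω i) =ᵐ[P] fun ω => w t ω i := by
  filter_upwards [hw.zero] with ω h0
  simp [h0]

lemma IsWiener.memLp (hw : IsWiener P Γ w) (t : ℝ≥0) (i : Fin d) :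
    MemLp (fun ω => w t ω i) 2 P :=
  (hw.memLp_sub zero_le i).ae_eq (hw.eval_ae_eq t i)

lemma IsWiener.integral_eq_zero (hw : IsWiener P Γ w) (t : ℝ≥0) (i : Fin d) :
    ∫ ω, w t ω i ∂P = 0 := by
  rw [← integral_congr_ae (hw.eval_ae_eq t i), hw.integral_sub zero_le i]

/-- The increment from s to t is centred and independent of the value at s. -/
lemma IsWiener.integral_mul (hw : IsWiener P Γ w) (hΓ : Γ.PosSemidef) {s t : ℝ≥0} (hst : s ≤ t)
    (i j : Fin d) : ∫ ω, w s ω i * w t ω j ∂P = s * Γ i j := by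
  have h1 : ∫ ω, w s ω i * w s ω j ∂P = s * Γ i j := by
    have := hw.integral_sub_mul_sub hΓ (zero_le : (0 : ℝ≥0) ≤ s) i j
    have e := integral_congr_ae ((hw.eval_ae_eq s i).mul (hw.eval_ae_eq s j))
    simp only [Pi.mul_apply] at e
    rw [← e, this]
    simp
  have h2 : ∫ ω, w s ω i * (w t ω j - w s ω j) ∂P = 0 := by
    have hi := (hw.indep.indepFun_eval_sub (zero_le : (0 : ℝ≥0) ≤ s) hst hw.zero).comp
      (measurable_pi_apply i) (measurable_pi_apply j)
    have := hi.integral_fun_mul_eq_mul_integral (hw.memLp s i).1 (hw.memLp_sub hst j).1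
    refine this.trans ?_
    have e := hw.integral_eq_zero s i
    simp only [Function.comp_def]
    rw [e, zero_mul]
  have e (ω : Ω) : w s ω i * w t ω j = w s ω i * w s ω j + w s ω i * (w t ω j - w s ω j) := by ring
  simp only [e]
  refine (integral_add ((hw.memLp s i).integrable_mul (hw.memLp s j))
    ((hw.memLp s i).integrable_mul (hw.memLp_sub hst j))).trans ?_
  simp only [Pi.mul_apply]
  rw [h1, h2, add_zero]

/-- A Wiener process as a path in `L²`. -/
lemma IsWiener.exists_process (hw : IsWiener P Γ w) (hΓ : Γ.PosSemidef) :
    ∃ (h : ℝ → Ω → Fin d → ℝ) (hH : ℝ → Fin d → Lp ℝ 2 P),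
      (∀ i, IsL2Process P (fun t ω => h t ω i) fun t => hH t i) ∧ IsWhite Γ hH ∧
      ∀ᵐ ω ∂P, ∀ t : ℝ, h t ω = w t.toNNReal ω := by
  obtain ⟨h, hcont, hmeas, hae⟩ := exists_measurable_version hw.aemeasurable hw.cont
  have hi (t : ℝ≥0) (i : Fin d) : (fun ω => h t ω i) =ᵐ[P] fun ω => w t ω i := by
    filter_upwards [hae] with ω hω
    rw [hω]
  have hL (t : ℝ≥0) (i : Fin d) : MemLp (fun ω => h t ω i) 2 P := (hw.memLp t i).ae_eq (hi t i).symm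
  set kH : ℝ≥0 → Fin d → Lp ℝ 2 P := fun t i => (hL t i).toLp _
  have hk (t : ℝ≥0) (i : Fin d) : kH t i =ᵐ[P] fun ω => h t ω i := MemLp.coeFn_toLp _
  have hinner {s t : ℝ≥0} (hst : s ≤ t) (i j : Fin d) : inner ℝ (kH s i) (kH t j) = s * Γ i j := by
    rw [L2.inner_def, ← hw.integral_mul hΓ hst i j]
    refine integral_congr_ae ?_
    filter_upwards [hk s i, hk t j, hi s i, hi t j] with ω h1 h2 h3 h4
    rw [h1, h2, h3, h4]
    simp [mul_comm]
  have hinner' (s t : ℝ≥0) (i : Fin d) : inner ℝ (kH s i) (kH t i) = (min s t : ℝ≥0) * Γ i i := by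
    rcases le_total s t with hst | hst
    · rw [hinner hst, min_eq_left hst]
    · rw [real_inner_comm, hinner hst, min_eq_right hst]
  -- Continuity in L² needs no path property: the squared norm of an increment is an explicit
  -- continuous function of the times, through their minimum.
  have hkc (i : Fin d) : Continuous fun t => kH t i := by
    refine continuous_iff_continuousAt.2 fun s => tendsto_iff_norm_sub_tendsto_zero.2 ?_
    have e (t : ℝ≥0) : ‖kH t i - kH s i‖ =
        √(t * Γ i i - 2 * ((min t s : ℝ≥0) * Γ i i) + s * Γ i i) := by
      rw [@norm_eq_sqrt_real_inner, real_inner_sub_sub_self, hinner le_rfl, hinner le_rfl, hinner']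
    simp only [e]
    have hc : Continuous fun t : ℝ≥0 =>
        √(t * Γ i i - 2 * ((min t s : ℝ≥0) * Γ i i) + s * Γ i i) := by fun_prop
    have := hc.tendsto s
    rwa [min_self, show (s : ℝ) * Γ i i - 2 * (s * Γ i i) + s * Γ i i = 0 by ring, Real.sqrt_zero]
      at this
  refine ⟨fun t => h t.toNNReal, fun t => kH t.toNNReal, fun i => ⟨fun ω => ?_, fun t => ?_,
    fun t => hk _ i, (hkc i).comp continuous_real_toNNReal⟩, fun r t hr hrt i j => ?_, ?_⟩
  · exact (continuous_apply i).comp ((hcont ω).comp continuous_real_toNNReal)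
  · exact (measurable_pi_apply i).comp (hmeas _)
  · rw [hinner (Real.toNNReal_le_toNNReal hrt), Real.coe_toNNReal r hr]
  · filter_upwards [hae] with ω hω t
    exact hω _

variable {n m₁ m₂ q : ℕ} {S : Plant n m₁ m₂} {v : ℝ≥0 → Ω → Fin m₂ → ℝ} {w : ℝ≥0 → Ω → Fin n → ℝ}

/-- The noise acting on the closed loop. -/
lemma IsNoise.exists_process (h : IsNoise S P w v) (hW : S.W.PosSemidef) (hV : S.V.PosSemidef)
    (K : Controller q m₁ m₂) :
    ∃ (g : ℝ → Ω → Fin n ⊕ Fin q → ℝ) (gH : ℝ → Fin n ⊕ Fin q → Lp ℝ 2 P),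
      (∀ i, IsL2Process P (fun t ω => g t ω i) fun t => gH t i) ∧ IsWhite (clNoise S K) gH ∧
      ∀ᵐ ω ∂P, ∀ t : ℝ, g t ω = Sum.elim (w t.toNNReal ω) (K.B *ᵥ v t.toNNReal ω) := by
  obtain ⟨a, aH, ha, hwa, hae⟩ := h.wiener_w.exists_process hW
  obtain ⟨b, bH, hb, hwb, hbe⟩ := h.wiener_v.exists_process hV
  -- Independent centred variables are orthogonal, which gives the zero off-diagonal blocks of the
  -- closed-loop intensity.
  have hab (s t : ℝ) (i : Fin n) (j : Fin m₂) : inner ℝ (aH s i) (bH t j) = 0 := by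
    have hind := h.indep.comp (φ := fun f : ℝ≥0 → Fin n → ℝ => f s.toNNReal i)
      (ψ := fun f : ℝ≥0 → Fin m₂ → ℝ => f t.toNNReal j) (by fun_prop) (by fun_prop)
    have h1 := hind.integral_fun_mul_eq_mul_integral (h.wiener_w.memLp _ i).1 (h.wiener_v.memLp _ j).1
    have h2 := h.wiener_w.integral_eq_zero s.toNNReal i
    simp only [Function.comp_def, h2, zero_mul] at h1
    rw [(ha i).inner_eq (hb j), ← h1]
    refine integral_congr_ae ?_
    filter_upwards [hae, hbe] with ω h3 h4
    rw [h3, h4]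
  have hba (s t : ℝ) (i : Fin n) (j : Fin m₂) : inner ℝ (bH s j) (aH t i) = 0 := by
    rw [real_inner_comm, hab]
  refine ⟨fun t ω => Sum.elim (a t ω) (act K.B (b t ω)), fun t => Sum.elim (aH t) (act K.B (bH t)),
    ?_, ?_, ?_⟩
  · rintro (i | i)
    · exact ha i
    · exact IsL2Process.act (N := fun _ => K.B) (fun _ _ => continuous_const) hb i
  · rintro r t hr hrt (i | i) (j | j)
    · exact hwa r t hr hrt i j
    · simp [act, inner_sum, real_inner_smul_right, hab, clNoise]
    · simp [act, sum_inner, real_inner_smul_left, hba, clNoise]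
    · simp only [Sum.elim_inr, act, inner_sum, sum_inner, real_inner_smul_left, real_inner_smul_right,
        hwb r t hr hrt, clNoise, fromBlocks_apply₂₂, Matrix.mul_apply, Matrix.transpose_apply,
        Finset.mul_sum, Finset.sum_mul]
      refine Finset.sum_congr rfl fun k _ => Finset.sum_congr rfl fun l _ => by ring
  · filter_upwards [hae, hbe] with ω h1 h2 t
    rw [h1, h2, act_real]

end Noise

end LQG

end

noncomputable section

namespace LQG

/-! ### The cost of a stabilizing controller -/

section Cost

lemma forced_eq_add_integral {σ : Type*} [Fintype σ] [DecidableEq σ] {A : Matrix σ σ ℝ}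
    {g : ℝ → σ → ℝ} (hg : ∀ i, Continuous fun t => g t i) (t : ℝ) (i : σ) :
    forced A g t i = g t i + ∫ s in (0 : ℝ)..t, act A (forced A g s) i := by
  rw [intervalIntegral.integral_eq_sub_of_hasDerivAt (fun s _ => hasDerivAt_drift hg s i)
    ((continuous_act A (continuous_forced hg) i).intervalIntegrable _ _), drift_zero]
  simp [forced]

lemma integral_linear {ι : Type*} [Fintype ι] {f : ℝ → ι → ℝ} {a b : ℝ}
    (hf : IntervalIntegrable f volume a b) (L : (ι → ℝ) →ₗ[ℝ] ℝ) :
    L (∫ t in a..b, f t) = ∫ t in a..b, L (f t) :=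
  (ContinuousLinearMap.intervalIntegral_comp_comm (LinearMap.toContinuousLinearMap L) hf).symm

variable {n m₁ m₂ q : ℕ} {S : Plant n m₁ m₂} {K : Controller q m₁ m₂}

lemma act_clA (S : Plant n m₁ m₂) (K : Controller q m₁ m₂) (x : Fin n → ℝ) (z : Fin q → ℝ) :
    act (clA S K) (Sum.elim x z) =
      Sum.elim (S.A *ᵥ x + S.B *ᵥ (K.C *ᵥ z)) (K.B *ᵥ (S.C *ᵥ x) + K.A *ᵥ z) := by
  rw [act_real, clA, fromBlocks_mulVec]
  simp [Matrix.mulVec_mulVec]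

lemma closedLoop_iff {x : ℝ → Fin n → ℝ} {z : ℝ → Fin q → ℝ} (hx : ContinuousOn x (Set.Ici 0))
    (hz : ContinuousOn z (Set.Ici 0)) {t : ℝ} (ht : 0 ≤ t) (a : Fin n → ℝ) (b : Fin m₂ → ℝ) :
    (x t = x 0 + (∫ s in (0 : ℝ)..t, (S.A *ᵥ x s + S.B *ᵥ (K.C *ᵥ z s))) + a ∧
      z t = z 0 + (∫ s in (0 : ℝ)..t, K.A *ᵥ z s) +
        K.B *ᵥ ((∫ s in (0 : ℝ)..t, S.C *ᵥ x s) + b)) ↔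
    ∀ i, Sum.elim (x t) (z t) i = Sum.elim (x 0) (z 0) i +
      (∫ s in (0 : ℝ)..t, act (clA S K) (Sum.elim (x s) (z s)) i) + Sum.elim a (K.B *ᵥ b) i := by
  have hsub : Set.uIcc 0 t ⊆ Set.Ici 0 := by
    rw [Set.uIcc_of_le ht]
    exact fun s hs => hs.1
  have hmv {k l : ℕ} (M : Matrix (Fin k) (Fin l) ℝ) : Continuous fun y : Fin l → ℝ => M *ᵥ y :=
    continuous_const.matrix_mulVec continuous_id
  have hx' := hx.mono hsub
  have hz' := hz.mono hsub
  have h1 : IntervalIntegrable (fun s => S.A *ᵥ x s + S.B *ᵥ (K.C *ᵥ z s)) volume 0 t :=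
    (((hmv _).comp_continuousOn hx').add
      ((hmv _).comp_continuousOn ((hmv _).comp_continuousOn hz'))).intervalIntegrable
  have h2 : IntervalIntegrable (fun s => K.A *ᵥ z s) volume 0 t :=
    ((hmv _).comp_continuousOn hz').intervalIntegrable
  have h3 : IntervalIntegrable (fun s => S.C *ᵥ x s) volume 0 t :=
    ((hmv _).comp_continuousOn hx').intervalIntegrable
  have h4 : IntervalIntegrable (fun s => K.B *ᵥ (S.C *ᵥ x s)) volume 0 t :=
    ((hmv _).comp_continuousOn ((hmv _).comp_continuousOn hx')).intervalIntegrable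
  simp only [act_clA, Sum.forall, Sum.elim_inl, Sum.elim_inr]
  refine and_congr ?_ ?_
  · rw [funext_iff]
    refine forall_congr' fun i => ?_
    have := integral_linear h1 (LinearMap.proj i)
    simp only [LinearMap.proj_apply] at this
    rw [Pi.add_apply, Pi.add_apply, this]
  · rw [funext_iff]
    refine forall_congr' fun i => ?_
    have e2 := integral_linear h2 (LinearMap.proj i)
    have e3 := integral_linear h3 (LinearMap.proj i ∘ₗ K.B.mulVecLin)
    have e4 := integral_linear (h4.add h2) (LinearMap.proj i)
    have e5 := intervalIntegral.integral_add h4 h2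
    have e6 := integral_linear h4 (LinearMap.proj i)
    simp only [LinearMap.proj_apply, LinearMap.comp_apply, Matrix.mulVecLin_apply] at e2 e3 e4 e6
    have e : ∫ s in (0 : ℝ)..t, (K.B *ᵥ (S.C *ᵥ x s) + K.A *ᵥ z s) i =
        (K.B *ᵥ ∫ s in (0 : ℝ)..t, S.C *ᵥ x s) i + (∫ s in (0 : ℝ)..t, K.A *ᵥ z s) i := by
      rw [← e4, e5, Pi.add_apply, e6, e3]
    rw [e, Matrix.mulVec_add, Pi.add_apply, Pi.add_apply, Pi.add_apply]
    constructor <;> intro h <;> rw [h] <;> ring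

/-- The running cost as a quadratic form of the closed-loop state. -/
def clCost (S : Plant n m₁ m₂) (K : Controller q m₁ m₂) :
    Matrix (Fin n ⊕ Fin q) (Fin n ⊕ Fin q) ℝ := fromBlocks S.Q 0 0 (K.Cᵀ * S.R * K.C)

lemma quad_clCost (S : Plant n m₁ m₂) (K : Controller q m₁ m₂) (x : Fin n → ℝ) (z : Fin q → ℝ) :
    Sum.elim x z ⬝ᵥ (clCost S K *ᵥ Sum.elim x z) =
      x ⬝ᵥ (S.Q *ᵥ x) + (K.C *ᵥ z) ⬝ᵥ (S.R *ᵥ (K.C *ᵥ z)) := by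
  rw [clCost, fromBlocks_mulVec, sumElim_dotProduct_sumElim]
  simp [← Matrix.mulVec_mulVec, Matrix.dotProduct_mulVec, Matrix.vecMul_transpose]

lemma posSemidef_clCost (hQ : S.Q.PosSemidef) (hR : S.R.PosSemidef) (K : Controller q m₁ m₂) :
    (clCost S K).PosSemidef := by
  refine PosSemidef.of_dotProduct_mulVec_nonneg ?_ fun y => ?_
  · simp [Matrix.IsHermitian, clCost, fromBlocks_transpose, transpose_eq_of_posSemidef hQ,
      transpose_eq_of_posSemidef hR, Matrix.mul_assoc]
  · rw [← Sum.elim_comp_inl_inr y, star_trivial, quad_clCost]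
    exact add_nonneg (PosSemidef.quad_nonneg hQ _) (PosSemidef.quad_nonneg hR _)

/-- Duality between the covariance that defines the stationary cost and the energy matrix that
governs the long-run average. -/
lemma controllerCost_eq_trace (hK : Stabilizes S K) {P : Matrix (Fin n ⊕ Fin q) (Fin n ⊕ Fin q) ℝ}
    (hP : (clA S K)ᵀ * P + P * clA S K = -clCost S K) :
    controllerCost S K = (P * clNoise S K).trace := by
  rw [Matrix.trace_mul_comm, ← trace_lyapunov_duality (gramSigma_eq hK) hP, controllerCost, loopCost,
    clCost]
  conv_rhs => rw [← fromBlocks_toBlocks (gramSigma S K), fromBlocks_multiply, trace_fromBlocks]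
  conv_lhs => rw [← fromBlocks_toBlocks (gramSigma S K)]
  simp only [fromCols_mul_fromBlocks, transpose_fromCols, fromCols_mul_fromRows, Matrix.transpose_zero,
    Matrix.zero_mul, Matrix.mul_zero, Matrix.one_mul, Matrix.mul_one, Matrix.transpose_one, add_zero,
    zero_add]
  rw [Matrix.mul_assoc K.Cᵀ, Matrix.mul_assoc K.Cᵀ, Matrix.trace_mul_comm K.Cᵀ]
  simp only [Matrix.mul_assoc]

variable {Ω : Type*} [MeasurableSpace Ω] {P : Measure Ω} [IsProbabilityMeasure P]
  {w : ℝ≥0 → Ω → Fin n → ℝ} {v : ℝ≥0 → Ω → Fin m₂ → ℝ}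

/-- A stabilizing controller has a cost, given by the stationary covariance. -/
lemma hasCost_controllerCost (hQ : S.Q.PosSemidef) (hR : S.R.PosSemidef) (hW : S.W.PosSemidef)
    (hV : S.V.PosSemidef) (hwv : IsNoise S P w v) (hK : Stabilizes S K) :
    HasCost S P w v K (controllerCost S K) := by
  obtain ⟨g, gH, hg, hwhite, hae⟩ := hwv.exists_process hW hV K
  have hgc (ω : Ω) (i) : Continuous fun t => g t ω i := (hg i).cont ω
  have hξ := IsL2Process.forced (clA S K) hg
  set ξ : ℝ → Ω → Fin n ⊕ Fin q → ℝ := fun t ω => forced (clA S K) (fun t => g t ω) t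
  have hξe (ω : Ω) (t : ℝ) (i) : ξ t ω i = g t ω i + ∫ s in (0 : ℝ)..t, act (clA S K) (ξ s ω) i :=
    forced_eq_add_integral (hgc ω) t i
  constructor
  -- The forced response with zero initial state is a trajectory, which settles existence.
  · refine ⟨fun t ω i => ξ t ω (Sum.inl i), fun t ω i => ξ t ω (Sum.inr i), ?_⟩
    have hcx (ω : Ω) : Continuous fun t => fun i => ξ t ω (Sum.inl i) :=
      continuous_pi fun i => (hξ _).cont ω
    have hcz (ω : Ω) : Continuous fun t => fun i => ξ t ω (Sum.inr i) :=
      continuous_pi fun i => (hξ _).cont ω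
    have hg0 : ∀ᵐ ω ∂P, g 0 ω = 0 := by
      filter_upwards [hae, hwv.wiener_w.zero, hwv.wiener_v.zero] with ω h1 h2 h3
      rw [h1, Real.toNNReal_zero, h2, h3, Matrix.mulVec_zero]
      ext i
      cases i <;> rfl
    have hξ0 : ∀ᵐ ω ∂P, ξ 0 ω = 0 := by
      filter_upwards [hg0] with ω h
      ext i
      rw [hξe, h]
      simp
    have heq (ω : Ω) (h1 : ∀ t : ℝ, g t ω = Sum.elim (w t.toNNReal ω) (K.B *ᵥ v t.toNNReal ω))
        (h2 : ξ 0 ω = 0) (t : ℝ≥0) :=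
      (closedLoop_iff (S := S) (K := K) (hcx ω).continuousOn (hcz ω).continuousOn t.2 (w t ω)
        (v t ω)).2 (by
          intro i
          have e (s : ℝ) : (Sum.elim (fun i => ξ s ω (Sum.inl i)) fun i => ξ s ω (Sum.inr i)) =
            ξ s ω := Sum.elim_comp_inl_inr _
          simp only [e, NNReal.val_eq_coe]
          rw [hξe, h1, h2, Real.toNNReal_coe, Pi.zero_apply, zero_add, add_comm])
    refine ⟨?_, ?_, Eventually.of_forall fun ω => (hcx ω).continuousOn,
      Eventually.of_forall fun ω => (hcz ω).continuousOn, ?_, ?_⟩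
    · refine (MemLp.zero' (ε := Fin n → ℝ)).ae_eq ?_
      filter_upwards [hξ0] with ω h
      rw [h]
      rfl
    · refine (MemLp.zero' (ε := Fin q → ℝ)).ae_eq ?_
      filter_upwards [hξ0] with ω h
      rw [h]
      rfl
    · filter_upwards [hae, hξ0] with ω h1 h2 t using (heq ω h1 h2 t).1
    · filter_upwards [hae, hξ0] with ω h1 h2 t using (heq ω h1 h2 t).2
  · intro x z hxz
    have hinit (i : Fin n ⊕ Fin q) : MemLp (fun ω => Sum.elim (x 0 ω) (z 0 ω) i) 2 P := by
      rcases i with i | i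
      · exact (ContinuousLinearMap.proj (R := ℝ) (φ := fun _ => ℝ) i).comp_memLp' hxz.init_x
      · exact (ContinuousLinearMap.proj (R := ℝ) (φ := fun _ => ℝ) i).comp_memLp' hxz.init_z
    set f : Ω → Fin n ⊕ Fin q → ℝ := fun ω i => (hinit i).1.aemeasurable.mk _ ω
    set fH : Fin n ⊕ Fin q → Lp ℝ 2 P := fun i => (hinit i).toLp _
    have hf (i) : IsL2Process P (fun _ ω => f ω i) (fun _ => fH i) :=
      IsL2Process.const (hinit i).1.aemeasurable.measurable_mk
        ((MemLp.coeFn_toLp _).trans (hinit i).1.aemeasurable.ae_eq_mk)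
    have hX (i) := (IsL2Process.act (continuous_flow (clA S K)) (x := fun _ => f) hf i).add (hξ i)
    set X : ℝ → Ω → Fin n ⊕ Fin q → ℝ := fun t ω => act (flow (clA S K) t) (f ω) + ξ t ω
    have hpath : ∀ᵐ ω ∂P, ∀ t, 0 ≤ t → Sum.elim (x t ω) (z t ω) = X t ω := by
      have h0 : ∀ᵐ ω ∂P, ∀ i, Sum.elim (x 0 ω) (z 0 ω) i = f ω i :=
        ae_all_iff.2 fun i => (hinit i).1.aemeasurable.ae_eq_mk
      filter_upwards [h0, hae, hxz.cont_x, hxz.cont_z, hxz.eq_x, hxz.eq_z] with ω h0 h1 hcx hcz hex hez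
      have hs (t : ℝ) (ht : 0 ≤ t) (i) := (closedLoop_iff (S := S) (K := K) hcx hcz ht
        (w t.toNNReal ω) (v t.toNNReal ω)).1
        ⟨by simpa [Real.coe_toNNReal t ht] using hex t.toNNReal,
          by simpa [Real.coe_toNNReal t ht] using hez t.toNNReal⟩ i
      have hsc (i) : ContinuousOn (fun t => Sum.elim (x t ω) (z t ω) i) (Set.Ici 0) := by
        rcases i with i | i
        · exact (continuous_apply i).comp_continuousOn hcx
        · exact (continuous_apply i).comp_continuousOn hcz
      have hg0 (i) : g 0 ω i = 0 := by
        have := hs 0 le_rfl i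
        rw [← h1] at this
        simpa using this
      have hac (i) : ContinuousOn (fun s => act (clA S K) (Sum.elim (x s ω) (z s ω)) i) (Set.Ici 0) :=
        continuousOn_finsetSum _ fun j _ => (hsc j).const_smul (clA S K i j)
      -- The noise cancels in the difference between an arbitrary trajectory and the forced
      -- response, so the difference solves the homogeneous equation and is the flow of the initial
      -- value.
      set y : ℝ → Fin n ⊕ Fin q → ℝ := fun t => Sum.elim (x t ω) (z t ω) - ξ t ω with hy
      have hy0 : y 0 = f ω := by
        ext i
        simp only [hy, Pi.sub_apply, h0]
        rw [hξe, hg0]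
        simp
      have key (t : ℝ) (ht : 0 ≤ t) : y t = act (flow (clA S K) t) (y 0) := by
        refine eq_flow_of_integral_eq (y := y) (fun i => (hsc i).sub ((hξ i).cont ω).continuousOn)
          (fun t ht i => ?_) ht
        have e (s : ℝ) : act (clA S K) (y s) i =
            act (clA S K) (Sum.elim (x s ω) (z s ω)) i - act (clA S K) (ξ s ω) i := by
          simp only [hy, act_real, Matrix.mulVec_sub, Pi.sub_apply]
        simp only [e]
        rw [intervalIntegral.integral_sub ((hac i).mono fun s hs => ?_).intervalIntegrable
          ((continuous_act _ (fun j => (hξ j).cont ω) i).intervalIntegrable _ _), hy0, ← h0]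
        · simp only [hy, Pi.sub_apply]
          rw [hs t ht, hξe, h1]
          ring
        · rw [Set.uIcc_of_le ht] at hs
          exact hs.1
      intro t ht
      have := key t ht
      rw [hy0, hy, sub_eq_iff_eq_add] at this
      exact this
    have hcost (T : ℝ) (hT : 0 ≤ T) : pathCost S K x z T =ᵐ[P]
        fun ω => ∫ t in (0 : ℝ)..T, X t ω ⬝ᵥ (clCost S K *ᵥ X t ω) := by
      filter_upwards [hpath] with ω h
      refine intervalIntegral.integral_congr fun t ht => ?_
      rw [Set.uIcc_of_le hT] at ht
      simp only [← h t ht.1, quad_clCost]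
    have hM := posSemidef_clCost hQ hR K
    obtain ⟨E, hE, hEM⟩ := Hurwitz.exists_energyMatrix (A := clA S K) hK hM
    have hΓ : (clNoise S K)ᵀ = clNoise S K := by
      simp [clNoise, fromBlocks_transpose, transpose_eq_of_posSemidef hW, transpose_eq_of_posSemidef hV,
        Matrix.mul_assoc]
    have hlim := hwhite.tendsto_average (A := clA S K) hK (fun i => (hg i).contH) hΓ hM hE hEM fH
    rw [← controllerCost_eq_trace hK hEM] at hlim
    refine ⟨fun T hT => (IsL2Process.integrable_integral_bil (clCost S K) hX hT.le).1.congr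
      (hcost T hT.le).symm, hlim.congr' ?_⟩
    filter_upwards [eventually_ge_atTop 0] with T hT
    rw [integral_congr_ae (hcost T hT)]
    exact congrArg (1 / T * ·) (IsL2Process.integrable_integral_bil (clCost S K) hX hT).2.symm

end Cost

end LQG

end

/-! ### Assembly of the theorem -/

theorem theorem5 {n m₁ m₂ q : ℕ} (S : LQG.Plant n m₁ m₂)
    (hQ : S.Q.PosDef) (hR : S.R.PosDef) (hW : S.W.PosDef) (hV : S.V.PosDef)
    {Ω : Type*} [MeasurableSpace Ω] (P : Measure Ω) [IsProbabilityMeasure P]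
    (w : ℝ≥0 → Ω → Fin n → ℝ) (v : ℝ≥0 → Ω → Fin m₂ → ℝ) (hwv : LQG.IsNoise S P w v)
    (K₀ : LQG.Controller q m₁ m₂) (hK₀ : LQG.Stabilizes S K₀) :
    (∃ L, LQG.IsSmoothnessConstant S K₀ L) ∧
    ∃ Jopt : ℝ,
      LQG.IsOptimalValue S P w v Jopt ∧
      (n ≤ q → LQG.IsOptimalOfOrder S P w v q Jopt) ∧
      ∀ L, LQG.IsSmoothnessConstant S K₀ L → ∀ η : ℝ, 0 < η → η < 2 / L →
        (∀ k, LQG.iterates S K₀ η k ∈ LQG.paramSpace q m₁ m₂) ∧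
        (∀ k, Jopt ≤ LQG.liftedCost S K₀ (LQG.iterates S K₀ η k)) ∧
        Tendsto (fun k => LQG.liftedCost S K₀ (LQG.iterates S K₀ η k)) atTop (𝓝 Jopt) ∧
        ∃ c : ℝ, ∀ k : ℕ, 1 ≤ k →
          LQG.liftedCost S K₀ (LQG.iterates S K₀ η k) - Jopt ≤ c / k := by
  obtain ⟨F, P', L₀, Y, hr⟩ := LQG.exists_riccatiPair S hQ hR hW hV K₀ hK₀
  have hcost {p : ℕ} {K : LQG.Controller p m₁ m₂} (hK : LQG.Stabilizes S K) :=
    LQG.hasCost_controllerCost hQ.posSemidef hR.posSemidef hW.posSemidef hV.posSemidef hwv hK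
  have hlower {p : ℕ} (K : LQG.Controller p m₁ m₂) (hK : LQG.Stabilizes S K) :
      ∃ c, LQG.HasCost S P w v K c ∧ LQG.lqgValue S F P' Y ≤ c :=
    ⟨_, hcost hK, LQG.lqgValue_le_controllerCost hr hR hV hK⟩
  -- The Kalman controller needs n states. An isometric embedding realizes it with any larger order,
  -- which is where `n ≤ q` enters.
  have hattained {p : ℕ} (hp : n ≤ p) : ∃ K : LQG.Controller p m₁ m₂,
      LQG.Stabilizes S K ∧ LQG.HasCost S P w v K (LQG.lqgValue S F P' Y) := by
    obtain ⟨J, hJ⟩ := LQG.exists_isometry hp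
    have hs := LQG.stabilizes_kalman hr hJ
    exact ⟨_, hs, LQG.controllerCost_kalman hr hJ ▸ hcost hs⟩
  refine ⟨LQG.exists_smoothnessConstant hQ hR hW hV hK₀, LQG.lqgValue S F P' Y,
    ⟨⟨n, hattained le_rfl⟩, fun p K hK => hlower K hK⟩, fun hnq => ⟨hattained hnq, hlower⟩,
    fun L hL η hη hηL => ?_⟩
  have hmem := LQG.iterates_mem hQ hR hW hV hK₀ η
  have hopt := LQG.liftedCost_optParam hr hQ hR hW hV hK₀
  have hle {X} (hX) := LQG.lqgValue_le_liftedCost (X := X) hr hQ hR hW hV hK₀ hX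
  have hconv := LQG.sublinear_convergence hL hη hηL hQ hR hW hV hK₀ (LQG.optParam_mem hr)
    fun X hX => hopt.trans_le (hle hX)
  rw [hopt] at hconv
  exact ⟨hmem, fun k => hle (hmem k), hconv⟩
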